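/- Let $0\le q\le p$ and $D\ge p+q+2$ be integers, and let $\mathbb R^{D}$ carry the Minkowski metric $\eta=\mathrm{diag}(-1,1,\dots,1)$, with $k\cdot x=\eta_{\mu\nu}k^\mu x^\nu$. For a space with metric $g$, the traceless tensors of type $[a,b]$ are the complex tensors $T_{\mu_1\dots\mu_a|\nu_1\dots\nu_b}$ that are antisymmetric in the $\mu$'s and in the $\nu$'s and satisfy $T_{[\mu_1\dots\mu_a|\nu_1]\nu_2\dots\nu_b}=0$ and $g^{\mu_1\nu_1}T_{\mu_1\dots\mu_a|\nu_1\dots\nu_b}=0$ (the last two conditions being void when they make no sense). A \emph{harmonic multiform} is a $C^2$ field $K$ on $\mathbb R^{D}$ with values in the traceless tensors of type $[p+1,q+1]$ of $O(D-1,1)$ that is closed and coclosed in both columns: $$\partial_{[\mu_0}K_{\mu_1\dots\mu_{p+1}]|\nu_1\dots\nu_{q+1}}=0=K_{\mu_1\dots\mu_{p+1}|[\nu_1\dots\nu_{q+1},\nu_0]},\qquad \partial^{\mu_1}K_{\mu_1\dots\mu_{p+1}|\nu_1\dots\nu_{q+1}}=0=\partial^{\nu_1}K_{\mu_1\dots\mu_{p+1}|\nu_1\dots\nu_{q+1}}.$$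 For $k\in\mathbb R^D$ let $\mathcal H_k$ be the space of harmonic multiforms of momentum $k$, i.e. those with $K(x+a)=e^{ik\cdot a}K(x)$ for all $a,x$. Then: 1. Every harmonic multiform satisfies $\Box K=\eta^{\mu\nu}\partial_\mu\partial_\nu K=0$. If $K$ is polynomially bounded, its Fourier transform, as a tempered distribution, is supported on the light-cone: for every component $K_{\alpha|\beta}$, $\int K_{\alpha|\beta}(x)\big(\int e^{ik\cdot x}g(k)\,dk\big)dx=0$ for every Schwartz function $g$ such that $k\cdot k\ne0$ for all $k$ in the (closed) support of $g$. 2. For a measure $m$ on momentum space and a tensor-valued amplitude $f$ with $(1+|k|^2)f\in L^1(m)$, the superposition $\int e^{ik\cdot x}f(k)\,dm(k)$ is a harmonic multiform if and only if $e^{ik\cdot x}f(k)\in\mathcal H_k$ for $m$-almost every $k$; and $\mathcal H_k=0$ whenever $k\cdot k\neq0$. 3. The space $V_{[p,q]}$ of traceless tensors of type $[p,q]$ on Euclidean $\mathbb R^{D-2}$ is a unitary irreducible complex representation of $O(D-2)$. 4. Let $k\neq0$ with $k\cdot k=0$. Then $\mathcal H_k$ consists of plane waves $e^{ik\cdot x}K(0)$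 and is stable under the stabilizer $G_k$ of $k$ in $O(D-1,1)$, acting by $(\Lambda K)(x)(v|w)=K(\Lambda^{-1}x)(\Lambda^{-1}v|\Lambda^{-1}w)$; it is a unitary irreducible representation of $G_k$. There are light-cone frames $(e_+,e_-,e_1,\dots,e_{D-2})$, with $e_\pm$ null, $e_+\cdot e_-=-1$, $e_\pm\cdot e_i=0$ and $e_i\cdot e_j=\delta_{ij}$, such that $k\in\mathbb R e_+$, and for each such frame the following holds. The map $\Lambda\mapsto(e_i\cdot\Lambda e_j)_{ij}$ is a group homomorphism $r\colon G_k\to O(D-2)$, which maps the subgroup of $G_k$ fixing $e_-$ onto $O(D-2)$. With $k_-=k\cdot e_-$, the map $K\mapsto\phi$, $$\phi_{i_1\dots i_p|j_1\dots j_q}=\frac{(p+1)(q+1)}{k_-^2}\,K_{-i_1\dots i_p|j_1\dots j_q-}(0),$$ is a linear isomorphism of $\mathcal H_k$ onto $V_{[p,q]}$ that intertwines $\Lambda\in G_k$ with $r(\Lambda)\in O(D-2)$. Thus the harmonic multiforms of any given nonzero light-like momentum form the unitary irreducible $O(D-2)$-module associated with the Young diagram $[p,q]$. -/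

import Mathlib

open scoped Matrix

noncomputable section

namespace LightCone

/-! ### Two-column tensors -/

/-- Complex tensors with two groups of (lower) indices, `T_{μ₁…μₐ|ν₁…ν_b}`, given by their
components in a basis indexed by `ι`. -/
abbrev BiTensor (ι : Type) (a b : ℕ) : Type := (Fin a → ι) → (Fin b → ι) → ℂ

/-- Complete antisymmetrization with strength one, `f_{[κ₁…κ_m]}`. -/
def alt {ι : Type} {m : ℕ} (f : (Fin m → ι) → ℂ) (κ : Fin m → ι) : ℂ :=
  ((m.factorial : ℂ))⁻¹ * ∑ σ : Equiv.Perm (Fin m), ((Equiv.Perm.sign σ : ℤ) : ℂ) * f (κ ∘ σ)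

theorem alt_add {ι : Type} {m : ℕ} (f g : (Fin m → ι) → ℂ) (κ : Fin m → ι) :
    alt (fun κ => f κ + g κ) κ = alt f κ + alt g κ := by
  simp [alt, mul_add, Finset.sum_add_distrib]

theorem alt_smul {ι : Type} {m : ℕ} (c : ℂ) (f : (Fin m → ι) → ℂ) (κ : Fin m → ι) :
    alt (fun κ => c * f κ) κ = c * alt f κ := by
  simp only [alt, Finset.mul_sum]
  exact Finset.sum_congr rfl fun σ _ => by ring

theorem alt_zero {ι : Type} {m : ℕ} (κ : Fin m → ι) : alt (fun _ => (0 : ℂ)) κ = 0 := by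
  simp [alt]

/-- The traceless tensors with the symmetry of the Young diagram `[a,b]` (two columns, of lengths
`a` and `b`), the trace being taken with the inverse metric `g`: the tensor is antisymmetric in
each column, antisymmetrizing the first column together with an index of the second one gives
zero, and all traces between the columns vanish. -/
def youngTraceless {ι : Type} [Fintype ι] (g : Matrix ι ι ℝ) (a b : ℕ) :
    Submodule ℂ (BiTensor ι a b) where
  carrier := {T |
    (∀ μ ν, alt (fun κ => T κ ν) μ = T μ ν) ∧
    (∀ μ ν, alt (fun κ => T μ κ) ν = T μ ν) ∧
    (∀ (κ : Fin (a + 1) → ι) (ν : Fin b → ι) (j : Fin b),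
      alt (fun κ => T (Fin.init κ) (Function.update ν j (κ (Fin.last a)))) κ = 0) ∧
    (∀ (μ : Fin a → ι) (ν : Fin b → ι) (i : Fin a) (j : Fin b),
      ∑ α, ∑ β, (g α β : ℂ) * T (Function.update μ i α) (Function.update ν j β) = 0)}
  zero_mem' := by
    refine ⟨?_, ?_, ?_, ?_⟩ <;> intros <;> simp [alt_zero]
  add_mem' := by
    rintro S T ⟨hS₁, hS₂, hS₃, hS₄⟩ ⟨hT₁, hT₂, hT₃, hT₄⟩
    refine ⟨?_, ?_, ?_, ?_⟩ <;> intros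
    · simp only [Pi.add_apply, alt_add, hS₁, hT₁]
    · simp only [Pi.add_apply, alt_add, hS₂, hT₂]
    · simp only [Pi.add_apply, alt_add, hS₃, hT₃, add_zero]
    · simp only [Pi.add_apply, mul_add, Finset.sum_add_distrib, hS₄, hT₄, add_zero]
  smul_mem' := by
    rintro c T ⟨hT₁, hT₂, hT₃, hT₄⟩
    refine ⟨?_, ?_, ?_, ?_⟩ <;> intros
    · simp only [Pi.smul_apply, smul_eq_mul, alt_smul, hT₁]
    · simp only [Pi.smul_apply, smul_eq_mul, alt_smul, hT₂]
    · simp only [Pi.smul_apply, smul_eq_mul, alt_smul, hT₃, mul_zero]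
    · simp only [Pi.smul_apply, smul_eq_mul, mul_left_comm _ c, ← Finset.mul_sum, hT₄, mul_zero]

/-- The contraction `T(u₁,…,uₐ | v₁,…,v_b)` of a tensor with vectors. -/
def contract {ι : Type} [Fintype ι] {a b : ℕ} (T : BiTensor ι a b)
    (u : Fin a → ι → ℝ) (v : Fin b → ι → ℝ) : ℂ :=
  ∑ α : Fin a → ι, ∑ β : Fin b → ι,
    ((∏ i, u i (α i) : ℝ) : ℂ) * ((∏ j, v j (β j) : ℝ) : ℂ) * T α β

/-- The pull-back of a tensor by a matrix, `(M^* T)(e_μ | e_ν) = T(M e_μ | M e_ν)`. -/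
def pull {ι : Type} [Fintype ι] {a b : ℕ} (M : Matrix ι ι ℝ) :
    BiTensor ι a b →ₗ[ℂ] BiTensor ι a b where
  toFun T μ ν := contract T (fun i α => M α (μ i)) (fun j β => M β (ν j))
  map_add' S T := by
    funext μ ν
    simp [contract, mul_add, Finset.sum_add_distrib]
  map_smul' c T := by
    funext μ ν
    simp only [contract, Pi.smul_apply, smul_eq_mul, RingHom.id_apply, mul_left_comm _ c,
      Finset.mul_sum]

theorem sum_prod_one {ι : Type} [Fintype ι] [DecidableEq ι] {a : ℕ} (μ : Fin a → ι)
    (f : (Fin a → ι) → ℂ) :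
    ∑ α : Fin a → ι, ((∏ i, (1 : Matrix ι ι ℝ) (α i) (μ i) : ℝ) : ℂ) * f α = f μ := by
  rw [Finset.sum_eq_single μ]
  · simp
  · intro α _ h
    obtain ⟨i, hi⟩ := Function.ne_iff.mp h
    have h0 : ∏ i, (1 : Matrix ι ι ℝ) (α i) (μ i) = 0 :=
      Finset.prod_eq_zero (Finset.mem_univ i) (Matrix.one_apply_ne hi)
    simp only [h0, Complex.ofReal_zero, zero_mul]
  · simp

theorem sum_prod_mul {ι : Type} [Fintype ι] {a : ℕ} (M N : Matrix ι ι ℝ) (α μ : Fin a → ι) :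
    ∏ i, (M * N) (α i) (μ i) =
      ∑ β : Fin a → ι, (∏ i, M (α i) (β i)) * ∏ i, N (β i) (μ i) := by
  classical
  simp only [Matrix.mul_apply, Finset.prod_univ_sum, Fintype.piFinset_univ,
    Finset.prod_mul_distrib]

theorem pull_one {ι : Type} [Fintype ι] [DecidableEq ι] {a b : ℕ} (T : BiTensor ι a b) :
    pull (1 : Matrix ι ι ℝ) T = T := by
  funext μ ν
  change ∑ α : Fin a → ι, ∑ β : Fin b → ι, _ = _
  simp only [mul_assoc, ← Finset.mul_sum]
  simp only [sum_prod_one ν, sum_prod_one μ fun α => T α ν]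

theorem sum_rotate {A B : Type} [Fintype A] [Fintype B] (F : A → B → B → A → ℂ) :
    ∑ α, ∑ β, ∑ δ, ∑ γ, F α β δ γ = ∑ γ, ∑ δ, ∑ α, ∑ β, F α β δ γ := by
  have h₁ : ∑ α, ∑ β, ∑ δ, ∑ γ, F α β δ γ =
      ∑ x : A × B, ∑ y : A × B, F x.1 x.2 y.2 y.1 := by
    simp only [Fintype.sum_prod_type]
    exact Finset.sum_congr rfl fun α _ => Finset.sum_congr rfl fun β _ => Finset.sum_comm
  rw [h₁, Finset.sum_comm]
  simp only [Fintype.sum_prod_type]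

theorem pull_mul {ι : Type} [Fintype ι] [DecidableEq ι] {a b : ℕ} (M N : Matrix ι ι ℝ)
    (T : BiTensor ι a b) : pull (M * N) T = pull N (pull M T) := by
  funext μ ν
  change ∑ α : Fin a → ι, ∑ β : Fin b → ι, _ =
    ∑ γ : Fin a → ι, ∑ δ : Fin b → ι, _ * ∑ α : Fin a → ι, ∑ β : Fin b → ι, _
  simp only [sum_prod_mul, Complex.ofReal_sum, Finset.sum_mul, Finset.mul_sum]
  rw [sum_rotate]
  refine Finset.sum_congr rfl fun γ _ => Finset.sum_congr rfl fun δ _ =>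
    Finset.sum_congr rfl fun α _ => Finset.sum_congr rfl fun β _ => ?_
  push_cast
  ring

/-- The representation of a group of matrices on tensors with lower indices,
`(g T)(v | w) = T(g⁻¹ v | g⁻¹ w)`. -/
def tensorRep {ι G : Type} [Fintype ι] [DecidableEq ι] [Group G] (e : G →* Matrix ι ι ℝ)
    (a b : ℕ) : Representation ℂ G (BiTensor ι a b) where
  toFun g := pull (e g⁻¹)
  map_one' := by
    refine LinearMap.ext fun T => ?_
    simp [pull_one]
  map_mul' g h := by
    refine LinearMap.ext fun T => ?_
    simp [pull_mul]

/-- The representation of `O(n)` on tensors. -/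
def orthogonalRep (n a b : ℕ) :
    Representation ℂ (Matrix.orthogonalGroup (Fin n) ℝ) (BiTensor (Fin n) a b) :=
  tensorRep (Matrix.orthogonalGroup (Fin n) ℝ).subtype a b

/-- A representation is unitary if it preserves a (positive definite Hermitian) inner product and
has continuous matrix coefficients. -/
def IsUnitary {G V : Type} [Group G] [TopologicalSpace G] [AddCommGroup V] [Module ℂ V]
    (ρ : Representation ℂ G V) : Prop :=
  ∃ c : InnerProductSpace.Core ℂ V,
    (∀ g u v, c.inner (ρ g u) (ρ g v) = c.inner u v) ∧
    (∀ u v, Continuous fun g => c.inner u (ρ g v))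

/-! ### Minkowski spacetime of dimension `D = n + 2` -/

/-- Spacetime vectors (also used for momenta `k^μ`); the time direction has index `0`. -/
abbrev Spacetime (n : ℕ) : Type := Fin (n + 2) → ℝ

/-- The Minkowski metric `diag(-1, 1, …, 1)`, which is its own inverse. -/
def eta (n : ℕ) : Matrix (Fin (n + 2)) (Fin (n + 2)) ℝ :=
  Matrix.diagonal fun μ => if μ = 0 then -1 else 1

/-- The Minkowski product `η_{μν} x^μ y^ν`. -/
def mdot {n : ℕ} (x y : Spacetime n) : ℝ := x ⬝ᵥ (eta n *ᵥ y)

/-- The Lorentz group `O(D-1,1)`. -/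
def lorentzGroup (n : ℕ) : Subgroup (GL (Fin (n + 2)) ℝ) where
  carrier := {g | ∀ x y, mdot (g.1 *ᵥ x) (g.1 *ᵥ y) = mdot x y}
  one_mem' := by intro x y; simp
  mul_mem' := by
    intro g h hg hh x y
    simp only [Units.val_mul, ← Matrix.mulVec_mulVec]
    rw [hg, hh]
  inv_mem' := by
    intro g hg x y
    have key : ∀ z, g.1 *ᵥ ((g⁻¹).1 *ᵥ z) = z := fun z => by
      rw [Matrix.mulVec_mulVec, ← Units.val_mul, mul_inv_cancel, Units.val_one, Matrix.one_mulVec]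
    have := hg ((g⁻¹).1 *ᵥ x) ((g⁻¹).1 *ᵥ y)
    rw [key, key] at this
    exact this.symm

/-- The matrix of a Lorentz transformation. -/
def lorentzMatrix (n : ℕ) : lorentzGroup n →* Matrix (Fin (n + 2)) (Fin (n + 2)) ℝ :=
  (Units.coeHom _).comp (lorentzGroup n).subtype

/-- The stabilizer of the momentum `k` in the Lorentz group. -/
def stabilizer {n : ℕ} (k : Spacetime n) : Subgroup (lorentzGroup n) where
  carrier := {g | lorentzMatrix n g *ᵥ k = k}
  one_mem' := by simp
  mul_mem' := by
    intro g h hg hh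
    simp only [Set.mem_ofPred_eq, map_mul, ← Matrix.mulVec_mulVec] at *
    rw [hh, hg]
  inv_mem' := by
    intro g hg
    simp only [Set.mem_ofPred_eq] at *
    conv_lhs => rw [← hg]
    rw [Matrix.mulVec_mulVec, ← map_mul, inv_mul_cancel, map_one, Matrix.one_mulVec]

/-- Complex tensor fields with two groups of lower indices. -/
abbrev TensorField (n a b : ℕ) : Type := Spacetime n → BiTensor (Fin (n + 2)) a b

/-- The action of the Lorentz group on fields,
`(Λ K)(x)(v | w) = K(Λ⁻¹ x)(Λ⁻¹ v | Λ⁻¹ w)`. -/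
def fieldRep (n a b : ℕ) : Representation ℂ (lorentzGroup n) (TensorField n a b) where
  toFun g :=
    { toFun := fun K x => tensorRep (lorentzMatrix n) a b g (K (lorentzMatrix n g⁻¹ *ᵥ x))
      map_add' := fun K L => by funext x; simp
      map_smul' := fun c K => by funext x; simp }
  map_one' := by
    refine LinearMap.ext fun K => ?_
    funext x
    simp
  map_mul' g h := by
    refine LinearMap.ext fun K => ?_
    funext x
    simp [Matrix.mulVec_mulVec]

/-! ### Harmonic multiforms -/

/-- The partial derivative `∂_μ f`. -/
def pderiv {n : ℕ} (μ : Fin (n + 2)) (f : Spacetime n → ℂ) (x : Spacetime n) : ℂ :=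
  fderiv ℝ f x (Pi.single μ 1)

theorem pderiv_zero {n : ℕ} (μ : Fin (n + 2)) (x : Spacetime n) :
    pderiv μ (fun _ => (0 : ℂ)) x = 0 := by
  simp [pderiv]

theorem pderiv_add {n : ℕ} (μ : Fin (n + 2)) {f g : Spacetime n → ℂ} (hf : ContDiff ℝ 2 f)
    (hg : ContDiff ℝ 2 g) (x : Spacetime n) :
    pderiv μ (fun y => f y + g y) x = pderiv μ f x + pderiv μ g x := by
  have hf' := (hf.differentiable (by norm_num)) x
  have hg' := (hg.differentiable (by norm_num)) x
  simp [pderiv, fderiv_fun_add hf' hg']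

theorem pderiv_mul {n : ℕ} (μ : Fin (n + 2)) {f : Spacetime n → ℂ} (hf : ContDiff ℝ 2 f)
    (c : ℂ) (x : Spacetime n) : pderiv μ (fun y => c * f y) x = c * pderiv μ f x := by
  have hf' := (hf.differentiable (by norm_num)) x
  simp [pderiv, fderiv_const_mul hf']

/-- The wave operator `□ f = η^{μν} ∂_μ ∂_ν f`. -/
def box {n : ℕ} (f : Spacetime n → ℂ) (x : Spacetime n) : ℂ :=
  ∑ μ, ∑ ν, (eta n μ ν : ℂ) * pderiv μ (pderiv ν f) x

/-- Harmonic multiforms of type `[p+1,q+1]`: twice continuously differentiable tensor fields `K`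
with values in the representation `[p+1,q+1]` of `O(D-1,1)`, closed and coclosed in each of the
two columns. -/
def harmonicMultiforms (n p q : ℕ) : Submodule ℂ (TensorField n (p + 1) (q + 1)) where
  carrier := {K |
    (∀ α β, ContDiff ℝ 2 fun x => K x α β) ∧
    (∀ x, K x ∈ youngTraceless (eta n) (p + 1) (q + 1)) ∧
    (∀ x (κ : Fin (p + 2) → Fin (n + 2)) ν,
      alt (fun κ => pderiv (κ 0) (fun y => K y (Fin.tail κ) ν) x) κ = 0) ∧
    (∀ x μ (κ : Fin (q + 2) → Fin (n + 2)),
      alt (fun κ => pderiv (κ (Fin.last (q + 1))) (fun y => K y μ (Fin.init κ)) x) κ = 0) ∧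
    (∀ x (μ : Fin p → Fin (n + 2)) ν,
      ∑ α, ∑ β, (eta n α β : ℂ) * pderiv α (fun y => K y (Fin.cons β μ) ν) x = 0) ∧
    (∀ x μ (ν : Fin q → Fin (n + 2)),
      ∑ α, ∑ β, (eta n α β : ℂ) * pderiv α (fun y => K y μ (Fin.cons β ν)) x = 0)}
  zero_mem' := by
    refine ⟨fun _ _ => contDiff_const, fun _ => zero_mem _, ?_, ?_, ?_, ?_⟩ <;> intros <;>
      simp [pderiv_zero, alt_zero]
  add_mem' := by
    rintro K L ⟨hK₀, hK₁, hK₂, hK₃, hK₄, hK₅⟩ ⟨hL₀, hL₁, hL₂, hL₃, hL₄, hL₅⟩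
    refine ⟨fun α β => (hK₀ α β).add (hL₀ α β), fun x => add_mem (hK₁ x) (hL₁ x),
      ?_, ?_, ?_, ?_⟩ <;> intros
    · simp only [Pi.add_apply, pderiv_add _ (hK₀ _ _) (hL₀ _ _), alt_add, hK₂, hL₂, add_zero]
    · simp only [Pi.add_apply, pderiv_add _ (hK₀ _ _) (hL₀ _ _), alt_add, hK₃, hL₃, add_zero]
    · simp only [Pi.add_apply, pderiv_add _ (hK₀ _ _) (hL₀ _ _), mul_add,
        Finset.sum_add_distrib, hK₄, hL₄, add_zero]
    · simp only [Pi.add_apply, pderiv_add _ (hK₀ _ _) (hL₀ _ _), mul_add,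
        Finset.sum_add_distrib, hK₅, hL₅, add_zero]
  smul_mem' := by
    rintro c K ⟨hK₀, hK₁, hK₂, hK₃, hK₄, hK₅⟩
    refine ⟨fun α β => contDiff_const.mul (hK₀ α β), fun x => Submodule.smul_mem _ c (hK₁ x),
      ?_, ?_, ?_, ?_⟩ <;> intros
    · simp only [Pi.smul_apply, smul_eq_mul, pderiv_mul _ (hK₀ _ _), alt_smul, hK₂, mul_zero]
    · simp only [Pi.smul_apply, smul_eq_mul, pderiv_mul _ (hK₀ _ _), alt_smul, hK₃, mul_zero]
    · simp only [Pi.smul_apply, smul_eq_mul, pderiv_mul _ (hK₀ _ _), mul_left_comm _ c,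
        ← Finset.mul_sum, hK₄, mul_zero]
    · simp only [Pi.smul_apply, smul_eq_mul, pderiv_mul _ (hK₀ _ _), mul_left_comm _ c,
        ← Finset.mul_sum, hK₅, mul_zero]

/-- The phase `e^{i k·x}`. -/
def phase {n : ℕ} (k x : Spacetime n) : ℂ := Complex.exp (Complex.I * (mdot k x : ℂ))

/-- The harmonic multiforms of momentum `k`: those on which the translation by `a` acts as the
phase `e^{i k·a}`. -/
def momentumSolutions (n p q : ℕ) (k : Spacetime n) : Submodule ℂ (TensorField n (p + 1) (q + 1)) where
  carrier := {K | K ∈ harmonicMultiforms n p q ∧ ∀ a x, K (x + a) = phase k a • K x}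
  zero_mem' := ⟨zero_mem _, by simp⟩
  add_mem' := by
    rintro K L ⟨hK, hK'⟩ ⟨hL, hL'⟩
    exact ⟨add_mem hK hL, fun a x => by simp [hK', hL']⟩
  smul_mem' := by
    rintro c K ⟨hK, hK'⟩
    exact ⟨Submodule.smul_mem _ c hK, fun a x => by simp [hK', smul_comm c]⟩

/-- The plane wave `e^{i k·x} T` with momentum `k` and amplitude `T`. -/
def planeWave {n a b : ℕ} (k : Spacetime n) (T : BiTensor (Fin (n + 2)) a b) : TensorField n a b :=
  fun x => phase k x • T

/-- The superposition `∫ e^{i k·x} f(k) dm(k)` of plane waves. -/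
def superposition {n a b : ℕ} (m : MeasureTheory.Measure (Spacetime n))
    (f : Spacetime n → BiTensor (Fin (n + 2)) a b) : TensorField n a b :=
  fun x α β => ∫ k, phase k x * f k α β ∂m

/-! ### Light-cone frames -/

/-- A light-cone frame `(e₊, e₋, e₁, …, e_{D-2})` of Minkowski space. -/
structure Frame (n : ℕ) where
  /-- The null vector `e₊`. -/
  plus : Spacetime n
  /-- The null vector `e₋`. -/
  minus : Spacetime n
  /-- The transverse vectors `e_i`. -/
  trans : Fin n → Spacetime n
  plus_plus : mdot plus plus = 0
  minus_minus : mdot minus minus = 0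
  plus_minus : mdot plus minus = -1
  plus_trans : ∀ i, mdot plus (trans i) = 0
  minus_trans : ∀ i, mdot minus (trans i) = 0
  trans_trans : ∀ i j, mdot (trans i) (trans j) = if i = j then 1 else 0

/-- The frame is adapted to the momentum `k` if `k = k^+ e₊`, i.e. all other components of `k`
vanish. -/
def Frame.Adapted {n : ℕ} (E : Frame n) (k : Spacetime n) : Prop := ∃ c : ℝ, k = c • E.plus

/-- The light-cone components
`φ_{i₁…i_p|j₁…j_q} = (p+1)(q+1)/(k₋)² · K_{- i₁…i_p | j₁…j_q -}` of a tensor `T = K`, where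
`k₋ = k·e₋`. -/
def Frame.components {n p q : ℕ} (E : Frame n) (k : Spacetime n)
    (T : BiTensor (Fin (n + 2)) (p + 1) (q + 1)) : BiTensor (Fin n) p q :=
  fun i j => (((p + 1) * (q + 1) / mdot k E.minus ^ 2 : ℝ) : ℂ) *
    contract T (Fin.cons E.minus fun s => E.trans (i s))
      (Fin.snoc (fun s => E.trans (j s)) E.minus)

end LightCone

end

noncomputable section

namespace LightCone

open Equiv Function
open scoped SchwartzMap ContDiff

/-! ### Alternating functions of several indices -/

/-! Everything reduces to algebra on amplitudes. For an antisymmetric column, closedness is the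
exchange identity `∂_y K_α = Σ_i ∂_{α_i} K_{α with α_i replaced by y}` (`alt_cons_eq_zero_iff`).
Applying `∂^y` and using coclosedness in each slot gives `□K = 0` (`box_eq_zero`); with derivatives
replaced by momenta the same computation gives `(k·k) T = 0` for an amplitude `T`, so there are no
modes off the cone. If `K` is polynomially bounded and `g` is supported off the cone, then, after
approximation by functions of compact support, `g = (k·k) w`; the transform of `g` is minus the wave
operator applied to that of `w`, and integration by parts moves the operator onto `K`
(`integral_mul_fourier_eq_zero`).

A superposition satisfies a homogeneous linear condition exactly when its amplitude does so almost
everywhere, because an integrable function with vanishing Fourier integral vanishes almost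
everywhere (`ae_eq_zero_of_integral_phase`). A Dirac measure gives the case of one plane wave.

Let `k` be null and nonzero. In an adapted frame its only covariant component is the one along `-`,
and its only contravariant component the one along `+`. Coclosedness kills every component of `T`
with an index `+`; closedness kills every component in which some column has no index `-`. By
antisymmetry each column then has exactly one `-`, all other indices being transverse, so `T` is
determined by `φ`, and the Young and trace conditions on `T` descend to those of `[p,q]`
(`IsMode.transverse_mem`). The stabilizer fixes `e₊`, so in the frame it is block triangular and `φ`
sees only its `O(D-2)` block (`IsMode.transverse_pull`). Hence `K ↦ φ` is an injective intertwiner.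
It is surjective because the target is irreducible and one nonzero mode can be written down
(`exists_isMode_ne_zero`).

Irreducibility of `[q+r,q]` rests on one linear form. Choose distinct indices `a_j, b_j, f_i` and
let `altSum` be the alternating sum of the component `T_{a f|a}` over the exchanges `a_j ↔ b_j`.
First, an invariant family annihilated by `altSum` is zero (`eq_zero_of_altSum`): permuting
coordinates annihilates all such sums, a combinatorial lemma on functions of `q` points kills the
components `T_{x f|x}`, and polarization by reflections kills the others (`eq_zero_of_contained`).
Second, a tensor with the parities of this form under sign changes, and odd under the exchanges, is
determined by `T_{a f|a}` alone (`eq_zero_of_parity`), so such tensors span at most a line. On a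
nonzero invariant subspace the form is nonzero, and the vector representing it in the invariant
inner product has these symmetries. A proper nonzero invariant subspace and its orthogonal
complement would both meet the same line, which is impossible (`eq_bot_or_eq_youngTraceless`). -/

/-- Total antisymmetry of a function of `m` indices. -/
def IsAlt {ι : Type} {m : ℕ} (f : (Fin m → ι) → ℂ) : Prop :=
  ∀ (σ : Perm (Fin m)) (κ : Fin m → ι), f (κ ∘ σ) = ((Perm.sign σ : ℤ) : ℂ) * f κ

theorem sign_mul_self {m : ℕ} (σ : Perm (Fin m)) :
    ((Perm.sign σ : ℤ) : ℂ) * ((Perm.sign σ : ℤ) : ℂ) = 1 := by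
  rcases Int.units_eq_one_or (Perm.sign σ) with h | h <;> simp [h]

theorem alt_comp_perm {ι : Type} {m : ℕ} (f : (Fin m → ι) → ℂ) (κ : Fin m → ι)
    (σ : Perm (Fin m)) : alt f (κ ∘ σ) = ((Perm.sign σ : ℤ) : ℂ) * alt f κ := by
  unfold alt
  rw [mul_left_comm]
  congr 1
  rw [Finset.mul_sum]
  refine Fintype.sum_equiv (Equiv.mulLeft σ) _ _ fun τ => ?_
  simp only [Equiv.coe_mulLeft, Perm.sign_mul, Units.val_mul, Int.cast_mul, ← mul_assoc,
    sign_mul_self, one_mul]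
  rfl

theorem alt_eq_self_iff {ι : Type} {m : ℕ} {f : (Fin m → ι) → ℂ} :
    (∀ κ, alt f κ = f κ) ↔ IsAlt f := by
  constructor
  · intro h σ κ
    rw [← h, alt_comp_perm, h]
  · intro h κ
    simp only [alt, h _ κ, ← mul_assoc, sign_mul_self, one_mul, Finset.sum_const, Finset.card_univ,
      Fintype.card_perm, Fintype.card_fin, nsmul_eq_mul]
    rw [inv_mul_cancel₀ (by exact_mod_cast Nat.factorial_ne_zero m), one_mul]

theorem alt_comp_right {ι : Type} {m : ℕ} (f : (Fin m → ι) → ℂ) (σ : Perm (Fin m))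
    (κ : Fin m → ι) : alt (fun κ => f (κ ∘ σ)) κ = alt f (κ ∘ σ) := by
  rw [alt_comp_perm, alt, alt, mul_left_comm]
  congr 1
  rw [Finset.mul_sum]
  refine Fintype.sum_equiv (Equiv.mulRight σ) _ _ fun τ => ?_
  simp only [Equiv.coe_mulRight, Perm.sign_mul, Units.val_mul, Int.cast_mul]
  rw [mul_comm ((Perm.sign τ : ℤ) : ℂ) ((Perm.sign σ : ℤ) : ℂ), ← mul_assoc, ← mul_assoc,
    sign_mul_self, one_mul]
  rfl

theorem IsAlt.swap {ι : Type} {m : ℕ} {f : (Fin m → ι) → ℂ} (hf : IsAlt f) {i j : Fin m}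
    (hij : i ≠ j) (κ : Fin m → ι) : f (κ ∘ Equiv.swap i j) = -f κ := by
  rw [hf, Perm.sign_swap hij]
  simp

theorem IsAlt.eq_zero {ι : Type} {m : ℕ} {f : (Fin m → ι) → ℂ} (hf : IsAlt f)
    {κ : Fin m → ι} {i j : Fin m} (hij : i ≠ j) (h : κ i = κ j) : f κ = 0 := by
  have h1 := hf.swap hij κ
  have h2 : κ ∘ Equiv.swap i j = κ := by
    funext l
    simp only [comp_apply, Equiv.swap_apply_def]
    split_ifs with h3 h4
    · rw [h3, h]
    · rw [h4, h]
    · rfl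
  rw [h2] at h1
  exact self_eq_neg.mp h1

theorem IsAlt.eq_zero_of_not_injective {ι : Type} {m : ℕ} {f : (Fin m → ι) → ℂ} (hf : IsAlt f)
    {κ : Fin m → ι} (h : ¬ Injective κ) : f κ = 0 := by
  rw [Injective] at h
  push Not at h
  obtain ⟨i, j, h1, h2⟩ := h
  exact hf.eq_zero h2 h1

theorem IsAlt.perm_eq_zero_iff {ι : Type} {m : ℕ} {f : (Fin m → ι) → ℂ} (hf : IsAlt f)
    (σ : Perm (Fin m)) (κ : Fin m → ι) : f (κ ∘ σ) = 0 ↔ f κ = 0 := by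
  rw [hf, mul_eq_zero, or_iff_right]
  intro h
  have := sign_mul_self σ
  simp [h] at this

/-- Antisymmetrizing an alternating function together with one more index gives the exchange
sum. -/
theorem alt_cons {ι : Type} {a : ℕ} {F : (Fin a → ι) → ι → ℂ} (hF : ∀ y, IsAlt fun μ => F μ y)
    (κ : Fin (a + 1) → ι) :
    alt (fun κ => F (Fin.tail κ) (κ 0)) κ = ((a + 1 : ℕ) : ℂ)⁻¹ *
      (F (Fin.tail κ) (κ 0) - ∑ i, F (update (Fin.tail κ) i (κ 0)) (κ i.succ)) := by
  have key : ∑ σ : Perm (Fin (a + 1)), ((Perm.sign σ : ℤ) : ℂ) *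
      F (Fin.tail (κ ∘ σ)) ((κ ∘ σ) 0) = (a.factorial : ℂ) *
      (F (Fin.tail κ) (κ 0) - ∑ i, F (update (Fin.tail κ) i (κ 0)) (κ i.succ)) := by
    -- A permutation is split into the image `x` of `0` and a permutation `e` of the remaining
    -- slots. By antisymmetry of `F` all `a!` choices of `e` contribute equally, and `x ≠ 0` costs
    -- the sign of a transposition.
    rw [← Equiv.sum_comp Perm.decomposeFin.symm, Fintype.sum_prod_type]
    have h1 : ∀ (x : Fin (a + 1)) (e : Perm (Fin a)),
        ((Perm.sign (Perm.decomposeFin.symm (x, e)) : ℤ) : ℂ) *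
          F (Fin.tail (κ ∘ Perm.decomposeFin.symm (x, e)))
            ((κ ∘ Perm.decomposeFin.symm (x, e)) 0) =
        (if x = 0 then 1 else -1) * F (Fin.tail (κ ∘ Equiv.swap 0 x)) (κ x) := by
      intro x e
      have h2 : Fin.tail (κ ∘ Perm.decomposeFin.symm (x, e)) =
          Fin.tail (κ ∘ Equiv.swap 0 x) ∘ e := by
        funext i
        simp [Fin.tail]
      rw [h2, show ∀ μ y, F (μ ∘ e) y = _ * F μ y from fun μ y => hF y e μ,
        Perm.decomposeFin.symm_sign]
      simp only [comp_apply, Perm.decomposeFin_symm_apply_zero]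
      have := sign_mul_self e
      split_ifs
      · simp only [one_mul, ← mul_assoc, this]
      · simp only [Units.val_mul, Units.val_neg, Units.val_one, Int.cast_mul, Int.cast_neg,
          Int.cast_one]
        linear_combination (-F (Fin.tail (κ ∘ Equiv.swap 0 x)) (κ x)) * this
    simp only [h1, Finset.sum_const, Finset.card_univ, Fintype.card_perm, Fintype.card_fin,
      nsmul_eq_mul, ← Finset.mul_sum]
    congr 1
    rw [Fin.sum_univ_succ]
    simp only [if_true, Equiv.swap_self, Fin.succ_ne_zero, if_false, one_mul, sub_eq_add_neg]
    congr 1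
    rw [← Finset.sum_neg_distrib]
    refine Finset.sum_congr rfl fun i _ => ?_
    rw [neg_one_mul]
    congr 2
    funext l
    simp only [Fin.tail, comp_apply, update_apply, Equiv.swap_apply_def, Fin.succ_ne_zero, if_false,
      Fin.succ_inj]
    split_ifs <;> rfl
  rw [alt, key, ← mul_assoc, Nat.factorial_succ]
  congr 1
  push_cast
  have := Nat.factorial_ne_zero a
  field_simp

/-- Up to the nonzero factor `1/(a+1)`, `alt_cons` is the difference of the two sides. In this form
closedness and the Young condition can be manipulated without permutations. -/
theorem alt_cons_eq_zero_iff {ι : Type} {a : ℕ} {F : (Fin a → ι) → ι → ℂ}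
    (hF : ∀ y, IsAlt fun μ => F μ y) :
    (∀ κ, alt (fun κ => F (Fin.tail κ) (κ 0)) κ = 0) ↔
      ∀ μ y, F μ y = ∑ i, F (update μ i y) (μ i) := by
  have h0 : ((a + 1 : ℕ) : ℂ)⁻¹ ≠ 0 := inv_ne_zero (by exact_mod_cast a.succ_ne_zero)
  constructor
  · intro h μ y
    have := h (Fin.cons y μ)
    rw [alt_cons hF, mul_eq_zero, or_iff_right h0, sub_eq_zero] at this
    simpa using this
  · intro h κ
    rw [alt_cons hF, h (Fin.tail κ) (κ 0)]
    simp [Fin.tail]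

/-- A cyclic rotation brings the last index to the front. It changes the antisymmetrization by a
sign at most, which does not matter for vanishing. -/
theorem alt_snoc {ι : Type} {a : ℕ} (F : (Fin a → ι) → ι → ℂ) (κ : Fin (a + 1) → ι) :
    alt (fun κ => F (Fin.init κ) (κ (Fin.last a))) κ =
      alt (fun κ => F (Fin.tail κ) (κ 0)) (κ ∘ (finRotate (a + 1)).symm) := by
  rw [← alt_comp_right]
  congr 1
  funext κ
  have h1 : ∀ i : Fin a, (finRotate (a + 1)).symm i.succ = i.castSucc := fun i => by
    rw [Equiv.symm_apply_eq, finRotate_apply, Fin.coeSucc_eq_succ]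
  have h0 : (finRotate (a + 1)).symm 0 = Fin.last a := by
    rw [Equiv.symm_apply_eq, finRotate_last]
  have h2 : Fin.tail (κ ∘ (finRotate (a + 1)).symm) = Fin.init κ := by
    funext i
    simp only [Fin.init, Fin.tail, comp_apply, h1]
  rw [h2, comp_apply, h0]

theorem alt_snoc_eq_zero_iff {ι : Type} {a : ℕ} {F : (Fin a → ι) → ι → ℂ}
    (hF : ∀ y, IsAlt fun μ => F μ y) :
    (∀ κ, alt (fun κ => F (Fin.init κ) (κ (Fin.last a))) κ = 0) ↔
      ∀ μ y, F μ y = ∑ i, F (update μ i y) (μ i) := by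
  rw [← alt_cons_eq_zero_iff hF]
  simp only [alt_snoc]
  constructor
  · intro h κ
    have := h (κ ∘ finRotate (a + 1))
    rwa [comp_assoc, Equiv.self_comp_symm, comp_id] at this
  · exact fun h κ => h _

/-! ### Tensors of type `[a,b]` by exchange relations -/

/-- The symmetries of the Young diagram `[a,b]`: antisymmetry in each column and the exchange
relation of each index of the second column with the first column. -/
structure IsYoung {ι : Type} {a b : ℕ} (T : BiTensor ι a b) : Prop where
  left : ∀ ν, IsAlt fun μ => T μ ν
  right : ∀ μ, IsAlt fun ν => T μ ν
  exch : ∀ μ ν j, T μ ν = ∑ i, T (update μ i (ν j)) (update ν j (μ i))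

/-- The traces between the two columns vanish. -/
def IsTraceless {ι : Type} [Fintype ι] {a b : ℕ} (g : Matrix ι ι ℝ) (T : BiTensor ι a b) : Prop :=
  ∀ μ ν i j, ∑ α, ∑ β, (g α β : ℂ) * T (update μ i α) (update ν j β) = 0

/-- With all indices of the second column but the `j`-th frozen, the third condition is an instance
of `alt_snoc_eq_zero_iff`; the index in slot `j` plays the role of the extra index. -/
theorem mem_youngTraceless_iff {ι : Type} [Fintype ι] {g : Matrix ι ι ℝ} {a b : ℕ}
    {T : BiTensor ι a b} : T ∈ youngTraceless g a b ↔ IsYoung T ∧ IsTraceless g T := by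
  have key : (∀ ν, IsAlt fun μ => T μ ν) →
      ((∀ (κ : Fin (a + 1) → ι) (ν : Fin b → ι) (j : Fin b),
        alt (fun κ => T (Fin.init κ) (update ν j (κ (Fin.last a)))) κ = 0) ↔
      ∀ μ ν j, T μ ν = ∑ i, T (update μ i (ν j)) (update ν j (μ i))) := by
    intro hT
    have h1 : ∀ ν j, (∀ κ : Fin (a + 1) → ι,
        alt (fun κ => T (Fin.init κ) (update ν j (κ (Fin.last a)))) κ = 0) ↔
        ∀ μ y, T μ (update ν j y) = ∑ i, T (update μ i y) (update ν j (μ i)) := fun ν j =>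
      alt_snoc_eq_zero_iff (F := fun μ y => T μ (update ν j y)) fun y => hT _
    constructor
    · intro h μ ν j
      simpa using (h1 ν j).1 (fun κ => h κ ν j) μ (ν j)
    · intro h κ ν j
      refine (h1 ν j).2 (fun μ y => ?_) κ
      simpa using h μ (update ν j y) j
  constructor
  · rintro ⟨h1, h2, h3, h4⟩
    have h1' : ∀ ν, IsAlt fun μ => T μ ν := fun ν => alt_eq_self_iff.1 fun μ => h1 μ ν
    exact ⟨⟨h1', fun μ => alt_eq_self_iff.1 fun ν => h2 μ ν, (key h1').1 h3⟩, h4⟩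
  · rintro ⟨⟨h1, h2, h3⟩, h4⟩
    exact ⟨fun μ ν => alt_eq_self_iff.2 (h1 ν) μ, fun μ ν => alt_eq_self_iff.2 (h2 μ) ν,
      (key h1).2 h3, h4⟩

/-! ### Evaluation of tensors on complex vectors -/

/-- Evaluation of a tensor with index slots `J` on complex vectors. -/
def mev {J ι : Type} [Fintype J] [DecidableEq J] [Fintype ι] (S : (J → ι) → ℂ) :
    MultilinearMap ℂ (fun _ : J => ι → ℂ) ℂ :=
  ∑ γ, S γ • (MultilinearMap.mkPiAlgebra ℂ J ℂ).compLinearMap fun s => LinearMap.proj (γ s)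

theorem mev_apply {J ι : Type} [Fintype J] [DecidableEq J] [Fintype ι] (S : (J → ι) → ℂ)
    (w : J → ι → ℂ) : mev S w = ∑ γ, S γ * ∏ s, w s (γ s) := by
  simp [mev]

theorem mev_single {J ι : Type} [Fintype J] [DecidableEq J] [Fintype ι] [DecidableEq ι]
    (S : (J → ι) → ℂ) (γ : J → ι) : mev S (fun s => Pi.single (γ s) 1) = S γ := by
  rw [mev_apply, Finset.sum_eq_single γ]
  · simp
  · intro δ _ h
    obtain ⟨s, hs⟩ := Function.ne_iff.mp h
    rw [Finset.prod_eq_zero (Finset.mem_univ s) (by simp [hs]), mul_zero]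
  · simp

theorem mev_comp_perm {J ι : Type} [Fintype J] [DecidableEq J] [Fintype ι] (S : (J → ι) → ℂ)
    (π : Perm J) (w : J → ι → ℂ) : mev (fun γ => S (γ ∘ π)) w = mev S (w ∘ π) := by
  rw [mev_apply, mev_apply]
  refine Fintype.sum_equiv (π.arrowCongr (Equiv.refl ι)).symm _ _ fun γ => ?_
  have : (π.arrowCongr (Equiv.refl ι)).symm γ = γ ∘ π := by
    funext s; simp [Equiv.arrowCongr]
  rw [this]
  congr 1
  exact (Equiv.prod_comp π fun s => w s (γ s)).symm

theorem mev_sum {J ι A : Type} [Fintype J] [DecidableEq J] [Fintype ι] (s : Finset A)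
    (S : A → (J → ι) → ℂ) (w : J → ι → ℂ) :
    mev (fun γ => ∑ i ∈ s, S i γ) w = ∑ i ∈ s, mev (S i) w := by
  simp only [mev_apply, Finset.sum_mul]
  exact Finset.sum_comm

theorem mev_smul {J ι : Type} [Fintype J] [DecidableEq J] [Fintype ι] (c : ℂ)
    (S : (J → ι) → ℂ) (w : J → ι → ℂ) : mev (fun γ => c * S γ) w = c * mev S w := by
  simp only [mev_apply, Finset.mul_sum, mul_assoc]

theorem mev_mul {J L ι : Type} [Fintype J] [DecidableEq J] [Fintype L] [DecidableEq L] [Fintype ι]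
    (A : (J → ι) → ℂ) (B : (L → ι) → ℂ) (w : J ⊕ L → ι → ℂ) :
    mev (fun γ => A (γ ∘ Sum.inl) * B (γ ∘ Sum.inr)) w =
      mev A (w ∘ Sum.inl) * mev B (w ∘ Sum.inr) := by
  simp only [mev_apply, Finset.sum_mul_sum]
  rw [← Fintype.sum_prod_type']
  refine Fintype.sum_equiv (Equiv.sumArrowEquivProdArrow J L ι) _ _ fun γ => ?_
  simp only [Fintype.prod_sum_type, Equiv.sumArrowEquivProdArrow, Equiv.coe_fn_mk, comp_apply]
  ring

theorem mev_update_eq_sum {J ι : Type} [Fintype J] [DecidableEq J] [Fintype ι] [DecidableEq ι]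
    (S : (J → ι) → ℂ) (w : J → ι → ℂ) (s : J) (x : ι → ℂ) :
    mev S (update w s x) = ∑ c, x c * mev S (update w s (Pi.single c 1)) := by
  conv_lhs => rw [pi_eq_sum_univ' x, MultilinearMap.map_update_sum]
  refine Finset.sum_congr rfl fun c _ => ?_
  rw [MultilinearMap.map_update_smul, smul_eq_mul]

/-- A function of vectors that is determined slot by slot by its values on basis vectors vanishes
if it vanishes on families of basis vectors. -/
theorem eq_zero_of_basis {J ι : Type} [Fintype J] [DecidableEq J] [DecidableEq ι]
    (N : (J → ι → ℂ) → ℂ)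
    (h : ∀ w r, (∀ c : ι, N (update w r (Pi.single c 1)) = 0) → N w = 0)
    (h0 : ∀ γ : J → ι, N (fun s => Pi.single (γ s) 1) = 0) (w : J → ι → ℂ) : N w = 0 := by
  -- `A` contains the slots that may still hold arbitrary vectors; each induction step expands one
  -- of them in the basis.
  have key : ∀ (A : Finset J) (w : J → ι → ℂ),
      (∀ r ∉ A, ∃ c : ι, w r = Pi.single c 1) → N w = 0 := by
    intro A
    induction A using Finset.induction_on with
    | empty =>
      intro w hw
      choose γ hγ using fun r => hw r (Finset.notMem_empty r)
      rw [show w = fun s => Pi.single (γ s) 1 from funext hγ]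
      exact h0 γ
    | insert r A hr ih =>
      intro w hw
      refine h w r fun c => ih _ fun r' hr' => ?_
      by_cases h' : r' = r
      · subst h'
        exact ⟨c, by simp⟩
      · rw [update_of_ne h']
        exact hw r' (by simp [h', hr'])
  exact key Finset.univ w (by simp)

/-- A tensor as a function of all its indices. -/
def joint {ι : Type} {a b : ℕ} (T : BiTensor ι a b) (γ : Fin a ⊕ Fin b → ι) : ℂ :=
  T (γ ∘ Sum.inl) (γ ∘ Sum.inr)

/-- The evaluation `T(u₁,…,uₐ | v₁,…,v_b)` on complex vectors. -/
def ev {ι : Type} [Fintype ι] {a b : ℕ} (T : BiTensor ι a b) (u : Fin a → ι → ℂ)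
    (v : Fin b → ι → ℂ) : ℂ := mev (joint T) (Sum.elim u v)

theorem contract_eq_ev {ι : Type} [Fintype ι] {a b : ℕ} (T : BiTensor ι a b)
    (u : Fin a → ι → ℝ) (v : Fin b → ι → ℝ) :
    contract T u v = ev T (fun i α => (u i α : ℂ)) (fun j β => (v j β : ℂ)) := by
  rw [ev, mev_apply, contract, ← Fintype.sum_prod_type']
  symm
  refine Fintype.sum_equiv (Equiv.sumArrowEquivProdArrow (Fin a) (Fin b) ι) _ _ fun γ => ?_
  simp only [Fintype.prod_sum_type, Equiv.sumArrowEquivProdArrow, Equiv.coe_fn_mk, comp_apply,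
    joint, Complex.ofReal_prod, Sum.elim_inl, Sum.elim_inr]
  rw [mul_comm]

theorem pull_apply {ι : Type} [Fintype ι] {a b : ℕ} (M : Matrix ι ι ℝ) (T : BiTensor ι a b)
    (μ : Fin a → ι) (ν : Fin b → ι) :
    pull M T μ ν = ev T (fun i α => (M α (μ i) : ℂ)) (fun j β => (M β (ν j) : ℂ)) :=
  contract_eq_ev T (fun i α => M α (μ i)) (fun j β => M β (ν j))

theorem ev_single {ι : Type} [Fintype ι] [DecidableEq ι] {a b : ℕ} (T : BiTensor ι a b)
    (μ : Fin a → ι) (ν : Fin b → ι) :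
    ev T (fun i => Pi.single (μ i) 1) (fun j => Pi.single (ν j) 1) = T μ ν := by
  rw [ev, show (Sum.elim (fun i => Pi.single (μ i) 1) (fun j => Pi.single (ν j) 1) :
    Fin a ⊕ Fin b → ι → ℂ) = fun s => Pi.single (Sum.elim μ ν s) 1 by
      funext s; cases s <;> rfl, mev_single]
  rfl

theorem ev_update_left {ι : Type} [Fintype ι] [DecidableEq ι] {a b : ℕ} (T : BiTensor ι a b)
    (u : Fin a → ι → ℂ) (v : Fin b → ι → ℂ) (i : Fin a) (x : ι → ℂ) :
    ev T (update u i x) v = ∑ c, x c * ev T (update u i (Pi.single c 1)) v := by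
  simp only [ev, ← Sum.update_elim_inl]
  exact mev_update_eq_sum _ _ _ _

theorem ev_update_right {ι : Type} [Fintype ι] [DecidableEq ι] {a b : ℕ} (T : BiTensor ι a b)
    (u : Fin a → ι → ℂ) (v : Fin b → ι → ℂ) (j : Fin b) (x : ι → ℂ) :
    ev T u (update v j x) = ∑ c, x c * ev T u (update v j (Pi.single c 1)) := by
  simp only [ev, ← Sum.update_elim_inr]
  exact mev_update_eq_sum _ _ _ _

theorem ev_perm_left {ι : Type} [Fintype ι] {a b : ℕ} {T : BiTensor ι a b}
    (hT : ∀ ν, IsAlt fun μ => T μ ν) (u : Fin a → ι → ℂ) (v : Fin b → ι → ℂ)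
    (σ : Perm (Fin a)) : ev T (u ∘ σ) v = ((Perm.sign σ : ℤ) : ℂ) * ev T u v := by
  have h1 : Sum.elim (u ∘ σ) v = Sum.elim u v ∘ (Equiv.sumCongr σ (Equiv.refl (Fin b))) := by
    funext s; cases s <;> rfl
  rw [ev, h1, ← mev_comp_perm, ev, ← mev_smul]
  congr 2
  funext γ
  exact hT (γ ∘ Sum.inr) σ (γ ∘ Sum.inl)

theorem ev_perm_right {ι : Type} [Fintype ι] {a b : ℕ} {T : BiTensor ι a b}
    (hT : ∀ μ, IsAlt fun ν => T μ ν) (u : Fin a → ι → ℂ) (v : Fin b → ι → ℂ)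
    (σ : Perm (Fin b)) : ev T u (v ∘ σ) = ((Perm.sign σ : ℤ) : ℂ) * ev T u v := by
  have h1 : Sum.elim u (v ∘ σ) = Sum.elim u v ∘ (Equiv.sumCongr (Equiv.refl (Fin a)) σ) := by
    funext s; cases s <;> rfl
  rw [ev, h1, ← mev_comp_perm, ev, ← mev_smul]
  congr 2
  funext γ
  exact hT (γ ∘ Sum.inl) σ (γ ∘ Sum.inr)

/-- An exchange between the columns is a transposition of slots in their disjoint union. By
`mev_comp_perm`, exchange relations between components therefore pass to arbitrary vectors. -/
theorem elim_comp_swap {A α β : Type} [DecidableEq α] [DecidableEq β] (u : α → A) (v : β → A)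
    (i : α) (j : β) : Sum.elim u v ∘ Equiv.swap (Sum.inl i) (Sum.inr j) =
      Sum.elim (update u i (v j)) (update v j (u i)) := by
  funext s
  rcases s with l | l
  · by_cases h : l = i
    · subst h; simp
    · rw [comp_apply, Equiv.swap_apply_of_ne_of_ne (by simpa using h) (by simp)]
      simp [h]
  · by_cases h : l = j
    · subst h; simp
    · rw [comp_apply, Equiv.swap_apply_of_ne_of_ne (by simp) (by simpa using h)]
      simp [h]

theorem ev_exch {ι : Type} [Fintype ι] {a b : ℕ} {T : BiTensor ι a b}
    (hT : ∀ μ ν j, T μ ν = ∑ i, T (update μ i (ν j)) (update ν j (μ i)))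
    (u : Fin a → ι → ℂ) (v : Fin b → ι → ℂ) (j : Fin b) :
    ev T u v = ∑ i, ev T (update u i (v j)) (update v j (u i)) := by
  simp only [ev, ← elim_comp_swap, ← mev_comp_perm, ← mev_sum]
  congr 2
  funext γ
  have h1 : ∀ γ : Fin a ⊕ Fin b → ι, joint T γ = T (γ ∘ Sum.inl) (γ ∘ Sum.inr) := fun _ => rfl
  have h2 : γ = Sum.elim (γ ∘ Sum.inl) (γ ∘ Sum.inr) := (Sum.elim_comp_inl_inr γ).symm
  rw [h1, hT _ _ j]
  refine Finset.sum_congr rfl fun i _ => ?_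
  conv_rhs => rw [h2, elim_comp_swap]
  rfl

/-- The traced expression is linear in each vector outside slots `i` and `j`, so `eq_zero_of_basis`
reduces it to the trace condition on components. -/
theorem ev_trace {ι : Type} [Fintype ι] [DecidableEq ι] {a b : ℕ} {g : Matrix ι ι ℝ}
    {T : BiTensor ι a b} (hT : IsTraceless g T) (u : Fin a → ι → ℂ) (v : Fin b → ι → ℂ) (i : Fin a)
    (j : Fin b) :
    ∑ α, ∑ β, (g α β : ℂ) * ev T (update u i (Pi.single α 1)) (update v j (Pi.single β 1)) = 0 := by
  rcases isEmpty_or_nonempty ι with hι | hι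
  · simp
  let c₀ : ι := Classical.arbitrary ι
  have key := eq_zero_of_basis (J := Fin a ⊕ Fin b) (ι := ι) (N := fun w => ∑ α, ∑ β, (g α β : ℂ) *
    mev (joint T) (update (update w (Sum.inl i) (Pi.single α 1)) (Sum.inr j) (Pi.single β 1)))
    ?_ ?_ (Sum.elim u v)
  · simpa only [ev, ← Sum.update_elim_inl, ← Sum.update_elim_inr] using key
  · intro w r hw
    -- A traced slot is overwritten, so its content is irrelevant and the single basis vector `c₀`
    -- settles it.
    by_cases h1 : r = Sum.inl i
    · subst h1
      simpa using hw c₀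
    by_cases h2 : r = Sum.inr j
    · subst h2
      have := hw c₀
      simp only [update_comm (show Sum.inr j ≠ Sum.inl i by simp), update_idem] at this
      simpa only [update_comm (show Sum.inr j ≠ Sum.inl i by simp)] using this
    have h3 : ∀ α β, mev (joint T)
        (update (update w (Sum.inl i) (Pi.single α 1)) (Sum.inr j) (Pi.single β 1)) =
        ∑ c, w r c * mev (joint T) (update (update (update w r (Pi.single c 1)) (Sum.inl i)
          (Pi.single α 1)) (Sum.inr j) (Pi.single β 1)) := by
      intro α β
      conv_lhs => rw [← update_eq_self r w]
      rw [update_comm h1, update_comm h2, mev_update_eq_sum]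
      refine Finset.sum_congr rfl fun c _ => ?_
      rw [update_comm h1, update_comm h2]
    simp only [h3, Finset.mul_sum]
    rw [Finset.sum_congr rfl fun α _ => Finset.sum_comm, Finset.sum_comm]
    refine Finset.sum_eq_zero fun c _ => ?_
    have := congrArg (w r c * ·) (hw c)
    simp only [mul_zero, Finset.mul_sum] at this
    rw [← this]
    refine Finset.sum_congr rfl fun α _ => Finset.sum_congr rfl fun β _ => by ring
  · intro γ
    have h4 : ∀ α β, update (update (fun s => (Pi.single (γ s) 1 : ι → ℂ)) (Sum.inl i)
        (Pi.single α 1)) (Sum.inr j) (Pi.single β 1) =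
        fun s => Pi.single (update (update γ (Sum.inl i) α) (Sum.inr j) β s) 1 := by
      intro α β
      funext s
      by_cases h1 : s = Sum.inr j
      · subst h1; simp
      by_cases h2 : s = Sum.inl i
      · subst h2; simp
      simp [h1, h2]
    simp only [h4, mev_single]
    have h5 : ∀ α β, joint T (update (update γ (Sum.inl i) α) (Sum.inr j) β) =
        T (update (γ ∘ Sum.inl) i α) (update (γ ∘ Sum.inr) j β) := by
      intro α β
      rw [joint]
      congr 1
      · funext l
        by_cases h : l = i
        · subst h; simp
        · simp [h]
      · funext l
        by_cases h : l = j
        · subst h; simp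
        · simp [h]
    simp only [h5]
    exact hT _ _ i j

/-- Expanding the columns of `M` in the basis turns the contraction with `g'` into the contraction
with `M g' Mᵀ = g`. -/
theorem ev_trace_frame {ι : Type} [Fintype ι] [DecidableEq ι] {a b : ℕ} {g g' M : Matrix ι ι ℝ}
    (hM : M * g' * Mᵀ = g) {T : BiTensor ι a b} (hT : IsTraceless g T) (u : Fin a → ι → ℂ)
    (v : Fin b → ι → ℂ) (i : Fin a) (j : Fin b) :
    ∑ α, ∑ β, (g' α β : ℂ) * ev T (update u i fun c => (M c α : ℂ))
      (update v j fun c => (M c β : ℂ)) = 0 := by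
  rw [← ev_trace hT u v i j, ← hM]
  simp only [ev_update_left T u _ i fun c => (M c _ : ℂ),
    ev_update_right T _ _ j fun c => (M c _ : ℂ), Finset.mul_sum, Matrix.mul_apply,
    Matrix.transpose_apply, Complex.ofReal_sum, Complex.ofReal_mul, Finset.sum_mul]
  rw [Finset.sum_congr rfl fun α _ => Finset.sum_congr rfl fun β _ => Finset.sum_comm, sum_rotate]
  refine Finset.sum_congr rfl fun c _ => Finset.sum_congr rfl fun d _ => ?_
  rw [Finset.sum_comm]
  refine Finset.sum_congr rfl fun α _ => Finset.sum_congr rfl fun β _ => ?_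
  ring

/-- The components of the pull-back are values on the columns of `M`, so the column symmetries hold
for every `M`; only the trace condition involves the metrics. Allowing two metrics covers orthogonal
maps, Lorentz maps and changes of frame at once. -/
theorem pull_mem_youngTraceless {ι : Type} [Fintype ι] [DecidableEq ι] {a b : ℕ}
    {g g' M : Matrix ι ι ℝ} (hM : M * g' * Mᵀ = g) {T : BiTensor ι a b}
    (hT : T ∈ youngTraceless g a b) : pull M T ∈ youngTraceless g' a b := by
  rw [mem_youngTraceless_iff] at *
  obtain ⟨hY, ht⟩ := hT
  have hu : ∀ {m : ℕ} (μ : Fin m → ι) (i : Fin m) (y : ι),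
      (fun l c => (M c (update μ i y l) : ℂ)) =
        update (fun l c => (M c (μ l) : ℂ)) i fun c => (M c y : ℂ) := by
    intro m μ i y
    funext l
    by_cases h : l = i
    · subst h; simp
    · simp [h]
  refine ⟨⟨fun ν σ μ => ?_, fun μ σ ν => ?_, fun μ ν j => ?_⟩, fun μ ν i j => ?_⟩
  · simp only [pull_apply]
    exact ev_perm_left hY.left (fun i c => (M c (μ i) : ℂ)) _ σ
  · simp only [pull_apply]
    exact ev_perm_right hY.right _ (fun i c => (M c (ν i) : ℂ)) σ
  · simp only [pull_apply, hu]
    exact ev_exch hY.exch _ _ j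
  · simp only [pull_apply, hu]
    exact ev_trace_frame hM ht _ _ i j

/-! ### Decomposable tensors -/

/-- The decomposable form `u₁ ∧ … ∧ u_m` (without normalization). -/
def colDet {ι : Type} {m : ℕ} (u : Fin m → ι → ℂ) (μ : Fin m → ι) : ℂ :=
  (Matrix.of fun r s => u r (μ s)).det

theorem colDet_isAlt {ι : Type} {m : ℕ} (u : Fin m → ι → ℂ) : IsAlt (colDet u) := by
  intro σ μ
  exact Matrix.det_permute' σ (Matrix.of fun r s => u r (μ s))

theorem colDet_update {ι : Type} {m : ℕ} (u : Fin m → ι → ℂ) (μ : Fin m → ι) (i : Fin m) (y : ι) :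
    colDet u (update μ i y) =
      Matrix.cramer (Matrix.of fun r s => u r (μ s)) (fun r => u r y) i := by
  rw [Matrix.cramer_apply, colDet]
  congr 1
  ext r s
  by_cases h : s = i
  · subst h; simp
  · simp [h]

/-- This is row `r` of Cramer's rule `A (cramer A b) = (det A) b`: an extra factor that already
occurs in a decomposable form satisfies the exchange relation. -/
theorem sum_colDet_update_mul {ι : Type} {m : ℕ} (u : Fin m → ι → ℂ) (μ : Fin m → ι) (y : ι)
    (r : Fin m) : ∑ i, colDet u (update μ i y) * u r (μ i) = colDet u μ * u r y := by
  have := congrFun (Matrix.mulVec_cramer (Matrix.of fun r s => u r (μ s)) fun r => u r y) r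
  simp only [Matrix.mulVec, dotProduct, Matrix.of_apply, Pi.smul_apply, smul_eq_mul] at this
  simp only [colDet_update]
  rw [colDet, ← this]
  exact Finset.sum_congr rfl fun i _ => mul_comm _ _

/-- Expansion of the determinant along column `i`; the coefficients are the cofactors, which do not
involve `y`. -/
theorem exists_colDet_update_eq {ι : Type} {m : ℕ} (u : Fin m → ι → ℂ) (μ : Fin m → ι)
    (i : Fin m) : ∃ c : Fin m → ℂ, ∀ y, colDet u (update μ i y) = ∑ r, c r * u r y := by
  refine ⟨fun r => Matrix.cramer (Matrix.of fun r s => u r (μ s)) (Pi.single r 1) i, fun y => ?_⟩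
  rw [colDet_update, pi_eq_sum_univ' fun r => u r y, map_sum, Finset.sum_apply]
  refine Finset.sum_congr rfl fun r _ => ?_
  rw [map_smul, Pi.smul_apply, smul_eq_mul, mul_comm]

theorem colDet_eq_one {ι : Type} {m : ℕ} {u : Fin m → ι → ℂ} {μ : Fin m → ι}
    (h : ∀ r s, u r (μ s) = if r = s then 1 else 0) : colDet u μ = 1 := by
  rw [colDet, show (Matrix.of fun r s => u r (μ s)) = 1 by
    ext r s; simp [h, Matrix.one_apply], Matrix.det_one]

theorem sum_comm_pairs {A B C D : Type} [Fintype A] [Fintype B] [Fintype C] [Fintype D]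
    (F : A → B → C → D → ℂ) :
    ∑ a, ∑ b, ∑ c, ∑ d, F a b c d = ∑ c, ∑ d, ∑ a, ∑ b, F a b c d := by
  have h : ∑ x : A × B, ∑ y : C × D, F x.1 x.2 y.1 y.2 =
      ∑ y : C × D, ∑ x : A × B, F x.1 x.2 y.1 y.2 := Finset.sum_comm
  simpa only [Fintype.sum_prod_type] using h

/-- The product of two decomposable forms. -/
def detTensor {ι : Type} {a b : ℕ} (u : Fin a → ι → ℂ) (w : Fin b → ι → ℂ) : BiTensor ι a b :=
  fun μ ν => colDet u μ * colDet w ν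

/-- The exchange relation holds because every factor of the second column also occurs in the first,
so antisymmetrizing it with that column repeats a vector. The traces are sums of multiples of the
contractions of some `u r` with some `w s`. -/
theorem detTensor_mem {ι : Type} [Fintype ι] {a b : ℕ} {g : Matrix ι ι ℝ} {u : Fin a → ι → ℂ}
    {w : Fin b → ι → ℂ} (huw : ∀ r, ∃ s, w r = u s)
    (hg : ∀ r s, ∑ α, ∑ β, (g α β : ℂ) * (u r α * w s β) = 0) :
    detTensor u w ∈ youngTraceless g a b := by
  rw [mem_youngTraceless_iff]
  refine ⟨⟨fun ν σ μ => ?_, fun μ σ ν => ?_, fun μ ν j => ?_⟩, fun μ ν i j => ?_⟩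
  · simp only [detTensor, colDet_isAlt u σ μ, mul_assoc]
  · simp only [detTensor, colDet_isAlt w σ ν, mul_left_comm]
  · obtain ⟨c, hc⟩ := exists_colDet_update_eq w ν j
    choose s hs using huw
    have h1 : colDet w ν = ∑ r, c r * w r (ν j) := by rw [← hc, update_eq_self]
    simp only [detTensor, hc, h1, hs, Finset.mul_sum]
    rw [Finset.sum_comm]
    refine Finset.sum_congr rfl fun r _ => ?_
    rw [mul_left_comm, ← sum_colDet_update_mul, Finset.mul_sum]
    exact Finset.sum_congr rfl fun i _ => by ring
  · obtain ⟨c, hc⟩ := exists_colDet_update_eq u μ i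
    obtain ⟨d, hd⟩ := exists_colDet_update_eq w ν j
    simp only [detTensor, hc, hd, Finset.sum_mul, Finset.mul_sum]
    rw [sum_comm_pairs, Finset.sum_comm]
    refine Finset.sum_eq_zero fun r _ => Finset.sum_eq_zero fun s _ => ?_
    have := congrArg (fun z => c r * d s * z) (hg r s)
    simp only [mul_zero, Finset.mul_sum] at this
    rw [← this]
    exact Finset.sum_congr rfl fun α _ => Finset.sum_congr rfl fun β _ => by ring

/-! ### A vanishing criterion for functions on `q`-element subsets -/

theorem exists_perm_comp_eq {α X : Type} [Finite α] {x y : X → α}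
    (hx : Injective x) (hy : Injective y) : ∃ π : Perm α, ∀ s, π (x s) = y s := by
  classical
  have := Fintype.ofFinite α
  let e : {c // c ∈ Set.range x} ≃ {c // c ∈ Set.range y} :=
    (Equiv.ofInjective x hx).symm.trans (Equiv.ofInjective y hy)
  refine ⟨e.extendSubtype, fun s => ?_⟩
  rw [Equiv.extendSubtype_apply_of_mem e (x s) ⟨s, rfl⟩]
  have : (Equiv.ofInjective x hx).symm ⟨x s, s, rfl⟩ = s := by
    rw [Equiv.symm_apply_eq]; rfl
  simp [e, this]

/-- A symmetric function of `q` distinct points outside `F`, all of whose partial sums vanish,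
is zero as soon as it is annihilated by all products of `q` disjoint transpositions. -/
theorem eq_zero_of_alternating_sums {ι : Type} [Fintype ι] [DecidableEq ι] {q : ℕ} (F : Set ι)
    (t : (Fin q → ι) → ℂ) (hinj : ∀ x, ¬ Injective x → t x = 0) (hF : ∀ x j, x j ∈ F → t x = 0)
    (hsymm : ∀ x i j, t (x ∘ Equiv.swap i j) = t x) (hsum : ∀ x j, ∑ c, t (update x j c) = 0)
    (halt : ∀ a b : Fin q → ι, Injective (Sum.elim a b) → (∀ j, a j ∉ F) → (∀ j, b j ∉ F) →
      ∑ S : Finset (Fin q), (-1) ^ S.card * t (S.piecewise b a) = 0)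
    (x : Fin q → ι) : t x = 0 := by
  classical
  have hdup : ∀ (x : Fin q → ι) (i j : Fin q), i ≠ j → x i = x j → t x = 0 :=
    fun x i j hij h => hinj x fun hx => hij (hx h)
  -- The alternating sum over the replacements of `a j` by `b j` for `j ∈ J` only. `Ok` says that
  -- the points involved are distinct and avoid `F`; the values of `b` outside `J` are
  -- unconstrained.
  let D : Finset (Fin q) → (Fin q → ι) → (Fin q → ι) → ℂ := fun J a b =>
    ∑ S ∈ J.powerset, (-1) ^ S.card * t (S.piecewise b a)
  let Ok : Finset (Fin q) → (Fin q → ι) → (Fin q → ι) → Prop := fun J a b =>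
    Injective a ∧ (∀ j, a j ∉ F) ∧ (∀ i ∈ J, ∀ j ∈ J, b i = b j → i = j) ∧ (∀ j ∈ J, b j ∉ F) ∧
      ∀ i, ∀ j ∈ J, a i ≠ b j
  -- One transposition is removed by averaging: slot `j` is filled with an arbitrary point `c` and
  -- the result is summed over all `c`.
  have step : ∀ J j, j ∉ J → (∀ a b, Ok (insert j J) a b → D (insert j J) a b = 0) →
      ∀ a b, Ok J a b → D J a b = 0 := by
    rintro J j hj hJ a b ⟨ha, haF, hb, hbF, hab⟩
    let G : ι → ℂ := fun c =>
      ∑ S ∈ J.powerset, (-1) ^ S.card * t (update (S.piecewise b a) j c)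
    have hG : ∑ c, G c = 0 := by
      rw [Finset.sum_comm]
      refine Finset.sum_eq_zero fun S _ => ?_
      rw [← Finset.mul_sum, hsum, mul_zero]
    have hne : ∀ i ∈ J, i ≠ j := fun i hi h => hj (h ▸ hi)
    have hjS : ∀ S ∈ J.powerset, j ∉ S := fun S hS h => hj (Finset.mem_powerset.1 hS h)
    have hGa : G (a j) = D J a b := by
      refine Finset.sum_congr rfl fun S hS => ?_
      congr 2
      rw [update_eq_self_iff, Finset.piecewise_eq_of_notMem _ _ _ (hjS S hS)]
    have hGF : ∀ c ∈ F, G c = 0 := fun c hc => Finset.sum_eq_zero fun S _ => by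
      rw [hF _ j (by simpa using hc), mul_zero]
    -- Taking `c` as the new partner `b j`, the vanishing sum for `insert j J` is the difference `G
    -- (a j) - G c`.
    have hGfree : ∀ c, c ∉ F → (∀ i, a i ≠ c) → (∀ i ∈ J, b i ≠ c) → G c = D J a b := by
      intro c hc hca hcb
      have h1 := hJ a (update b j c) ⟨ha, haF, ?_, ?_, ?_⟩
      · simp only [D] at h1 ⊢
        rw [Finset.sum_powerset_insert hj, ← Finset.sum_add_distrib] at h1
        rw [← sub_eq_zero, ← neg_eq_zero, neg_sub, ← h1, ← Finset.sum_sub_distrib]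
        refine Finset.sum_congr rfl fun S hS => ?_
        have h2 : S.piecewise (update b j c) a = S.piecewise b a := by
          funext l
          by_cases hl : l ∈ S
          · have : l ≠ j := fun h => hjS S hS (h ▸ hl)
            simp [hl, this]
          · simp [hl]
        have h3 : (insert j S).piecewise (update b j c) a = update (S.piecewise b a) j c := by
          rw [Finset.piecewise_insert, h2]
          simp
        rw [h2, h3, Finset.card_insert_of_notMem (hjS S hS), pow_succ]
        ring
      · intro i hi i' hi' h
        rcases Finset.mem_insert.1 hi with rfl | hi₁ <;>
          rcases Finset.mem_insert.1 hi' with rfl | hi₂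
        · rfl
        · rw [update_self, update_of_ne (hne _ hi₂)] at h
          exact absurd h.symm (hcb _ hi₂)
        · rw [update_self, update_of_ne (hne _ hi₁)] at h
          exact absurd h (hcb _ hi₁)
        · rw [update_of_ne (hne _ hi₁), update_of_ne (hne _ hi₂)] at h
          exact hb _ hi₁ _ hi₂ h
      · intro i hi
        rcases Finset.mem_insert.1 hi with rfl | hi
        · simpa using hc
        · rw [update_of_ne (hne _ hi)]
          exact hbF i hi
      · intro i i' hi'
        rcases Finset.mem_insert.1 hi' with rfl | hi'
        · simpa using hca i
        · rw [update_of_ne (hne _ hi')]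
          exact hab i i' hi'
    have hGout : ∀ i, i ≠ j → i ∉ J → G (a i) = 0 := by
      intro i hij hi
      refine Finset.sum_eq_zero fun S hS => ?_
      have hiS : i ∉ S := fun h => hi (Finset.mem_powerset.1 hS h)
      rw [hdup _ i j hij (by simp [hij, hiS]), mul_zero]
    -- With `a i` or `b i` in slot `j`, the terms repeating this point vanish. The remaining ones
    -- differ by a swap of slots `i` and `j`, and their signs are opposite.
    have hGpair : ∀ i ∈ J, G (a i) + G (b i) = 0 := by
      intro i hi
      have hij : i ≠ j := fun h => hj (h ▸ hi)
      have hJi : J = insert i (J.erase i) := (Finset.insert_erase hi).symm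
      simp only [G]
      rw [hJi, Finset.sum_powerset_insert (Finset.notMem_erase i J),
        Finset.sum_powerset_insert (Finset.notMem_erase i J), ← Finset.sum_add_distrib,
        ← Finset.sum_add_distrib, ← Finset.sum_add_distrib]
      refine Finset.sum_eq_zero fun S hS => ?_
      have hiS : i ∉ S := fun h => by simpa using Finset.mem_powerset.1 hS h
      have hjS' : j ∉ S := fun h => hj (Finset.mem_of_mem_erase (Finset.mem_powerset.1 hS h))
      have e1 : t (update (S.piecewise b a) j (a i)) = 0 :=
        hdup _ i j hij (by simp [hij, hiS])
      have e2 : t (update ((insert i S).piecewise b a) j (b i)) = 0 :=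
        hdup _ i j hij (by simp [hij])
      have e3 : update ((insert i S).piecewise b a) j (a i) =
          update (S.piecewise b a) j (b i) ∘ Equiv.swap i j := by
        funext l
        by_cases h1 : l = j
        · subst h1
          simp [hij, hiS]
        by_cases h2 : l = i
        · subst h2
          simp [hij]
        rw [comp_apply, Equiv.swap_apply_of_ne_of_ne h2 h1, update_of_ne h1, update_of_ne h1,
          Finset.piecewise_insert, update_of_ne h2]
      rw [e1, e2, e3, hsymm, Finset.card_insert_of_notMem hiS, pow_succ]
      ring
    -- On `U` the function `G` is constantly `D J a b`, and its sum over the complement is zero. As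
    -- the total sum vanishes and `U` contains `a j`, the constant is zero.
    let U : Finset ι :=
      Finset.univ.filter fun c => c ∉ F ∧ (∀ i, i ≠ j → a i ≠ c) ∧ ∀ i ∈ J, b i ≠ c
    have hU : ∀ c ∈ U, G c = D J a b := by
      intro c hc
      simp only [U, Finset.mem_filter_univ] at hc
      by_cases h : a j = c
      · rw [← h, hGa]
      · refine hGfree c hc.1 (fun i => ?_) hc.2.2
        by_cases hi : i = j
        · rwa [hi]
        · exact hc.2.1 i hi
    have hUc : ∑ c ∈ Uᶜ, G c = 0 := by
      have hsub : J.image a ∪ J.image b ⊆ Uᶜ := by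
        intro c hc
        simp only [Finset.mem_union, Finset.mem_image] at hc
        simp only [U, Finset.mem_compl, Finset.mem_filter_univ, not_and]
        intro _ h1 h2
        rcases hc with ⟨i, hi, rfl⟩ | ⟨i, hi, rfl⟩
        · exact h1 i (fun h => hj (h ▸ hi)) rfl
        · exact h2 i hi rfl
      rw [← Finset.sum_subset hsub, Finset.sum_union, Finset.sum_image, Finset.sum_image,
        ← Finset.sum_add_distrib]
      · exact Finset.sum_eq_zero hGpair
      · exact fun i hi i' hi' h => hb i hi i' hi' h
      · exact fun i _ i' _ h => ha h
      · rw [Finset.disjoint_left]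
        intro c hc hc'
        simp only [Finset.mem_image] at hc hc'
        obtain ⟨i, -, rfl⟩ := hc
        obtain ⟨i', hi', h⟩ := hc'
        exact hab i i' hi' h.symm
      · intro c hc hc'
        simp only [U, Finset.mem_compl, Finset.mem_filter_univ, not_and, not_forall] at hc
        simp only [Finset.mem_union, Finset.mem_image, not_or, not_exists, not_and] at hc'
        by_cases h1 : c ∈ F
        · exact hGF c h1
        by_cases h2 : ∃ i, i ≠ j ∧ a i = c
        · obtain ⟨i, hi, rfl⟩ := h2
          exact hGout i hi fun h => hc'.1 i h rfl
        · push Not at h2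
          obtain ⟨i, hi, h⟩ := hc h1 h2
          exact absurd (not_not.1 h) (hc'.2 i hi)
    rw [← Finset.sum_add_sum_compl U, hUc, add_zero, Finset.sum_congr rfl hU, Finset.sum_const,
      nsmul_eq_mul, mul_eq_zero] at hG
    refine hG.resolve_left ?_
    have : a j ∈ U := by
      simp only [U, Finset.mem_filter_univ]
      exact ⟨haF j, fun i hi h => hi (ha h), fun i hi h => hab j i hi h.symm⟩
    exact_mod_cast Finset.card_ne_zero_of_mem this
  -- Descending induction on `J = Kᶜ`: the full set is the hypothesis `halt`, and the empty set
  -- leaves the single value `t a`.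
  have all : ∀ K : Finset (Fin q), ∀ a b, Ok Kᶜ a b → D Kᶜ a b = 0 := by
    intro K
    induction K using Finset.induction_on with
    | empty =>
      rintro a b ⟨ha, haF, hb, hbF, hab⟩
      simp only [Finset.compl_empty, D, Finset.powerset_univ]
      refine halt a b ?_ haF fun j => hbF j (by simp)
      rw [Sum.elim_injective]
      exact ⟨ha, fun i j h => hb i (by simp) j (by simp) h, fun i j => hab i j (by simp)⟩
    | insert j K hj ih =>
      have h1 : insert j (insert j K)ᶜ = Kᶜ := by
        ext l
        simp only [Finset.mem_insert, Finset.mem_compl, not_or]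
        by_cases h : l = j
        · simp [h, hj]
        · simp [h]
      exact step _ j (by simp) (by rw [h1]; exact ih)
  by_cases hx : Injective x
  · by_cases hxF : ∃ j, x j ∈ F
    · obtain ⟨j, hj⟩ := hxF
      exact hF x j hj
    · push Not at hxF
      have := all Finset.univ x x ⟨hx, hxF, by simp, by simp, by simp⟩
      simpa [D] using this
  · exact hinj x hx

/-! ### Some orthogonal matrices and their action on tensors -/

/-- The signed permutation matrix `e_i ↦ s_i e_{π i}`. -/
def signedPerm {ι : Type} [DecidableEq ι] (s : ι → ℝ) (π : Perm ι) : Matrix ι ι ℝ :=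
  Matrix.of fun α i => s i * (Pi.single (π i) 1 : ι → ℝ) α

theorem signedPerm_mem {n : ℕ} {s : Fin n → ℝ} (hs : ∀ i, s i * s i = 1) (π : Perm (Fin n)) :
    signedPerm s π ∈ Matrix.orthogonalGroup (Fin n) ℝ := by
  rw [Matrix.mem_orthogonalGroup_iff']
  ext i j
  simp only [Matrix.mul_apply, Matrix.transpose_apply, signedPerm, Matrix.of_apply,
    Matrix.one_apply]
  rw [Finset.sum_eq_single (π i)]
  · by_cases h : i = j
    · subst h; simp [hs]
    · simp [h]
  · intro α _ h
    simp [h]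
  · simp

theorem pull_signedPerm {ι : Type} [Fintype ι] [DecidableEq ι] {a b : ℕ} (s : ι → ℝ) (π : Perm ι)
    (T : BiTensor ι a b) (μ : Fin a → ι) (ν : Fin b → ι) :
    pull (signedPerm s π) T μ ν =
      (((∏ i, s (μ i)) * ∏ j, s (ν j) : ℝ) : ℂ) * T (π ∘ μ) (π ∘ ν) := by
  rw [pull_apply, ev]
  have h : (Sum.elim (fun i α => ((signedPerm s π α (μ i) : ℝ) : ℂ))
      (fun j β => ((signedPerm s π β (ν j) : ℝ) : ℂ)) : Fin a ⊕ Fin b → ι → ℂ) =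
      fun t => ((s (Sum.elim μ ν t) : ℝ) : ℂ) •
        (Pi.single (Sum.elim (π ∘ μ) (π ∘ ν) t) 1 : ι → ℂ) := by
    funext t α
    rcases t with t | t <;>
    · simp only [signedPerm, Sum.elim_inl, Sum.elim_inr, Matrix.of_apply, Pi.smul_apply,
        Pi.single_apply, comp_apply, smul_eq_mul]
      split_ifs <;> simp
  rw [h, MultilinearMap.map_smul_univ, mev_single, Fintype.prod_sum_type]
  simp only [Sum.elim_inl, Sum.elim_inr, smul_eq_mul, joint, Sum.elim_comp_inl, Sum.elim_comp_inr,
    Complex.ofReal_mul, Complex.ofReal_prod]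

/-- The orthogonal reflection interchanging `e_a` and `(e_a + e_b)/√2`. -/
def hadamard {n : ℕ} (a b : Fin n) : Matrix (Fin n) (Fin n) ℝ :=
  Matrix.of fun α i =>
    if i = a then (√2)⁻¹ * ((Pi.single a 1 : Fin n → ℝ) α + (Pi.single b 1 : Fin n → ℝ) α)
    else if i = b then (√2)⁻¹ * ((Pi.single a 1 : Fin n → ℝ) α - (Pi.single b 1 : Fin n → ℝ) α)
    else (Pi.single i 1 : Fin n → ℝ) α

theorem hadamard_mem {n : ℕ} {a b : Fin n} (hab : a ≠ b) :
    hadamard a b ∈ Matrix.orthogonalGroup (Fin n) ℝ := by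
  rw [Matrix.mem_orthogonalGroup_iff']
  have hc : (√2)⁻¹ * (√2)⁻¹ = (1 / 2 : ℝ) := by
    rw [← mul_inv, Real.mul_self_sqrt (by norm_num)]; norm_num
  have hs : ∀ (x y : Fin n), ∑ α, (Pi.single x 1 : Fin n → ℝ) α * (Pi.single y 1 : Fin n → ℝ) α =
      if x = y then 1 else 0 := by
    intro x y
    simp [Pi.single_apply, eq_comm]
  have h1 : ∀ f g h k : Fin n → ℝ, ∑ α, (√2)⁻¹ * (f α + g α) * ((√2)⁻¹ * (h α + k α)) =
      (1 / 2) * (∑ α, f α * h α + ∑ α, f α * k α + ∑ α, g α * h α + ∑ α, g α * k α) := by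
    intro f g h k
    rw [← hc, ← Finset.sum_add_distrib, ← Finset.sum_add_distrib, ← Finset.sum_add_distrib,
      Finset.mul_sum]
    exact Finset.sum_congr rfl fun α _ => by ring
  have h2 : ∀ f h k : Fin n → ℝ, ∑ α, f α * ((√2)⁻¹ * (h α + k α)) =
      (√2)⁻¹ * (∑ α, f α * h α + ∑ α, f α * k α) := by
    intro f h k
    rw [← Finset.sum_add_distrib, Finset.mul_sum]
    exact Finset.sum_congr rfl fun α _ => by ring
  have h3 : ∀ f h k : Fin n → ℝ, ∑ α, (√2)⁻¹ * (h α + k α) * f α =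
      (√2)⁻¹ * (∑ α, h α * f α + ∑ α, k α * f α) := by
    intro f h k
    rw [← Finset.sum_add_distrib, Finset.mul_sum]
    exact Finset.sum_congr rfl fun α _ => by ring
  ext i j
  simp only [Matrix.mul_apply, Matrix.transpose_apply, hadamard, Matrix.of_apply, Matrix.one_apply,
    sub_eq_add_neg]
  by_cases hia : i = a <;> by_cases hib : i = b <;> by_cases hja : j = a <;>
    by_cases hjb : j = b <;>
  simp only [hia, hib, hja, hjb, hab, hab.symm, if_true, if_false, h1, h2, h3, hs, mul_neg, neg_mul,
    Finset.sum_neg_distrib] <;> grind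

/-- Pulling back by the reflection puts `(e_x + e_y)/√2` into both slots and leaves the others
unchanged. Of the four terms the two with equal indices vanish, leaving half the sum of the mixed
ones. -/
theorem polarize {n a b : ℕ} {T : BiTensor (Fin n) a b} {μ : Fin a → Fin n} {ν : Fin b → Fin n}
    {i : Fin a} {j : Fin b} {x y : Fin n} (hμ : ∀ l, l ≠ i → μ l ≠ x ∧ μ l ≠ y)
    (hν : ∀ l, l ≠ j → ν l ≠ x ∧ ν l ≠ y) (hx : T (update μ i x) (update ν j x) = 0)
    (hy : T (update μ i y) (update ν j y) = 0)
    (h : pull (hadamard x y) T (update μ i x) (update ν j x) = 0) :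
    T (update μ i x) (update ν j y) + T (update μ i y) (update ν j x) = 0 := by
  have key : ∀ {m : ℕ} (μ : Fin m → Fin n) (i : Fin m), (∀ l, l ≠ i → μ l ≠ x ∧ μ l ≠ y) →
      (fun l α => ((hadamard x y α (update μ i x l) : ℝ) : ℂ)) =
      update (fun l => (Pi.single (μ l) 1 : Fin n → ℂ)) i
        fun α => (((√2)⁻¹ : ℝ) : ℂ) *
          ((Pi.single x 1 : Fin n → ℂ) α + (Pi.single y 1 : Fin n → ℂ) α) := by
    intro m μ i hμ
    funext l α
    by_cases hl : l = i
    · subst hl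
      simp only [hadamard, update_self, Matrix.of_apply, if_true, Pi.single_apply]
      split_ifs <;> simp
    · simp only [hadamard, update_of_ne hl, Matrix.of_apply, (hμ l hl).1, (hμ l hl).2, if_false,
        Pi.single_apply]
      split_ifs <;> simp
  have hup : ∀ {m : ℕ} (μ : Fin m → Fin n) (i : Fin m) (c : Fin n),
      update (fun l => (Pi.single (μ l) 1 : Fin n → ℂ)) i (Pi.single c 1) =
        fun l => Pi.single (update μ i c l) 1 := by
    intro m μ i c
    funext l
    by_cases hl : l = i
    · subst hl; simp
    · simp [hl]
  rw [pull_apply, key μ i hμ, key ν j hν, ev_update_left] at h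
  simp only [ev_update_right _ _ _ j fun α => _ * _, hup, ev_single, mul_assoc,
    ← Finset.mul_sum] at h
  have hsplit : ∀ f : Fin n → ℂ,
      ∑ c, ((Pi.single x 1 : Fin n → ℂ) c + (Pi.single y 1 : Fin n → ℂ) c) * f c
      = f x + f y := by
    intro f
    simp [add_mul, Finset.sum_add_distrib, Pi.single_apply]
  have h2 : (((√2)⁻¹ : ℝ) : ℂ) ≠ 0 := by
    simp
  simp only [mul_left_comm _ (((√2)⁻¹ : ℝ) : ℂ), ← Finset.mul_sum, hsplit, mul_eq_zero, h2,
    false_or] at h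
  rw [hx, hy] at h
  linear_combination h

/-! ### Invariant families of tensors of type `[q+r,q]` -/

/-- If in all tensors of an invariant family the components whose second column is contained in the
first one vanish, then all components vanish. -/
theorem eq_zero_of_contained {n p q : ℕ} {W : Set (BiTensor (Fin n) p q)}
    (hY : ∀ T ∈ W, IsYoung T)
    (hW : ∀ M ∈ Matrix.orthogonalGroup (Fin n) ℝ, ∀ T ∈ W, pull M T ∈ W)
    (h : ∀ T ∈ W, ∀ μ ν, Set.range ν ⊆ Set.range μ → T μ ν = 0) {T : BiTensor (Fin n) p q}
    (hT : T ∈ W) (μ : Fin p → Fin n) (ν : Fin q → Fin n) : T μ ν = 0 := by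
  classical
  let cnt : (Fin p → Fin n) → (Fin q → Fin n) → ℕ := fun μ ν =>
    (Finset.univ.filter fun j => ν j ∈ Set.range μ).card
  -- `m` bounds the number of entries of the second column that are missing from the first.
  suffices H : ∀ m : ℕ, ∀ T ∈ W, ∀ μ ν, q ≤ cnt μ ν + m → T μ ν = 0 from
    H q T hT μ ν (by omega)
  intro m
  induction m with
  | zero =>
    intro T hT μ ν hc
    refine h T hT μ ν ?_
    have h1 : (Finset.univ.filter fun j => ν j ∈ Set.range μ) = Finset.univ := by
      rw [← Finset.card_eq_iff_eq_univ, Fintype.card_fin]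
      exact le_antisymm ((Finset.card_le_univ _).trans (by simp)) hc
    rintro _ ⟨j, rfl⟩
    have h2 := Finset.mem_univ j
    rw [← h1] at h2
    simpa only [Finset.mem_filter_univ] using h2
  | succ m ih =>
    intro T hT μ ν hc
    by_cases hall : ∀ j, ν j ∈ Set.range μ
    · exact h T hT μ ν (by rintro _ ⟨j, rfl⟩; exact hall j)
    push Not at hall
    obtain ⟨j, hj⟩ := hall
    have hYT := hY T hT
    by_cases hμ : Injective μ
    swap
    · exact (hYT.left ν).eq_zero_of_not_injective hμ
    by_cases hν : Injective ν
    swap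
    · exact (hYT.right μ).eq_zero_of_not_injective hν
    have hμj : ∀ i, μ i ≠ ν j := fun i hi => hj ⟨i, hi⟩
    -- If `μ i` already occurs in `ν`, the exchanged second column has a repeated index. Otherwise
    -- the two components with equal indices in slots `i` and `j` have one more contained entry, so
    -- they vanish by induction, and polarization makes the exchanged component `-T μ ν`.
    have key : ∀ i, T (update μ i (ν j)) (update ν j (μ i)) =
        if μ i ∈ Set.range ν then 0 else -T μ ν := by
      intro i
      split_ifs with hi
      · obtain ⟨l, hl⟩ := hi
        have hlj : l ≠ j := by rintro rfl; exact hμj i hl.symm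
        exact (hYT.right _).eq_zero hlj (by simp [hlj, hl])
      · have hνi : ∀ l, ν l ≠ μ i := fun l hl => hi ⟨l, hl⟩
        have hcx : q ≤ cnt (update μ i (μ i)) (update ν j (μ i)) + m := by
          have : cnt μ ν < cnt (update μ i (μ i)) (update ν j (μ i)) := by
            refine Finset.card_lt_card ⟨fun l hl => ?_, fun hsub => ?_⟩
            · simp only [Finset.mem_filter_univ, update_eq_self] at hl ⊢
              have : l ≠ j := by rintro rfl; exact hj hl
              rwa [update_of_ne this]
            · have := hsub (x := j) (by simp)
              exact hj (by simpa using this)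
          omega
        have hcy : q ≤ cnt (update μ i (ν j)) (update ν j (ν j)) + m := by
          have : cnt μ ν < cnt (update μ i (ν j)) (update ν j (ν j)) := by
            refine Finset.card_lt_card ⟨fun l hl => ?_, fun hsub => ?_⟩
            · simp only [Finset.mem_filter_univ, update_eq_self] at hl ⊢
              obtain ⟨t, ht⟩ := hl
              have : t ≠ i := by rintro rfl; exact hνi l ht.symm
              exact ⟨t, by rw [update_of_ne this, ht]⟩
            · have := hsub (x := j) (by
                simp only [Finset.mem_filter_univ, update_eq_self]
                exact ⟨i, by simp⟩)
              exact hj (by simpa using this)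
          omega
        have := polarize (T := T) (μ := μ) (ν := ν) (i := i) (j := j) (x := μ i) (y := ν j)
          (fun l hl => ⟨fun h' => hl (hμ h'), hμj l⟩) (fun l hl => ⟨hνi l, fun h' => hl (hν h')⟩)
          (ih T hT _ _ hcx) (ih T hT _ _ hcy)
          (ih _ (hW _ (hadamard_mem (hμj i)) T hT) _ _ hcx)
        simp only [update_eq_self] at this
        linear_combination this
    have hex := hYT.exch μ ν j
    simp only [key, Finset.sum_ite, Finset.sum_const_zero, zero_add, Finset.sum_const,
      nsmul_eq_mul] at hex
    set c := (Finset.univ.filter fun i => μ i ∉ Set.range ν).card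
    -- The exchange relation now reads `T μ ν = -c T μ ν`, with `c` the number of entries of the
    -- first column absent from the second.
    have h2 : ((c + 1 : ℕ) : ℂ) * T μ ν = 0 := by
      push_cast
      linear_combination hex
    exact (mul_eq_zero.1 h2).resolve_left (by exact_mod_cast c.succ_ne_zero)

/-! ### Alternating sums and nested columns -/

/-- The alternating sum over the exchanges `a_j ↔ b_j` of the components
`T_{a f | a}`. -/
def altSum {ι : Type} {q r : ℕ} (a b : Fin q → ι) (f : Fin r → ι) (T : BiTensor ι (q + r) q) : ℂ :=
  ∑ S : Finset (Fin q),
    (-1) ^ S.card * T (Fin.append (S.piecewise b a) f) (S.piecewise b a)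

theorem comp_append {A B : Type} {q r : ℕ} (g : A → B) (x : Fin q → A) (f : Fin r → A) :
    g ∘ Fin.append x f = Fin.append (g ∘ x) (g ∘ f) := by
  funext i
  refine Fin.addCases (fun i => ?_) (fun i => ?_) i <;> simp

theorem append_update {A : Type} {q r : ℕ} (x : Fin q → A) (f : Fin r → A) (j : Fin q) (c : A) :
    Fin.append (update x j c) f = update (Fin.append x f) (Fin.castAdd r j) c := by
  funext i
  refine Fin.addCases (fun i => ?_) (fun i => ?_) i
  · by_cases h : i = j
    · subst h; simp
    · have : Fin.castAdd r i ≠ Fin.castAdd r j := fun h' => h (Fin.castAdd_injective _ _ h')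
      simp [h]
  · have : Fin.natAdd q i ≠ Fin.castAdd r j := by
      intro h; have := congrArg Fin.val h; simp at this; omega
    simp [this]

theorem append_comp_swap {A : Type} {q r : ℕ} (x : Fin q → A) (f : Fin r → A) (i j : Fin q) :
    Fin.append (x ∘ Equiv.swap i j) f =
      Fin.append x f ∘ Equiv.swap (Fin.castAdd r i) (Fin.castAdd r j) := by
  funext l
  refine Fin.addCases (fun l => ?_) (fun l => ?_) l
  · rw [comp_apply, ← (Fin.castAdd_injective q r).map_swap]
    simp
  · rw [comp_apply, Equiv.swap_apply_of_ne_of_ne] <;> simp [Fin.ext_iff] <;> omega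

/-- In an invariant family annihilated by one alternating sum, the components whose second column
is contained in the first one vanish. -/
theorem eq_zero_of_altSum {n q r : ℕ} {W : Set (BiTensor (Fin n) (q + r) q)}
    (hV : ∀ T ∈ W, T ∈ youngTraceless (1 : Matrix (Fin n) (Fin n) ℝ) (q + r) q)
    (hW : ∀ M ∈ Matrix.orthogonalGroup (Fin n) ℝ, ∀ T ∈ W, pull M T ∈ W)
    {a₀ b₀ : Fin q → Fin n} {f₀ : Fin r → Fin n}
    (h₀ : Injective (Sum.elim (Sum.elim a₀ b₀) f₀)) (hE : ∀ T ∈ W, altSum a₀ b₀ f₀ T = 0)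
    {T : BiTensor (Fin n) (q + r) q} (hT : T ∈ W) : T = 0 := by
  have hY : ∀ T ∈ W, IsYoung T := fun T hT => (mem_youngTraceless_iff.1 (hV T hT)).1
  funext μ ν
  refine eq_zero_of_contained hY hW (fun T hT μ ν hμν => ?_) hT μ ν
  have hYT := hY T hT
  by_cases hμ : Injective μ
  swap
  · exact (hYT.left ν).eq_zero_of_not_injective hμ
  by_cases hν : Injective ν
  swap
  · exact (hYT.right μ).eq_zero_of_not_injective hν
  choose e he using fun j => hμν ⟨j, rfl⟩
  have heinj : Injective e := fun i j h => hν (by rw [← he i, ← he j, h])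
  -- The first column is reordered so that it starts with `ν`; the rest is `f`.
  obtain ⟨σ, hσ⟩ := exists_perm_comp_eq (Fin.castAdd_injective q r) heinj
  rw [← (hYT.left ν).perm_eq_zero_iff σ]
  set f : Fin r → Fin n := fun i => μ (σ (Fin.natAdd q i)) with hf
  have hfinj : Injective f := fun i j h => by
    simpa using σ.injective (hμ h)
  have happ : μ ∘ σ = Fin.append ν f := by
    funext i
    refine Fin.addCases (fun i => ?_) (fun i => ?_) i
    · rw [comp_apply, hσ, he, Fin.append_left]
    · rw [Fin.append_right]; rfl
  rw [happ]
  -- For fixed `f`, the component `T_{x f|x}` is symmetric in `x`, since a swap changes sign in both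
  -- columns, and its partial sums are traces of `T`. Invariance under coordinate permutations
  -- carries the given alternating sum to all others.
  refine eq_zero_of_alternating_sums (Set.range f) (fun x => T (Fin.append x f) x)
    (fun x hx => (hYT.right _).eq_zero_of_not_injective hx) ?_ ?_ ?_ ?_ ν
  · rintro x j ⟨i, hi⟩
    refine (hYT.left x).eq_zero (i := Fin.castAdd r j) (j := Fin.natAdd q i) ?_ (by simp [hi])
    intro h; have := congrArg Fin.val h; simp at this; omega
  · intro x i j
    by_cases hij : i = j
    · subst hij; simp
    · simp only [append_comp_swap]
      rw [(hYT.right _).swap hij]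
      have := (hYT.left x).swap (show Fin.castAdd r i ≠ Fin.castAdd r j from
        fun h => hij (Fin.castAdd_injective _ _ h)) (Fin.append x f)
      rw [this, neg_neg]
  · intro x j
    simp only [append_update]
    have := (mem_youngTraceless_iff.1 (hV T hT)).2 (Fin.append x f) x (Fin.castAdd r j) j
    simpa only [Matrix.one_apply, apply_ite Complex.ofReal, Complex.ofReal_one,
      Complex.ofReal_zero, ite_mul, one_mul, zero_mul, Finset.sum_ite_eq, Finset.mem_univ,
      if_true] using this
  · intro a b hab ha hb
    have hinj : Injective (Sum.elim (Sum.elim a b) f) := by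
      refine hab.sumElim hfinj ?_
      rintro (j | j) i h
      · exact ha j ⟨i, h.symm⟩
      · exact hb j ⟨i, h.symm⟩
    obtain ⟨π, hπ⟩ := exists_perm_comp_eq h₀ hinj
    have h1 := hE _ (hW _ (signedPerm_mem (s := fun _ => 1) (by simp) π) T hT)
    have hpf : π ∘ f₀ = f := funext fun i => hπ (Sum.inr i)
    have hpw : ∀ S : Finset (Fin q), π ∘ S.piecewise b₀ a₀ = S.piecewise b a := by
      intro S
      funext j
      by_cases hj : j ∈ S
      · simpa [hj] using hπ (Sum.inl (Sum.inr j))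
      · simpa [hj] using hπ (Sum.inl (Sum.inl j))
    simpa [altSum, pull_signedPerm, comp_append, hpf, hpw] using h1

/-! ### Parities under sign changes and transpositions -/

/-- The sign change of one coordinate. -/
def flip {ι : Type} [DecidableEq ι] (c i : ι) : ℝ := if i = c then -1 else 1

theorem flip_mul_self {ι : Type} [DecidableEq ι] (c i : ι) : flip c i * flip c i = 1 := by
  unfold flip; split_ifs <;> norm_num

theorem prod_flip {ι : Type} [DecidableEq ι] {m : ℕ} {μ : Fin m → ι} (hμ : Injective μ) (c : ι) :
    ∏ i, flip c (μ i) = if c ∈ Finset.univ.image μ then -1 else 1 := by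
  split_ifs with h
  · obtain ⟨i, -, hi⟩ := Finset.mem_image.1 h
    rw [Fintype.prod_eq_single i]
    · simp [flip, hi]
    · intro j hj
      exact if_neg fun h' => hj (hμ (h'.trans hi.symm))
  · refine Finset.prod_eq_one fun i _ => if_neg fun h' => h ?_
    exact Finset.mem_image.2 ⟨i, Finset.mem_univ i, h'⟩

/-- Each chosen `a_j` or `b_j` occurs in both columns, so its sign is squared away and only `f`
contributes. -/
theorem altSum_flip {n q r : ℕ} (a b : Fin q → Fin n) (f : Fin r → Fin n) (c : Fin n)
    (T : BiTensor (Fin n) (q + r) q) :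
    altSum a b f (pull (signedPerm (flip c) 1) T) =
      ((∏ i, flip c (f i) : ℝ) : ℂ) * altSum a b f T := by
  simp only [altSum, Finset.mul_sum, pull_signedPerm, Fin.prod_univ_add, Fin.append_left,
    Fin.append_right, Perm.coe_one, id_comp]
  refine Finset.sum_congr rfl fun S _ => ?_
  have : (∏ j, flip c (S.piecewise b a j)) * (∏ j, flip c (S.piecewise b a j)) = 1 := by
    rw [← Finset.prod_mul_distrib]
    exact Finset.prod_eq_one fun j _ => flip_mul_self _ _
  rw [mul_right_comm, this, one_mul]
  ring

/-- The transposition toggles the membership of `j` in `S`, which reverses the sign of every term.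
-/
theorem altSum_swap {n q r : ℕ} {a b : Fin q → Fin n} {f : Fin r → Fin n}
    (h₀ : Injective (Sum.elim (Sum.elim a b) f)) (j : Fin q) (T : BiTensor (Fin n) (q + r) q) :
    altSum a b f (pull (signedPerm (fun _ => 1) (Equiv.swap (a j) (b j))) T) =
      -altSum a b f T := by
  classical
  have hab : ∀ i l, a i ≠ b l := fun i l h => by
    simpa using h₀ (a₁ := Sum.inl (Sum.inl i)) (a₂ := Sum.inl (Sum.inr l)) h
  have haf : ∀ i l, f i ≠ a l := fun i l h => by
    simpa using h₀ (a₁ := Sum.inr i) (a₂ := Sum.inl (Sum.inl l)) h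
  have hbf : ∀ i l, f i ≠ b l := fun i l h => by
    simpa using h₀ (a₁ := Sum.inr i) (a₂ := Sum.inl (Sum.inr l)) h
  have ha : ∀ i l, a i = a l → i = l := fun i l h => by
    simpa using h₀ (a₁ := Sum.inl (Sum.inl i)) (a₂ := Sum.inl (Sum.inl l)) h
  have hb : ∀ i l, b i = b l → i = l := fun i l h => by
    simpa using h₀ (a₁ := Sum.inl (Sum.inr i)) (a₂ := Sum.inl (Sum.inr l)) h
  set π := Equiv.swap (a j) (b j) with hπ
  have hpf : π ∘ f = f := funext fun i => Equiv.swap_apply_of_ne_of_ne (haf i j) (hbf i j)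
  have hu : (Finset.univ : Finset (Finset (Fin q))) =
      (insert j (Finset.univ.erase j)).powerset := by
    rw [Finset.insert_erase (Finset.mem_univ j), Finset.powerset_univ]
  have hother : ∀ (S : Finset (Fin q)) l, l ≠ j → π (S.piecewise b a l) = S.piecewise b a l := by
    intro S l hl
    by_cases hS : l ∈ S
    · simp only [hS, Finset.piecewise_eq_of_mem]
      exact Equiv.swap_apply_of_ne_of_ne (fun h => hab _ _ h.symm) fun h => hl (hb _ _ h)
    · simp only [hS, not_false_eq_true, Finset.piecewise_eq_of_notMem]
      exact Equiv.swap_apply_of_ne_of_ne (fun h => hl (ha _ _ h)) (hab _ _)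
  have h1 : ∀ S ∈ (Finset.univ.erase j).powerset,
      π ∘ S.piecewise b a = (insert j S).piecewise b a ∧
        π ∘ (insert j S).piecewise b a = S.piecewise b a := by
    intro S hS
    have hj : j ∉ S := fun h => by simpa using Finset.mem_powerset.1 hS h
    constructor <;> funext l <;> by_cases hl : l = j
    · subst hl; simp [hj, hπ]
    · rw [comp_apply, hother S l hl, Finset.piecewise_insert, update_of_ne hl]
    · subst hl; simp [hj, hπ]
    · rw [comp_apply, hother _ l hl, Finset.piecewise_insert, update_of_ne hl]
  simp only [altSum, pull_signedPerm, Finset.prod_const_one, mul_one, Complex.ofReal_one, one_mul,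
    comp_append, hpf]
  rw [hu, Finset.sum_powerset_insert (Finset.notMem_erase j _),
    Finset.sum_powerset_insert (Finset.notMem_erase j _), ← Finset.sum_add_distrib,
    ← Finset.sum_add_distrib, ← Finset.sum_neg_distrib]
  refine Finset.sum_congr rfl fun S hS => ?_
  have hj : j ∉ S := fun h => by simpa using Finset.mem_powerset.1 hS h
  rw [(h1 S hS).1, (h1 S hS).2, Finset.card_insert_of_notMem hj, pow_succ]
  ring

/-- A tensor with the parities of the component `T_{a f | a}` which is odd under the exchanges
`a_j ↔ b_j` is determined by this component. -/
theorem eq_zero_of_parity {n q r : ℕ} {a b : Fin q → Fin n} {f : Fin r → Fin n}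
    (h₀ : Injective (Sum.elim (Sum.elim a b) f)) {T : BiTensor (Fin n) (q + r) q} (hY : IsYoung T)
    (hflip : ∀ c, pull (signedPerm (flip c) 1) T = ((∏ i, flip c (f i) : ℝ) : ℂ) • T)
    (hswap : ∀ j, pull (signedPerm (fun _ => 1) (Equiv.swap (a j) (b j))) T = -T)
    (h : T (Fin.append a f) a = 0) : T = 0 := by
  classical
  have haf : ∀ i l, f i ≠ a l := fun i l h => by
    simpa using h₀ (a₁ := Sum.inr i) (a₂ := Sum.inl (Sum.inl l)) h
  have hbf : ∀ i l, f i ≠ b l := fun i l h => by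
    simpa using h₀ (a₁ := Sum.inr i) (a₂ := Sum.inl (Sum.inr l)) h
  have hab : ∀ i l, a i ≠ b l := fun i l h => by
    simpa using h₀ (a₁ := Sum.inl (Sum.inl i)) (a₂ := Sum.inl (Sum.inr l)) h
  have ha : Injective a := fun i l h => by
    simpa using h₀ (a₁ := Sum.inl (Sum.inl i)) (a₂ := Sum.inl (Sum.inl l)) h
  have hf : Injective f := fun i l h => by
    simpa using h₀ (a₁ := Sum.inr i) (a₂ := Sum.inr l) h
  -- The sign changes force the symmetric difference of the two columns of a nonzero component to be
  -- the set of values of `f`; a count then shows that the first column is the disjoint union of the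
  -- second one and `f`.
  have hshape : ∀ μ ν, T μ ν ≠ 0 → Injective μ ∧ Injective ν ∧
      (∀ c, c ∈ Set.range μ ↔ c ∈ Set.range ν ∨ c ∈ Set.range f) := by
    intro μ ν hT
    have hμ : Injective μ := by
      by_contra hμ
      exact hT ((hY.left ν).eq_zero_of_not_injective hμ)
    have hν : Injective ν := by
      by_contra hν
      exact hT ((hY.right μ).eq_zero_of_not_injective hν)
    refine ⟨hμ, hν, ?_⟩
    set A := Finset.univ.image μ with hA
    set B := Finset.univ.image ν with hB
    set F := Finset.univ.image f with hF
    have hpar : ∀ c, (c ∈ A ∧ c ∉ B ∨ c ∉ A ∧ c ∈ B) ↔ c ∈ F := by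
      intro c
      have h1 := congrFun (congrFun (hflip c) μ) ν
      rw [pull_signedPerm, prod_flip hμ, prod_flip hν, Pi.smul_apply, Pi.smul_apply, smul_eq_mul,
        prod_flip hf, Perm.coe_one, id_comp, id_comp] at h1
      have h2 := mul_right_cancel₀ (b := T μ ν) hT h1
      by_cases h3 : c ∈ A <;> by_cases h4 : c ∈ B <;> by_cases h5 : c ∈ F <;>
        simp only [← hA, ← hB, ← hF, h3, h4, h5, if_true, if_false] at h2 ⊢ <;>
        norm_num at h2 <;> norm_num
    have hcA : A.card = q + r := by simp [hA, Finset.card_image_of_injective _ hμ]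
    have hcB : B.card = q := by simp [hB, Finset.card_image_of_injective _ hν]
    have hcF : F.card = r := by simp [hF, Finset.card_image_of_injective _ hf]
    have hdis : Disjoint (A \ B) (B \ A) := by
      rw [Finset.disjoint_left]
      intro c hc hc'
      simp only [Finset.mem_sdiff] at hc hc'
      exact hc'.2 hc.1
    have hF' : F = (A \ B) ∪ (B \ A) := by
      ext c
      rw [← hpar c]
      simp only [Finset.mem_union, Finset.mem_sdiff]
      tauto
    -- `|A \ B| + |B \ A| = r` by the parities, while `|A \ B| - |B \ A| = r` by the lengths of the
    -- columns.
    have hBA : B \ A = ∅ := by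
      rw [← Finset.card_eq_zero]
      have h1 := Finset.card_union_of_disjoint hdis
      rw [← hF', hcF] at h1
      have h2 := Finset.card_sdiff_add_card_inter A B
      have h3 := Finset.card_sdiff_add_card_inter B A
      rw [Finset.inter_comm] at h3
      omega
    intro c
    have h1 := hpar c
    have h2 : c ∈ B → c ∈ A := fun h => (Finset.sdiff_eq_empty_iff_subset.1 hBA) h
    have eA : c ∈ Set.range μ ↔ c ∈ A := by simp [hA]
    have eB : c ∈ Set.range ν ↔ c ∈ B := by simp [hB]
    have eF : c ∈ Set.range f ↔ c ∈ F := by simp [hF]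
    rw [eA, eB, eF]
    tauto
  -- `m` bounds the number of indices `a j` missing from the second column. If none is missing, the
  -- component is `T_{a f|a}` up to reordering.
  suffices H : ∀ (m : ℕ) (μ ν), (Finset.univ.filter fun j => a j ∉ Set.range ν).card ≤ m →
      T μ ν = 0 by
    funext μ ν
    exact H _ μ ν le_rfl
  intro m
  induction m with
  | zero =>
    intro μ ν hm
    by_contra hT
    obtain ⟨hμ, hν, hsh⟩ := hshape μ ν hT
    have h1 : ∀ j, a j ∈ Set.range ν := by
      intro j
      by_contra hj
      have := Finset.card_pos.2 ⟨j, show j ∈ Finset.univ.filter fun j => a j ∉ Set.range ν by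
        simpa using hj⟩
      omega
    choose τ hτ using h1
    have hτi : Injective τ := fun i j h => ha (by rw [← hτ i, ← hτ j, h])
    have hτ' : ν ∘ Equiv.ofBijective τ (Finite.injective_iff_bijective.1 hτi) = a := funext hτ
    have h2 : ∀ i, Fin.append a f i ∈ Set.range μ := by
      intro i
      rw [hsh]
      refine Fin.addCases (fun i => ?_) (fun i => ?_) i
      · exact Or.inl ⟨τ i, by rw [hτ, Fin.append_left]⟩
      · exact Or.inr ⟨i, by rw [Fin.append_right]⟩
    choose σ hσ using h2
    have happ : Injective (Fin.append a f) := by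
      have : Fin.append a f = Sum.elim a f ∘ finSumFinEquiv.symm := by
        funext i
        refine Fin.addCases (fun i => ?_) (fun i => ?_) i <;> simp
      rw [this]
      exact (ha.sumElim hf fun i j h => haf j i h.symm).comp (Equiv.injective _)
    have hσi : Injective σ := fun i j h => happ (by rw [← hσ i, ← hσ j, h])
    have hσ' : μ ∘ Equiv.ofBijective σ (Finite.injective_iff_bijective.1 hσi) = Fin.append a f :=
      funext hσ
    rw [← hσ', ← hτ', (hY.left _).perm_eq_zero_iff, (hY.right _).perm_eq_zero_iff] at h
    exact hT h
  | succ m ih =>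
    intro μ ν hm
    by_cases h1 : ∀ j, a j ∈ Set.range ν
    · refine ih μ ν ?_
      simp [h1]
    push Not at h1
    obtain ⟨j, hj⟩ := h1
    by_contra hT
    obtain ⟨hμ, hν, hsh⟩ := hshape μ ν hT
    have h2 := congrFun (congrFun (hswap j) μ) ν
    rw [pull_signedPerm] at h2
    simp only [Finset.prod_const_one, mul_one, Complex.ofReal_one, one_mul, Pi.neg_apply] at h2
    have hajμ : a j ∉ Set.range μ := by
      rw [hsh]
      rintro (h3 | ⟨i, h3⟩)
      · exact hj h3
      · exact haf i j h3
    -- If `b j` is present, the swap trades it for the missing `a j`. If neither is present in `ν`,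
    -- neither is present in `μ`; the component is then fixed by the swap and equals its own
    -- negative.
    by_cases hbj : b j ∈ Set.range ν
    · refine hT (neg_eq_zero.1 (h2 ▸ ih _ _ ?_))
      have : (Finset.univ.filter fun l => a l ∉ Set.range (Equiv.swap (a j) (b j) ∘ ν)).card <
          (Finset.univ.filter fun l => a l ∉ Set.range ν).card := by
        refine Finset.card_lt_card ⟨fun l hl => ?_, fun hsub => ?_⟩
        · simp only [Finset.mem_filter_univ] at hl ⊢
          rintro ⟨i, hi⟩
          have hlj : l ≠ j := by rintro rfl; exact hj ⟨i, hi⟩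
          refine hl ⟨i, ?_⟩
          rw [comp_apply, hi, Equiv.swap_apply_of_ne_of_ne (fun h => hlj (ha h)) (hab _ _)]
        · have h3 := hsub (x := j) (by simpa using hj)
          obtain ⟨i, hi⟩ := hbj
          simp only [Finset.mem_filter_univ] at h3
          exact h3 ⟨i, by rw [comp_apply, hi, Equiv.swap_apply_right]⟩
      omega
    · have hbjμ : b j ∉ Set.range μ := by
        rw [hsh]
        rintro (h3 | ⟨i, h3⟩)
        · exact hbj h3
        · exact hbf i j h3
      have e1 : Equiv.swap (a j) (b j) ∘ μ = μ := funext fun i =>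
        Equiv.swap_apply_of_ne_of_ne (fun h => hajμ ⟨i, h⟩) fun h => hbjμ ⟨i, h⟩
      have e2 : Equiv.swap (a j) (b j) ∘ ν = ν := funext fun i =>
        Equiv.swap_apply_of_ne_of_ne (fun h => hj ⟨i, h⟩) fun h => hbj ⟨i, h⟩
      rw [e1, e2] at h2
      exact hT (self_eq_neg.1 h2)

/-! ### The invariant inner product -/

/-- The inner product induced by an injective linear map. -/
@[reducible]
def coreOfInjective {V H : Type} [AddCommGroup V] [Module ℂ V] [NormedAddCommGroup H]
    [InnerProductSpace ℂ H] (f : V →ₗ[ℂ] H) (hf : Injective f) : InnerProductSpace.Core ℂ V where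
  inner x y := inner ℂ (f x) (f y)
  conj_inner_symm x y := inner_conj_symm _ _
  re_inner_nonneg x := inner_self_nonneg
  add_left x y z := by rw [map_add, inner_add_left]
  smul_left x y c := by rw [map_smul, inner_smul_left]
  definite x hx := by
    rw [inner_self_eq_zero] at hx
    exact hf (hx.trans (map_zero f).symm)

/-- Tensors as vectors of a Hilbert space. -/
def toHilbert (ι : Type) (a b : ℕ) :
    BiTensor ι a b ≃ₗ[ℂ] EuclideanSpace ℂ ((Fin a → ι) × (Fin b → ι)) :=
  (LinearEquiv.curry ℂ ℂ (Fin a → ι) (Fin b → ι)).symm.trans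
    (WithLp.linearEquiv 2 ℂ ((Fin a → ι) × (Fin b → ι) → ℂ)).symm

/-- The standard inner product of tensors. -/
def tdot {ι : Type} [Fintype ι] {a b : ℕ} (S T : BiTensor ι a b) : ℂ :=
  inner ℂ (toHilbert ι a b S) (toHilbert ι a b T)

theorem tdot_eq_sum {ι : Type} [Fintype ι] {a b : ℕ} (S T : BiTensor ι a b) :
    tdot S T = ∑ μ, ∑ ν, starRingEnd ℂ (S μ ν) * T μ ν := by
  rw [tdot, PiLp.inner_apply, Fintype.sum_prod_type]
  refine Finset.sum_congr rfl fun μ _ => Finset.sum_congr rfl fun ν _ => ?_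
  rw [RCLike.inner_apply, mul_comm]
  rfl

/-- The entries of `M` are real, so the adjoint of the pull-back is the pull-back by the transpose.
This gives both invariance under orthogonal maps and invariance of orthogonal complements. -/
theorem tdot_pull {ι : Type} [Fintype ι] {a b : ℕ} (M : Matrix ι ι ℝ) (S T : BiTensor ι a b) :
    tdot (pull M S) T = tdot S (pull Mᵀ T) := by
  have h : ∀ (M : Matrix ι ι ℝ) (T : BiTensor ι a b) μ ν, pull M T μ ν =
      ∑ α : Fin a → ι, ∑ β : Fin b → ι,
      ((∏ i, M (α i) (μ i) : ℝ) : ℂ) * ((∏ j, M (β j) (ν j) : ℝ) : ℂ) * T α β := fun _ _ _ _ => rfl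
  simp only [tdot_eq_sum, h, map_sum, map_mul, Complex.conj_ofReal, Finset.sum_mul,
    Finset.mul_sum, Matrix.transpose_apply]
  rw [sum_comm_pairs]
  refine Finset.sum_congr rfl fun α _ => Finset.sum_congr rfl fun β _ =>
    Finset.sum_congr rfl fun μ _ => Finset.sum_congr rfl fun ν _ => by ring

theorem tdot_pull_pull {n a b : ℕ} {M : Matrix (Fin n) (Fin n) ℝ}
    (hM : M ∈ Matrix.orthogonalGroup (Fin n) ℝ) (S T : BiTensor (Fin n) a b) :
    tdot (pull M S) (pull M T) = tdot S T := by
  rw [tdot_pull, ← pull_mul, (Matrix.mem_orthogonalGroup_iff _ _).1 hM, pull_one]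

/-- Riesz representation inside the finite-dimensional space `W`. -/
theorem exists_tdot_eq {ι : Type} [Fintype ι] {a b : ℕ} (W : Submodule ℂ (BiTensor ι a b))
    (l : BiTensor ι a b →ₗ[ℂ] ℂ) : ∃ x ∈ W, ∀ w ∈ W, tdot x w = l w := by
  let e := toHilbert ι a b
  let W' : Submodule ℂ (EuclideanSpace ℂ ((Fin a → ι) × (Fin b → ι))) :=
    W.map e.toLinearMap
  let l' : W' →L[ℂ] ℂ := LinearMap.toContinuousLinearMap
    ((l.comp e.symm.toLinearMap).comp W'.subtype)
  let x' : W' := (InnerProductSpace.toDual ℂ W').symm l'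
  obtain ⟨x, hx, hxx'⟩ := x'.2
  refine ⟨x, hx, fun w hw => ?_⟩
  let w' : W' := ⟨e w, w, hw, rfl⟩
  have h1 : inner ℂ x' w' = l' w' := InnerProductSpace.toDual_symm_apply
  have h2 : l' w' = l w := by
    change l (e.symm (e w)) = l w
    rw [LinearEquiv.symm_apply_apply]
  rw [← h2, ← h1, Submodule.coe_inner, ← hxx']
  rfl

theorem tdot_sub_left {ι : Type} [Fintype ι] {a b : ℕ} (S S' T : BiTensor ι a b) :
    tdot (S - S') T = tdot S T - tdot S' T := by
  simp only [tdot, map_sub, inner_sub_left]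

theorem tdot_smul_left {ι : Type} [Fintype ι] {a b : ℕ} (c : ℂ) (S T : BiTensor ι a b) :
    tdot (c • S) T = starRingEnd ℂ c * tdot S T := by
  simp only [tdot, map_smul, inner_smul_left]

theorem tdot_self_eq_zero {ι : Type} [Fintype ι] {a b : ℕ} {T : BiTensor ι a b} :
    tdot T T = 0 ↔ T = 0 := by
  rw [tdot, inner_self_eq_zero, map_eq_zero_iff _ (LinearEquiv.injective _)]

/-! ### Irreducibility of `[q+r,q]` -/

/-- `altSum` as a linear form. -/
def altSumₗ {ι : Type} {q r : ℕ} (a b : Fin q → ι) (f : Fin r → ι) :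
    BiTensor ι (q + r) q →ₗ[ℂ] ℂ where
  toFun := altSum a b f
  map_add' S T := by simp [altSum, mul_add, Finset.sum_add_distrib]
  map_smul' c T := by
    simp only [altSum, Pi.smul_apply, smul_eq_mul, RingHom.id_apply, Finset.mul_sum]
    exact Finset.sum_congr rfl fun S _ => by ring

theorem signedPerm_flip_transpose {ι : Type} [DecidableEq ι] (c : ι) :
    (signedPerm (flip c) 1)ᵀ = signedPerm (flip c) 1 := by
  ext i j
  simp only [signedPerm, Matrix.transpose_apply, Matrix.of_apply, Perm.coe_one, id_eq,
    Pi.single_apply]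
  by_cases h : i = j
  · subst h; rfl
  · simp [h, Ne.symm h]

theorem signedPerm_swap_transpose {ι : Type} [DecidableEq ι] (x y : ι) :
    (signedPerm (fun _ => 1) (Equiv.swap x y))ᵀ = signedPerm (fun _ => 1) (Equiv.swap x y) := by
  ext i j
  simp only [signedPerm, Matrix.transpose_apply, Matrix.of_apply, Pi.single_apply]
  congr 2
  rw [eq_iff_iff, ← Equiv.swap_apply_eq_iff, eq_comm]

/-- The vector represents `altSum` on `W`, which is not the zero form by `eq_zero_of_altSum`. The
sign changes and transpositions are symmetric matrices, hence self-adjoint on tensors, so the vector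
inherits the symmetries of the form. -/
theorem exists_parity_vector {n q r : ℕ} {a b : Fin q → Fin n} {f : Fin r → Fin n}
    (h₀ : Injective (Sum.elim (Sum.elim a b) f)) {W : Submodule ℂ (BiTensor (Fin n) (q + r) q)}
    (hV : W ≤ youngTraceless (1 : Matrix (Fin n) (Fin n) ℝ) (q + r) q)
    (hW : ∀ M ∈ Matrix.orthogonalGroup (Fin n) ℝ, ∀ T ∈ W, pull M T ∈ W) (hne : W ≠ ⊥) :
    ∃ x ∈ W, x ≠ 0 ∧
      (∀ c, pull (signedPerm (flip c) 1) x = ((∏ i, flip c (f i) : ℝ) : ℂ) • x) ∧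
      ∀ j, pull (signedPerm (fun _ => 1) (Equiv.swap (a j) (b j))) x = -x := by
  obtain ⟨x, hxW, hx⟩ := exists_tdot_eq W (altSumₗ a b f)
  have hx' : ∀ w ∈ W, tdot x w = altSum a b f w := hx
  have ext : ∀ y ∈ W, ∀ z ∈ W, (∀ w ∈ W, tdot y w = tdot z w) → y = z := by
    intro y hy z hz h
    rw [← sub_eq_zero, ← tdot_self_eq_zero, tdot_sub_left, h _ (W.sub_mem hy hz), sub_self]
  refine ⟨x, hxW, ?_, fun c => ?_, fun j => ?_⟩
  · rintro rfl
    refine hne ((Submodule.eq_bot_iff W).2 fun T hT => ?_)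
    refine eq_zero_of_altSum (W := W) (fun T hT => hV hT) hW h₀ (fun T hT => ?_) hT
    rw [← hx' T hT, tdot, map_zero, inner_zero_left]
  · have hM := signedPerm_mem (flip_mul_self c) 1
    refine ext _ (hW _ hM x hxW) _ (W.smul_mem _ hxW) fun w hw => ?_
    rw [tdot_pull, signedPerm_flip_transpose, hx' _ (hW _ hM w hw), altSum_flip, tdot_smul_left,
      Complex.conj_ofReal, hx' w hw]
  · have hM := signedPerm_mem (n := n) (s := fun _ => 1) (by simp) (Equiv.swap (a j) (b j))
    refine ext _ (hW _ hM x hxW) _ (W.neg_mem hxW) fun w hw => ?_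
    rw [tdot_pull, signedPerm_swap_transpose, hx' _ (hW _ hM w hw), altSum_swap h₀,
      ← neg_one_smul ℂ x, tdot_smul_left, hx' w hw]
    simp

/-- The space of vectors with the prescribed parities is at most a line, so it cannot meet two
orthogonal invariant subspaces nontrivially. -/
theorem eq_bot_or_eq_youngTraceless {n q r : ℕ} {a b : Fin q → Fin n} {f : Fin r → Fin n}
    (h₀ : Injective (Sum.elim (Sum.elim a b) f)) {W : Submodule ℂ (BiTensor (Fin n) (q + r) q)}
    (hV : W ≤ youngTraceless (1 : Matrix (Fin n) (Fin n) ℝ) (q + r) q)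
    (hW : ∀ M ∈ Matrix.orthogonalGroup (Fin n) ℝ, ∀ T ∈ W, pull M T ∈ W) :
    W = ⊥ ∨ W = youngTraceless (1 : Matrix (Fin n) (Fin n) ℝ) (q + r) q := by
  by_contra hcon
  push Not at hcon
  obtain ⟨hbot, htop⟩ := hcon
  set V := youngTraceless (1 : Matrix (Fin n) (Fin n) ℝ) (q + r) q
  -- The orthogonal complement of `W` within `V`.
  let W₂ : Submodule ℂ (BiTensor (Fin n) (q + r) q) :=
    { carrier := {T | T ∈ V ∧ ∀ w ∈ W, tdot T w = 0}
      zero_mem' := ⟨V.zero_mem, fun w _ => by rw [tdot, map_zero, inner_zero_left]⟩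
      add_mem' := fun hS hT => ⟨V.add_mem hS.1 hT.1, fun w hw => by
        have h1 := hS.2 w hw
        have h2 := hT.2 w hw
        rw [tdot] at *
        rw [map_add, inner_add_left, h1, h2, add_zero]⟩
      smul_mem' := fun c T hT => ⟨V.smul_mem c hT.1, fun w hw => by
        rw [tdot_smul_left, hT.2 w hw, mul_zero]⟩ }
  have hpV : ∀ M ∈ Matrix.orthogonalGroup (Fin n) ℝ, ∀ T ∈ V, pull M T ∈ V := fun M hM T hT =>
    pull_mem_youngTraceless (by rw [mul_one, (Matrix.mem_orthogonalGroup_iff _ _).1 hM]) hT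
  have hT' : ∀ M ∈ Matrix.orthogonalGroup (Fin n) ℝ, Mᵀ ∈ Matrix.orthogonalGroup (Fin n) ℝ := by
    intro M hM
    rw [Matrix.mem_orthogonalGroup_iff, Matrix.transpose_transpose]
    exact (Matrix.mem_orthogonalGroup_iff' _ _).1 hM
  have hW₂ : ∀ M ∈ Matrix.orthogonalGroup (Fin n) ℝ, ∀ T ∈ W₂, pull M T ∈ W₂ := fun M hM T hT =>
    ⟨hpV M hM T hT.1, fun w hw => by rw [tdot_pull, hT.2 _ (hW _ (hT' M hM) w hw)]⟩
  have hbot₂ : W₂ ≠ ⊥ := by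
    obtain ⟨T, hTV, hTW⟩ : ∃ T ∈ V, T ∉ W := by
      by_contra h
      push Not at h
      exact htop (le_antisymm hV h)
    let l : BiTensor (Fin n) (q + r) q →ₗ[ℂ] ℂ :=
      (innerSL ℂ (toHilbert _ _ _ T)).toLinearMap.comp (toHilbert (Fin n) (q + r) q).toLinearMap
    obtain ⟨x, hxW, hx⟩ := exists_tdot_eq W l
    intro h
    have h1 : T - x ∈ W₂ := ⟨V.sub_mem hTV (hV hxW), fun w hw => by
      rw [tdot_sub_left, hx w hw]
      exact sub_self _⟩
    rw [h, Submodule.mem_bot, sub_eq_zero] at h1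
    exact hTW (h1 ▸ hxW)
  obtain ⟨x, hxW, hx0, hxf, hxs⟩ := exists_parity_vector h₀ hV hW hbot
  obtain ⟨y, hyW, hy0, hyf, hys⟩ := exists_parity_vector h₀
    (show W₂ ≤ V from fun T hT => hT.1) hW₂ hbot₂
  -- The coefficients are chosen so that the component `T_{a f|a}` of the combination vanishes.
  have hxy : y (Fin.append a f) a • x - x (Fin.append a f) a • y = 0 := by
    refine eq_zero_of_parity h₀ (mem_youngTraceless_iff.1 (V.sub_mem (V.smul_mem _ (hV hxW))
      (V.smul_mem _ hyW.1))).1 (fun c => ?_) (fun j => ?_) ?_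
    · rw [map_sub, map_smul, map_smul, hxf, hyf, smul_sub, smul_comm, smul_comm _ _ y]
    · rw [map_sub, map_smul, map_smul, hxs, hys]
      module
    · simp [mul_comm]
  have hxc : x (Fin.append a f) a ≠ 0 := fun h =>
    hx0 (eq_zero_of_parity h₀ (mem_youngTraceless_iff.1 (hV hxW)).1 hxf hxs h)
  have hyc : y (Fin.append a f) a ≠ 0 := fun h =>
    hy0 (eq_zero_of_parity h₀ (mem_youngTraceless_iff.1 hyW.1).1 hyf hys h)
  have h1 : tdot (y (Fin.append a f) a • x) x = 0 := by
    rw [sub_eq_zero.1 hxy, tdot_smul_left, hyW.2 x hxW, mul_zero]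
  rw [tdot_smul_left, mul_eq_zero, map_eq_zero, tdot_self_eq_zero] at h1
  exact h1.elim hyc hx0

/-- The vectors `e_{a_j} + i e_{b_j}` are null and mutually orthogonal for the complex bilinear
extension of the metric, and the `e_{f_i}` are orthogonal to them. The index families `μ`, `ν`
select a component on which both determinants are `1`. -/
theorem exists_null_vectors {n q r : ℕ} {a b : Fin q → Fin n} {f : Fin r → Fin n}
    (h₀ : Injective (Sum.elim (Sum.elim a b) f)) :
    ∃ (u : Fin (q + r) → Fin n → ℂ) (z : Fin q → Fin n → ℂ) (μ : Fin (q + r) → Fin n)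
      (ν : Fin q → Fin n), (∀ j, ∃ s, z j = u s) ∧ (∀ s t, u s ⬝ᵥ z t = 0) ∧
      (∀ s t, u s (μ t) = if s = t then 1 else 0) ∧ ∀ s t, z s (ν t) = if s = t then 1 else 0 := by
  have haf : ∀ i l, f i ≠ a l := fun i l h => by
    simpa using h₀ (a₁ := Sum.inr i) (a₂ := Sum.inl (Sum.inl l)) h
  have hbf : ∀ i l, f i ≠ b l := fun i l h => by
    simpa using h₀ (a₁ := Sum.inr i) (a₂ := Sum.inl (Sum.inr l)) h
  have hab : ∀ i l, a i ≠ b l := fun i l h => by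
    simpa using h₀ (a₁ := Sum.inl (Sum.inl i)) (a₂ := Sum.inl (Sum.inr l)) h
  have ha : ∀ i l, a i = a l ↔ i = l := fun i l => ⟨fun h => by
    simpa using h₀ (a₁ := Sum.inl (Sum.inl i)) (a₂ := Sum.inl (Sum.inl l)) h, congrArg a⟩
  have hb : ∀ i l, b i = b l ↔ i = l := fun i l => ⟨fun h => by
    simpa using h₀ (a₁ := Sum.inl (Sum.inr i)) (a₂ := Sum.inl (Sum.inr l)) h, congrArg b⟩
  have hf : ∀ i l, f i = f l ↔ i = l := fun i l => ⟨fun h => by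
    simpa using h₀ (a₁ := Sum.inr i) (a₂ := Sum.inr l) h, congrArg f⟩
  let z : Fin q → Fin n → ℂ := fun j => Pi.single (a j) 1 + Complex.I • Pi.single (b j) 1
  let u : Fin (q + r) → Fin n → ℂ := Fin.append z fun i => Pi.single (f i) 1
  have hz : ∀ j l, z j (a l) = if j = l then 1 else 0 := by
    intro j l
    have h1 : (Pi.single (a j) 1 : Fin n → ℂ) (a l) = if j = l then 1 else 0 := by
      simp [Pi.single_apply, ha, eq_comm]
    simp [z, h1, hab]
  refine ⟨u, z, Fin.append a f, a, fun j => ⟨Fin.castAdd r j, by simp [u]⟩, fun s t => ?_,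
    fun r s => ?_, hz⟩
  · have hdot : ∀ x : Fin n → ℂ, ∀ t, x ⬝ᵥ z t = x (a t) + Complex.I * x (b t) := by
      intro x t
      simp [z, dotProduct_add]
    have hzb : ∀ j l, z j (b l) = if j = l then Complex.I else 0 := by
      intro j l
      have h1 : (Pi.single (b j) 1 : Fin n → ℂ) (b l) = if j = l then 1 else 0 := by
        simp [Pi.single_apply, hb, eq_comm]
      simp [z, h1, (hab _ _).symm]
    refine Fin.addCases (fun s => ?_) (fun s => ?_) s
    · rw [hdot, show u (Fin.castAdd r s) = z s by simp [u], hz, hzb]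
      by_cases h : s = t <;> simp [h]
    · rw [hdot, show u (Fin.natAdd q s) = Pi.single (f s) 1 by simp [u],
        Pi.single_eq_of_ne (haf s t).symm, Pi.single_eq_of_ne (hbf s t).symm, mul_zero, add_zero]
  · refine Fin.addCases (fun r => ?_) (fun r => ?_) r <;>
      refine Fin.addCases (fun s => ?_) (fun s => ?_) s
    · simp [u, hz]
    · have : Fin.castAdd _ r ≠ Fin.natAdd q s := by simp [Fin.ext_iff]; omega
      simp [u, z, haf, hbf, this]
    · have : Fin.natAdd q r ≠ Fin.castAdd _ s := by simp [Fin.ext_iff]; omega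
      simp [u, this, fun i l => (haf i l).symm]
    · simp [u, Pi.single_apply, hf, eq_comm]

theorem youngTraceless_ne_bot {n q r : ℕ} {a b : Fin q → Fin n} {f : Fin r → Fin n}
    (h₀ : Injective (Sum.elim (Sum.elim a b) f)) :
    youngTraceless (1 : Matrix (Fin n) (Fin n) ℝ) (q + r) q ≠ ⊥ := by
  obtain ⟨u, z, μ, ν, huz, hdot, hμ, hν⟩ := exists_null_vectors h₀
  intro hbot
  have hmem : detTensor u z ∈ youngTraceless (1 : Matrix (Fin n) (Fin n) ℝ) (q + r) q := by
    refine detTensor_mem huz fun s t => ?_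
    rw [← hdot s t]
    simp [Matrix.one_apply, apply_ite Complex.ofReal, ite_mul, dotProduct]
  rw [hbot, Submodule.mem_bot] at hmem
  have hdet : detTensor u z μ ν = 1 := by
    rw [detTensor, colDet_eq_one hμ, colDet_eq_one hν, mul_one]
  rw [hmem] at hdet
  simp at hdet

/-- With `p = q + r`, the bound `p + q ≤ n` is precisely the room needed for the `2q + r` distinct
indices. -/
theorem exists_indices {n q r : ℕ} (h : q + r + q ≤ n) :
    ∃ (a b : Fin q → Fin n) (f : Fin r → Fin n), Injective (Sum.elim (Sum.elim a b) f) := by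
  refine ⟨fun j => ⟨j, by omega⟩, fun j => ⟨q + j, by omega⟩, fun j => ⟨q + q + j, by omega⟩, ?_⟩
  rintro ((i | i) | i) ((j | j) | j) hij <;> simp [Fin.ext_iff] at hij ⊢ <;> omega

/-! ### Transfer of irreducibility and unitarity -/

theorem isIrreducible_of_forall {G V : Type} [Group G] [AddCommGroup V] [Module ℂ V]
    (ρ : Representation ℂ G V) [Nontrivial V]
    (h : ∀ W : Submodule ℂ V, (∀ g, ∀ v ∈ W, ρ g v ∈ W) → W = ⊥ ∨ W = ⊤) : ρ.IsIrreducible where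
  exists_pair_ne := ⟨⊥, ⊤, fun h => bot_ne_top (α := Submodule ℂ V)
    (congrArg Subrepresentation.toSubmodule h)⟩
  eq_bot_or_eq_top s := (h s.toSubmodule fun g _ hv => s.apply_mem_toSubmodule g hv).imp
    (fun hs => Subrepresentation.ext hs) fun hs => Subrepresentation.ext hs

theorem eq_bot_or_eq_top_of_isIrreducible {G V : Type} [Group G] [AddCommGroup V] [Module ℂ V]
    {ρ : Representation ℂ G V} (hρ : ρ.IsIrreducible) (W : Submodule ℂ V)
    (hW : ∀ g, ∀ v ∈ W, ρ g v ∈ W) : W = ⊥ ∨ W = ⊤ :=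
  (hρ.eq_bot_or_eq_top ⟨W, fun g v hv => hW g v hv⟩).imp
    (fun h => congrArg Subrepresentation.toSubmodule h)
    fun h => congrArg Subrepresentation.toSubmodule h

theorem nontrivial_of_isIrreducible {G V : Type} [Group G] [AddCommGroup V] [Module ℂ V]
    {ρ : Representation ℂ G V} (hρ : ρ.IsIrreducible) : Nontrivial V := by
  by_contra h
  rw [not_nontrivial_iff_subsingleton] at h
  obtain ⟨s, t, hst⟩ := hρ.exists_pair_ne
  exact hst (Subrepresentation.ext (Subsingleton.elim _ _))

/-- Surjectivity of `r` makes the image of an invariant subspace invariant under the whole of `G'`.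
-/
theorem isIrreducible_of_equiv {G G' V V' : Type} [Group G] [Group G'] [AddCommGroup V]
    [Module ℂ V] [AddCommGroup V'] [Module ℂ V'] {ρ : Representation ℂ G V}
    {ρ' : Representation ℂ G' V'} (L : V ≃ₗ[ℂ] V') (r : G →* G') (hr : Surjective r)
    (hL : ∀ g v, L (ρ g v) = ρ' (r g) (L v)) (hρ' : ρ'.IsIrreducible) : ρ.IsIrreducible := by
  have := nontrivial_of_isIrreducible hρ'
  have : Nontrivial V := L.toEquiv.nontrivial
  refine isIrreducible_of_forall ρ fun W hW => ?_
  have h := eq_bot_or_eq_top_of_isIrreducible hρ' (W.map L.toLinearMap) fun g v hv => by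
    obtain ⟨w, hw, rfl⟩ := hv
    obtain ⟨g, rfl⟩ := hr g
    exact ⟨ρ g w, hW g w hw, hL g w⟩
  refine h.imp (fun h => ?_) fun h => ?_
  · exact Submodule.map_injective_of_injective L.injective (h.trans (Submodule.map_bot _).symm)
  · exact Submodule.map_injective_of_injective L.injective (h.trans (by simp))

theorem isUnitary_of_equiv {G G' V V' : Type} [Group G] [Group G'] [TopologicalSpace G]
    [TopologicalSpace G'] [AddCommGroup V]
    [Module ℂ V] [AddCommGroup V'] [Module ℂ V'] {ρ : Representation ℂ G V}
    {ρ' : Representation ℂ G' V'} (L : V ≃ₗ[ℂ] V') (r : G →* G') (hr : Continuous r)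
    (hL : ∀ g v, L (ρ g v) = ρ' (r g) (L v)) (hρ' : IsUnitary ρ') : IsUnitary ρ := by
  obtain ⟨c, hc, hcont⟩ := hρ'
  refine ⟨{ inner := fun x y => c.inner (L x) (L y)
            conj_inner_symm := fun x y => c.conj_inner_symm _ _
            re_inner_nonneg := fun x => c.re_inner_nonneg _
            add_left := fun x y z => by rw [map_add]; exact c.add_left _ _ _
            smul_left := fun x y a => by rw [map_smul]; exact c.smul_left _ _ _
            definite := fun x hx => L.map_eq_zero_iff.1 (c.definite _ hx) }, ?_, ?_⟩
  · intro g u v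
    change c.inner (L (ρ g u)) (L (ρ g v)) = c.inner (L u) (L v)
    rw [hL, hL, hc]
  · intro u v
    change Continuous fun g => c.inner (L u) (L (ρ g v))
    simp only [hL]
    exact (hcont (L u) (L v)).comp hr

/-! ### The module `[p,q]` of `O(n)` -/

/-- The representation of `O(n)` on the traceless tensors of type `[p,q]`. -/
def youngRep (n p q : ℕ) : Subrepresentation (orthogonalRep n p q) where
  toSubmodule := youngTraceless (1 : Matrix (Fin n) (Fin n) ℝ) p q
  apply_mem_toSubmodule g T hT := by
    refine pull_mem_youngTraceless ?_ hT
    rw [mul_one]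
    exact (Matrix.mem_orthogonalGroup_iff _ _).1 (g⁻¹).2

/-- The standard inner product is restricted. Matrix coefficients are polynomials in the entries of
`g⁻¹`, and these are entries of `g` because the inverse is the transpose. -/
theorem youngRep_isUnitary (n p q : ℕ) : IsUnitary (youngRep n p q).toRepresentation := by
  refine ⟨coreOfInjective ((toHilbert (Fin n) p q).toLinearMap.comp
    (youngRep n p q).toSubmodule.subtype)
    ((toHilbert (Fin n) p q).injective.comp Subtype.val_injective), fun g u v => ?_, fun u v => ?_⟩
  · exact tdot_pull_pull (g⁻¹).2 u.1 v.1
  · change Continuous fun g : Matrix.orthogonalGroup (Fin n) ℝ => tdot u.1 (pull (g⁻¹).1 v.1)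
    have hentry : ∀ i j, Continuous fun g : Matrix.orthogonalGroup (Fin n) ℝ => (g⁻¹).1 i j := by
      intro i j
      have : (fun g : Matrix.orthogonalGroup (Fin n) ℝ => (g⁻¹).1 i j) = fun g => g.1 j i := by
        funext g
        exact star_trivial (g.1 j i)
      rw [this]
      exact (continuous_apply i).comp ((continuous_apply j).comp continuous_subtype_val)
    simp only [tdot_eq_sum]
    refine continuous_finsetSum _ fun μ _ => continuous_finsetSum _ fun ν _ =>
      continuous_const.mul ?_
    refine continuous_finsetSum _ fun α _ => continuous_finsetSum _ fun β _ =>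
      Continuous.mul (Continuous.mul ?_ ?_) continuous_const
    · exact Complex.continuous_ofReal.comp (continuous_finsetProd _ fun i _ => hentry _ _)
    · exact Complex.continuous_ofReal.comp (continuous_finsetProd _ fun i _ => hentry _ _)

theorem youngRep_isIrreducible {n p q : ℕ} (hqp : q ≤ p) (hn : p + q ≤ n) :
    (youngRep n p q).toRepresentation.IsIrreducible := by
  obtain ⟨r, rfl⟩ := Nat.exists_eq_add_of_le hqp
  obtain ⟨a, b, f, h₀⟩ := exists_indices hn
  have : Nontrivial (youngRep n (q + r) q).toSubmodule :=
    (Submodule.nontrivial_iff_ne_bot).2 (youngTraceless_ne_bot h₀)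
  refine isIrreducible_of_forall _ fun W hW => ?_
  have h := eq_bot_or_eq_youngTraceless h₀
    (W := W.map (youngRep n (q + r) q).toSubmodule.subtype) (Submodule.map_subtype_le _ _) ?_
  · refine h.imp (fun h => ?_) fun h => ?_
    · exact Submodule.map_injective_of_injective (f := (youngRep n (q + r) q).toSubmodule.subtype)
        Subtype.val_injective (h.trans (Submodule.map_bot _).symm)
    · refine Submodule.map_injective_of_injective (f := (youngRep n (q + r) q).toSubmodule.subtype)
        Subtype.val_injective (h.trans ?_)
      rw [Submodule.map_top, Submodule.range_subtype]
      rfl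
  · rintro M hM _ ⟨T, hT, rfl⟩
    -- The representation pulls back by `g⁻¹`, so the pull-back by `M` is the action of `M⁻¹`.
    refine ⟨_, hW (⟨M, hM⟩ : Matrix.orthogonalGroup (Fin n) ℝ)⁻¹ T hT, ?_⟩
    change pull (((⟨M, hM⟩ : Matrix.orthogonalGroup (Fin n) ℝ)⁻¹)⁻¹).1 T.1 = pull M T.1
    rw [inv_inv]

/-! ### The Minkowski product -/

theorem mdot_eq_sum {n : ℕ} (x y : Spacetime n) :
    mdot x y = ∑ μ, (if μ = 0 then -1 else 1) * (x μ * y μ) := by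
  simp only [mdot, eta, dotProduct, Matrix.mulVec_diagonal]
  exact Finset.sum_congr rfl fun μ _ => by ring

theorem mdot_comm {n : ℕ} (x y : Spacetime n) : mdot x y = mdot y x := by
  simp only [mdot_eq_sum, mul_comm (x _)]

theorem mdot_add {n : ℕ} (x y z : Spacetime n) : mdot x (y + z) = mdot x y + mdot x z := by
  simp only [mdot, Matrix.mulVec_add, dotProduct_add]

theorem mdot_smul {n : ℕ} (x y : Spacetime n) (c : ℝ) : mdot x (c • y) = c * mdot x y := by
  simp only [mdot, Matrix.mulVec_smul, dotProduct_smul, smul_eq_mul]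

theorem add_mdot {n : ℕ} (x y z : Spacetime n) : mdot (x + y) z = mdot x z + mdot y z := by
  simp only [mdot, add_dotProduct]

theorem smul_mdot {n : ℕ} (x y : Spacetime n) (c : ℝ) : mdot (c • x) y = c * mdot x y := by
  simp only [mdot, smul_dotProduct, smul_eq_mul]

/-- The Minkowski product as a continuous bilinear map. -/
def mdotL (n : ℕ) : Spacetime n →L[ℝ] Spacetime n →L[ℝ] ℝ :=
  (LinearMap.mk₂ ℝ mdot add_mdot (fun c x y => smul_mdot x y c) mdot_add
    fun c x y => mdot_smul x y c).toContinuousBilinearMap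

/-- The covariant components `k_μ` of a vector. -/
def low {n : ℕ} (k : Spacetime n) (μ : Fin (n + 2)) : ℝ := mdot k (Pi.single μ 1)

theorem low_eq {n : ℕ} (k : Spacetime n) (μ : Fin (n + 2)) :
    low k μ = (if μ = 0 then -1 else 1) * k μ := by
  rw [low, mdot_eq_sum, Finset.sum_eq_single μ]
  · simp
  · intro ν _ hν
    simp [hν]
  · simp

theorem sum_low_mul {n : ℕ} (k x : Spacetime n) : ∑ μ, low k μ * x μ = mdot k x := by
  simp only [low_eq, mdot_eq_sum, mul_assoc]

theorem sum_eta_low_mul {n : ℕ} (k : Spacetime n) (f : Fin (n + 2) → ℂ) :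
    ∑ α, ∑ β, (eta n α β : ℂ) * ((low k α : ℂ) * f β) = ∑ β, (k β : ℂ) * f β := by
  rw [Finset.sum_comm]
  refine Finset.sum_congr rfl fun β _ => ?_
  rw [Finset.sum_eq_single β]
  · rw [low_eq, eta, Matrix.diagonal_apply_eq]
    split_ifs <;> simp
  · intro α _ h
    rw [eta, Matrix.diagonal_apply_ne _ h]
    simp
  · simp

/-! ### Integrals of phases -/

theorem phase_add {n : ℕ} (k x y : Spacetime n) : phase k (x + y) = phase k x * phase k y := by
  simp only [phase, mdot_add, Complex.ofReal_add, mul_add, Complex.exp_add]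

theorem phase_zero {n : ℕ} (k : Spacetime n) : phase k 0 = 1 := by
  simp [phase, mdot]

theorem phase_neg {n : ℕ} (k x : Spacetime n) : phase k (-x) = starRingEnd ℂ (phase k x) := by
  rw [phase, phase, ← Complex.exp_conj, map_mul, Complex.conj_I, Complex.conj_ofReal,
    ← neg_one_smul ℝ x, mdot_smul]
  congr 1
  push_cast
  ring

theorem continuous_mdot {n : ℕ} : Continuous fun z : Spacetime n × Spacetime n => mdot z.1 z.2 :=
  (mdotL n).continuous₂

theorem continuous_phase {n : ℕ} :
    Continuous fun z : Spacetime n × Spacetime n => phase z.1 z.2 :=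
  Complex.continuous_exp.comp (continuous_const.mul
    (Complex.continuous_ofReal.comp continuous_mdot))

theorem norm_phase {n : ℕ} (k x : Spacetime n) : ‖phase k x‖ = 1 := by
  rw [phase, mul_comm, Complex.norm_exp_ofReal_mul_I]

/-- The bilinear map for which the Fourier integral has the kernel `phase`. -/
def phaseL (n : ℕ) : Spacetime n →L[ℝ] Spacetime n →L[ℝ] ℝ := (-(2 * Real.pi)⁻¹) • mdotL n

theorem fourierChar_phaseL {n : ℕ} (k x : Spacetime n) :
    (Real.fourierChar (-(phaseL n k x)) : ℂ) = phase k x := by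
  rw [Real.fourierChar_apply, phase]
  congr 1
  have h : -(phaseL n k x) = (2 * Real.pi)⁻¹ * mdot k x := by
    change -((-(2 * Real.pi)⁻¹) * mdot k x) = _
    ring
  rw [h, mul_inv_cancel_left₀ (by positivity), mul_comm]

/-- Superpositions are Fourier integrals for the rescaled Minkowski pairing, so the general results
on their differentiability apply to any measure `m`. -/
theorem integral_phase_eq {n : ℕ} (m : MeasureTheory.Measure (Spacetime n))
    (c : Spacetime n → ℂ) :
    (fun x => ∫ k, phase k x * c k ∂m) =
      VectorFourier.fourierIntegral Real.fourierChar m (phaseL n).toLinearMap₁₂ c := by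
  funext x
  simp only [VectorFourier.fourierIntegral, ContinuousLinearMap.toLinearMap₁₂_apply_apply_apply,
    Circle.smul_def, fourierChar_phaseL, smul_eq_mul]

section

variable {n : ℕ} {m : MeasureTheory.Measure (Spacetime n)} {c : Spacetime n → ℂ}

/-- The factor `g / (1 + ‖k‖²)` is bounded by `C`. The quadratic weight is what two derivatives of
the phase require. -/
theorem integrable_pow_mul
    (hc : MeasureTheory.Integrable (fun k => ((1 + ‖k‖ ^ 2 : ℝ) : ℂ) * c k) m) {g : Spacetime n → ℂ}
    (hg : Continuous g) {C : ℝ} (hgC : ∀ k, ‖g k‖ ≤ C * (1 + ‖k‖ ^ 2)) :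
    MeasureTheory.Integrable (fun k => g k * c k) m := by
  have hpos : ∀ k : Spacetime n, (0 : ℝ) < 1 + ‖k‖ ^ 2 := fun k => by positivity
  have h : (fun k => g k * c k) =
      fun k => (g k * ((1 + ‖k‖ ^ 2 : ℝ) : ℂ)⁻¹) * (((1 + ‖k‖ ^ 2 : ℝ) : ℂ) * c k) := by
    funext k
    have : ((1 + ‖k‖ ^ 2 : ℝ) : ℂ) ≠ 0 := Complex.ofReal_ne_zero.2 (hpos k).ne'
    field_simp
  rw [h]
  refine hc.bdd_mul (c := C) ?_ (Filter.Eventually.of_forall fun k => ?_)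
  · refine (hg.mul (Continuous.inv₀ (by fun_prop) fun k => ?_)).aestronglyMeasurable
    exact Complex.ofReal_ne_zero.2 (hpos k).ne'
  · rw [norm_mul, norm_inv, Complex.norm_real, Real.norm_of_nonneg (hpos k).le,
      ← div_eq_mul_inv, div_le_iff₀ (hpos k)]
    exact hgC k

theorem integrable_of_weighted
    (hc : MeasureTheory.Integrable (fun k => ((1 + ‖k‖ ^ 2 : ℝ) : ℂ) * c k) m) :
    MeasureTheory.Integrable c m := by
  simpa using integrable_pow_mul hc (g := fun _ => 1) continuous_const (C := 1)
    fun k => by simp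

theorem integrable_norm_pow_mul
    (hc : MeasureTheory.Integrable (fun k => ((1 + ‖k‖ ^ 2 : ℝ) : ℂ) * c k) m) {N : ℕ}
    (hN : N ≤ 2) : MeasureTheory.Integrable (fun k => ‖k‖ ^ N * ‖c k‖) m := by
  have h := (integrable_pow_mul hc (g := fun k => ((‖k‖ ^ N : ℝ) : ℂ)) (by fun_prop) (C := 1)
    fun k => ?_).norm
  · simpa using h
  · rw [Complex.norm_real, Real.norm_of_nonneg (by positivity)]
    have := norm_nonneg k
    interval_cases N <;> nlinarith [sq_nonneg (‖k‖ - 1)]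

theorem integrable_low_mul
    (hc : MeasureTheory.Integrable (fun k => ((1 + ‖k‖ ^ 2 : ℝ) : ℂ) * c k) m)
    (μ : Fin (n + 2)) : MeasureTheory.Integrable (fun k => (low k μ : ℂ) * c k) m := by
  refine integrable_pow_mul hc (C := 1) ?_ fun k => ?_
  · simp only [low_eq]
    fun_prop
  · rw [Complex.norm_real, low_eq, norm_mul]
    have h1 : ‖(if μ = 0 then -1 else 1 : ℝ)‖ = 1 := by split_ifs <;> simp
    have h2 : ‖k μ‖ ≤ ‖k‖ := norm_le_pi_norm k μ
    rw [h1]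
    nlinarith [sq_nonneg (‖k‖ - 1)]

theorem contDiff_integral_phase
    (hc : MeasureTheory.Integrable (fun k => ((1 + ‖k‖ ^ 2 : ℝ) : ℂ) * c k) m) :
    ContDiff ℝ 2 fun x => ∫ k, phase k x * c k ∂m := by
  rw [integral_phase_eq]
  exact VectorFourier.contDiff_fourierIntegral (N := 2) _ fun N hN =>
    integrable_norm_pow_mul hc (by exact_mod_cast hN)

theorem pderiv_integral_phase
    (hc : MeasureTheory.Integrable (fun k => ((1 + ‖k‖ ^ 2 : ℝ) : ℂ) * c k) m)
    (μ : Fin (n + 2)) (x : Spacetime n) :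
    pderiv μ (fun x => ∫ k, phase k x * c k ∂m) x =
      ∫ k, phase k x * (Complex.I * ((low k μ : ℂ) * c k)) ∂m := by
  have h1 := integrable_of_weighted hc
  have h2 : MeasureTheory.Integrable (fun k => ‖k‖ * ‖c k‖) m := by
    simpa using integrable_norm_pow_mul hc (N := 1) (by norm_num)
  have h3 : MeasureTheory.Integrable (VectorFourier.fourierSMulRight (phaseL n) c) m := by
    refine (h2.const_mul (2 * Real.pi * ‖phaseL n‖)).mono' h1.1.fourierSMulRight
      (Filter.Eventually.of_forall fun k => ?_)
    refine (VectorFourier.norm_fourierSMulRight_le _ _ _).trans (le_of_eq (by ring))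
  rw [pderiv, integral_phase_eq, (VectorFourier.hasFDerivAt_fourierIntegral _ h1 h2 x).fderiv,
    Real.fourierIntegral_continuousLinearMap_apply' h3]
  simp only [VectorFourier.fourierIntegral, ContinuousLinearMap.toLinearMap₁₂_apply_apply_apply,
    Circle.smul_def, fourierChar_phaseL, smul_eq_mul, VectorFourier.fourierSMulRight_apply]
  refine MeasureTheory.integral_congr_ae (Filter.Eventually.of_forall fun k => ?_)
  have h : phaseL n k (Pi.single μ 1) = -(2 * Real.pi)⁻¹ * low k μ := rfl
  simp only [h, Complex.real_smul]
  have hpi : (Real.pi : ℂ) ≠ 0 := Complex.ofReal_ne_zero.2 Real.pi_ne_zero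
  push_cast
  field_simp

theorem integrable_phase_mul (hc : MeasureTheory.Integrable c m) (x : Spacetime n) :
    MeasureTheory.Integrable (fun k => phase k x * c k) m := by
  refine hc.bdd_mul (c := 1) ?_ (Filter.Eventually.of_forall fun k => (norm_phase k x).le)
  exact (continuous_phase.comp (continuous_id.prodMk continuous_const)).aestronglyMeasurable

/-- The positive and negative parts of `c` are densities of two finite measures with the same
characteristic function. Finite measures are determined by it, so the two parts agree almost
everywhere; since one of them is always zero, both are. -/
theorem ae_eq_zero_of_integral_phase_ofReal {c : Spacetime n → ℝ}
    (hc : MeasureTheory.Integrable c m)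
    (h : ∀ x, ∫ k, phase k x * (c k : ℂ) ∂m = 0) : c =ᵐ[m] 0 := by
  have hmeas : ∀ c : Spacetime n → ℝ, MeasureTheory.Integrable c m →
      AEMeasurable (fun k => (c k).toNNReal) m := fun c hc => hc.1.aemeasurable.real_toNNReal
  have hfin : ∀ c : Spacetime n → ℝ, MeasureTheory.Integrable c m →
      ∫⁻ k, ((c k).toNNReal : ENNReal) ∂m ≠ ⊤ := fun c hc => by
    refine ne_top_of_le_ne_top hc.2.ne (MeasureTheory.lintegral_mono fun k => ?_)
    exact ENNReal.coe_le_coe.2 (by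
      rw [← NNReal.coe_le_coe, Real.coe_toNNReal', coe_nnnorm, Real.norm_eq_abs]
      exact max_le (le_abs_self _) (abs_nonneg _))
  have : MeasureTheory.IsFiniteMeasure (m.withDensity fun k => ((c k).toNNReal : ENNReal)) :=
    MeasureTheory.isFiniteMeasure_withDensity (hfin c hc)
  have : MeasureTheory.IsFiniteMeasure (m.withDensity fun k => (((-c) k).toNNReal : ENNReal)) :=
    MeasureTheory.isFiniteMeasure_withDensity (hfin _ hc.neg)
  have heq : (m.withDensity fun k => ((c k).toNNReal : ENNReal)) =
      m.withDensity fun k => (((-c) k).toNNReal : ENNReal) := by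
    refine MeasureTheory.ext_of_integral_char_eq Real.continuous_probChar Real.probChar_ne_one
      (L := (mdotL n).toLinearMap₁₂) (fun v hv h0 => hv ?_) (mdotL n).continuous₂ fun x => ?_
    · funext μ
      have h1 : low v μ = 0 := LinearMap.congr_fun h0 (Pi.single μ 1)
      rw [low_eq] at h1
      split_ifs at h1 <;> simpa using h1
    · have hp : ∀ k, Complex.exp ((mdot k x : ℂ) * Complex.I) = phase k x := fun k => by
        rw [phase, mul_comm]
      change ∫ k, Complex.exp ((mdot k x : ℂ) * Complex.I) ∂_ =
        ∫ k, Complex.exp ((mdot k x : ℂ) * Complex.I) ∂_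
      simp only [hp]
      rw [integral_withDensity_eq_integral_smul₀ (hmeas c hc),
        integral_withDensity_eq_integral_smul₀ (hmeas _ hc.neg), ← sub_eq_zero,
        ← MeasureTheory.integral_sub, ← h x]
      · refine MeasureTheory.integral_congr_ae (Filter.Eventually.of_forall fun k => ?_)
        have hk : c k = ((c k).toNNReal : ℝ) - ((-c k).toNNReal : ℝ) := by
          rw [Real.coe_toNNReal', Real.coe_toNNReal', max_zero_sub_max_neg_zero_eq_self]
        simp only [NNReal.smul_def, Complex.real_smul, Pi.neg_apply]
        conv_rhs => rw [hk]
        push_cast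
        ring
      · have := integrable_phase_mul (hc.pos_part.ofReal (𝕜 := ℂ)) x
        refine this.congr (Filter.Eventually.of_forall fun k => ?_)
        simp [NNReal.smul_def, mul_comm]
      · have := integrable_phase_mul (hc.neg.pos_part.ofReal (𝕜 := ℂ)) x
        refine this.congr (Filter.Eventually.of_forall fun k => ?_)
        simp [NNReal.smul_def, mul_comm]
  rw [MeasureTheory.withDensity_eq_iff (hmeas c hc).coe_nnreal_ennreal
    (hmeas _ hc.neg).coe_nnreal_ennreal (hfin c hc)] at heq
  filter_upwards [heq] with k hk
  have hk' : (c k).toNNReal = (-c k).toNNReal := ENNReal.coe_injective hk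
  have := congrArg NNReal.toReal hk'
  rw [Real.coe_toNNReal', Real.coe_toNNReal'] at this
  have h3 := max_zero_sub_max_neg_zero_eq_self (c k)
  rw [this, sub_self] at h3
  exact h3.symm

/-- Conjugation turns the phase at `x` into that at `-x`, so the conjugate of `c` also has vanishing
Fourier integral, and hence so do the real and imaginary parts. -/
theorem ae_eq_zero_of_integral_phase (hc : MeasureTheory.Integrable c m)
    (h : ∀ x, ∫ k, phase k x * c k ∂m = 0) : c =ᵐ[m] 0 := by
  have hconj : ∀ x, ∫ k, phase k x * starRingEnd ℂ (c k) ∂m = 0 := fun x => by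
    have h1 := congrArg (starRingEnd ℂ) (h (-x))
    rw [map_zero, ← integral_conj] at h1
    rw [← h1]
    refine MeasureTheory.integral_congr_ae (Filter.Eventually.of_forall fun k => ?_)
    simp only [map_mul, phase_neg, Complex.conj_conj]
  have hci : MeasureTheory.Integrable (fun k => starRingEnd ℂ (c k)) m :=
    (LinearIsometryEquiv.integrable_comp_iff Complex.conjLIE).2 hc
  have hre := ae_eq_zero_of_integral_phase_ofReal hc.re fun x => by
    have h1 : ∀ k, phase k x * ((RCLike.re (c k) : ℝ) : ℂ) =
        2⁻¹ * (phase k x * c k + phase k x * starRingEnd ℂ (c k)) := fun k => by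
      have := Complex.add_conj (c k)
      rw [← mul_add, this]
      push_cast
      change _ * ((c k).re : ℂ) = _
      ring
    simp only [h1]
    rw [MeasureTheory.integral_const_mul, MeasureTheory.integral_add (integrable_phase_mul hc x)
      (integrable_phase_mul hci x), h, hconj, add_zero, mul_zero]
  have him := ae_eq_zero_of_integral_phase_ofReal hc.im fun x => by
    have h1 : ∀ k, phase k x * ((RCLike.im (c k) : ℝ) : ℂ) =
        (2 * Complex.I)⁻¹ * (phase k x * c k - phase k x * starRingEnd ℂ (c k)) := fun k => by
      have := Complex.sub_conj (c k)
      rw [← mul_sub, this]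
      push_cast
      change _ * ((c k).im : ℂ) = _
      field_simp
    simp only [h1]
    rw [MeasureTheory.integral_const_mul, MeasureTheory.integral_sub (integrable_phase_mul hc x)
      (integrable_phase_mul hci x), h, hconj, sub_zero, mul_zero]
  filter_upwards [hre, him] with k h1 h2
  exact Complex.ext h1 h2

end

/-! ### Superpositions of plane waves -/

/-- The conditions on the amplitude `T` of a harmonic plane wave of momentum `k`. -/
structure IsAmplitude {n p q : ℕ} (k : Spacetime n)
    (T : BiTensor (Fin (n + 2)) (p + 1) (q + 1)) : Prop where
  young : T ∈ youngTraceless (eta n) (p + 1) (q + 1)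
  closed_left : ∀ (κ : Fin (p + 2) → Fin (n + 2)) ν,
    alt (fun κ => (low k (κ 0) : ℂ) * T (Fin.tail κ) ν) κ = 0
  closed_right : ∀ μ (κ : Fin (q + 2) → Fin (n + 2)),
    alt (fun κ => (low k (κ (Fin.last (q + 1))) : ℂ) * T μ (Fin.init κ)) κ = 0
  coclosed_left : ∀ (μ : Fin p → Fin (n + 2)) ν, ∑ β, (k β : ℂ) * T (Fin.cons β μ) ν = 0
  coclosed_right : ∀ μ (ν : Fin q → Fin (n + 2)), ∑ β, (k β : ℂ) * T μ (Fin.cons β ν) = 0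

/-- Antisymmetrization, evaluated at given indices, as a linear form. -/
def altₗ {ι : Type} {m : ℕ} (κ : Fin m → ι) : ((Fin m → ι) → ℂ) →ₗ[ℂ] ℂ where
  toFun f := alt f κ
  map_add' f g := alt_add f g κ
  map_smul' c f := alt_smul c f κ

theorem altₗ_apply {ι : Type} {m : ℕ} (κ : Fin m → ι) (f : (Fin m → ι) → ℂ) :
    altₗ κ f = alt f κ := rfl

/-- Contraction with the metric as a linear form. -/
def traceₗ (n : ℕ) : (Fin (n + 2) × Fin (n + 2) → ℂ) →ₗ[ℂ] ℂ where
  toFun f := ∑ α, ∑ β, (eta n α β : ℂ) * f (α, β)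
  map_add' f g := by simp [mul_add, Finset.sum_add_distrib]
  map_smul' c f := by
    simp only [Pi.smul_apply, smul_eq_mul, mul_left_comm _ c, Finset.mul_sum, RingHom.id_apply]

section

variable {n : ℕ} {m : MeasureTheory.Measure (Spacetime n)} {J : Type} [Finite J]
  {c : Spacetime n → J → ℂ}

theorem exists_linearForm_eq {J : Type} [Fintype J] (l : (J → ℂ) →ₗ[ℂ] ℂ) :
    ∃ b : J → ℂ, ∀ v, l v = ∑ j, v j * b j := by
  classical
  exact ⟨_, LinearMap.pi_apply_eq_sum_univ l⟩

theorem linearForm_integral_phase (hc : ∀ j, MeasureTheory.Integrable (fun k => c k j) m)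
    (l : (J → ℂ) →ₗ[ℂ] ℂ) (x : Spacetime n) :
    l (fun j => ∫ k, phase k x * c k j ∂m) = ∫ k, phase k x * l (c k) ∂m := by
  have := Fintype.ofFinite J
  obtain ⟨b, hb⟩ := exists_linearForm_eq l
  simp only [hb, Finset.mul_sum]
  rw [MeasureTheory.integral_finsetSum]
  · refine Finset.sum_congr rfl fun j _ => ?_
    rw [← MeasureTheory.integral_mul_const]
    simp only [mul_assoc]
  · intro j _
    simp only [← mul_assoc]
    exact (integrable_phase_mul (hc j) x).mul_const _

/-- A linear form on finitely many components commutes with the integral, so the condition becomes a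
vanishing Fourier integral and injectivity applies. -/
theorem forall_linearForm_eq_zero_iff (hc : ∀ j, MeasureTheory.Integrable (fun k => c k j) m)
    (l : (J → ℂ) →ₗ[ℂ] ℂ) :
    (∀ x, l (fun j => ∫ k, phase k x * c k j ∂m) = 0) ↔ ∀ᵐ k ∂m, l (c k) = 0 := by
  have := Fintype.ofFinite J
  obtain ⟨b, hb⟩ := exists_linearForm_eq l
  simp only [linearForm_integral_phase hc l]
  refine ⟨fun h => ?_, fun h x => ?_⟩
  · refine ae_eq_zero_of_integral_phase ?_ h
    simp only [hb]
    exact MeasureTheory.integrable_finsetSum _ fun j _ => (hc j).mul_const _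
  · refine MeasureTheory.integral_eq_zero_of_ae ?_
    filter_upwards [h] with k hk
    rw [hk, mul_zero, Pi.zero_apply]

theorem forall_alt_eq_zero_iff {N : ℕ} {c : Spacetime n → (Fin N → Fin (n + 2)) → ℂ}
    (hc : ∀ κ, MeasureTheory.Integrable (fun k => c k κ) m) (κ : Fin N → Fin (n + 2)) :
    (∀ x, alt (fun κ => ∫ k, phase k x * (Complex.I * c k κ) ∂m) κ = 0) ↔
      ∀ᵐ k ∂m, alt (c k) κ = 0 := by
  have h := forall_linearForm_eq_zero_iff (c := fun k κ => Complex.I * c k κ)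
    (fun κ => (hc κ).const_mul _) (altₗ κ)
  simp only [altₗ_apply, alt_smul, mul_eq_zero, Complex.I_ne_zero, false_or] at h
  exact h

theorem forall_trace_eq_zero_iff {c : Spacetime n → Fin (n + 2) → ℂ}
    (hc : ∀ α β, MeasureTheory.Integrable (fun k => (low k α : ℂ) * c k β) m) :
    (∀ x, ∑ α, ∑ β, (eta n α β : ℂ) *
      ∫ k, phase k x * (Complex.I * ((low k α : ℂ) * c k β)) ∂m = 0) ↔
      ∀ᵐ k ∂m, ∑ β, (k β : ℂ) * c k β = 0 := by
  refine (forall_linearForm_eq_zero_iff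
    (c := fun k (j : Fin (n + 2) × Fin (n + 2)) => Complex.I * ((low k j.1 : ℂ) * c k j.2))
    (fun j => (hc j.1 j.2).const_mul _) (traceₗ n)).trans ?_
  refine Filter.eventually_congr (Filter.Eventually.of_forall fun k => ?_)
  change ∑ α, ∑ β, (eta n α β : ℂ) * (Complex.I * ((low k α : ℂ) * c k β)) = 0 ↔ _
  simp only [mul_left_comm _ Complex.I, ← Finset.mul_sum, sum_eta_low_mul, mul_eq_zero,
    Complex.I_ne_zero, false_or]

/-- In finite dimension `W` is cut out by finitely many linear forms, so only finitely many
exceptional null sets have to be united. -/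
theorem forall_mem_iff (hc : ∀ j, MeasureTheory.Integrable (fun k => c k j) m)
    (W : Submodule ℂ (J → ℂ)) :
    (∀ x, (fun j => ∫ k, phase k x * c k j ∂m) ∈ W) ↔ ∀ᵐ k ∂m, c k ∈ W := by
  obtain ⟨s, hs⟩ : (W.dualAnnihilator).FG := IsNoetherian.noetherian _
  have hW : ∀ v, v ∈ W ↔ ∀ φ : s, φ.1 v = 0 := fun v => by
    rw [← Subspace.forall_mem_dualAnnihilator_apply_eq_zero_iff W v]
    refine ⟨fun h φ => h φ.1 (hs ▸ Submodule.subset_span φ.2), fun h φ hφ => ?_⟩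
    have hle : Submodule.span ℂ (s : Set (Module.Dual ℂ (J → ℂ))) ≤
        LinearMap.ker (Module.Dual.eval ℂ (J → ℂ) v) :=
      Submodule.span_le.2 fun ψ hψ => h ⟨ψ, hψ⟩
    rw [hs] at hle
    exact hle hφ
  simp only [hW]
  rw [MeasureTheory.ae_all_iff, forall_comm]
  exact forall_congr' fun φ => forall_linearForm_eq_zero_iff hc φ.1

end

theorem superposition_mem_iff {n p q : ℕ} (m : MeasureTheory.Measure (Spacetime n))
    (f : Spacetime n → BiTensor (Fin (n + 2)) (p + 1) (q + 1))
    (hf : ∀ α β, MeasureTheory.Integrable (fun k => ((1 + ‖k‖ ^ 2 : ℝ) : ℂ) * f k α β) m) :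
    superposition m f ∈ harmonicMultiforms n p q ↔ ∀ᵐ k ∂m, IsAmplitude k (f k) := by
  have hd : ∀ α β μ x, pderiv μ (fun y => superposition m f y α β) x =
      ∫ k, phase k x * (Complex.I * ((low k μ : ℂ) * f k α β)) ∂m := fun α β μ x =>
    pderiv_integral_phase (hf α β) μ x
  have hci : ∀ α β μ, MeasureTheory.Integrable
      (fun k => (low k μ : ℂ) * f k α β) m := fun α β μ => integrable_low_mul (hf α β) μ
  have hyoung : (∀ x, superposition m f x ∈ youngTraceless (eta n) (p + 1) (q + 1)) ↔
      ∀ᵐ k ∂m, f k ∈ youngTraceless (eta n) (p + 1) (q + 1) :=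
    forall_mem_iff (J := (Fin (p + 1) → Fin (n + 2)) × (Fin (q + 1) → Fin (n + 2)))
      (c := fun k j => f k j.1 j.2) (fun j => integrable_of_weighted (hf j.1 j.2))
      ((youngTraceless (eta n) (p + 1) (q + 1)).comap (LinearEquiv.curry ℂ ℂ _ _).toLinearMap)
  have hcl : (∀ x (κ : Fin (p + 2) → Fin (n + 2)) ν,
      alt (fun κ => pderiv (κ 0) (fun y => superposition m f y (Fin.tail κ) ν) x) κ = 0) ↔
      ∀ᵐ k ∂m, ∀ (κ : Fin (p + 2) → Fin (n + 2)) ν,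
        alt (fun κ => (low k (κ 0) : ℂ) * f k (Fin.tail κ) ν) κ = 0 := by
    simp only [MeasureTheory.ae_all_iff, hd]
    rw [forall_comm]
    refine forall_congr' fun κ => ?_
    rw [forall_comm]
    exact forall_congr' fun ν => forall_alt_eq_zero_iff (fun κ => hci _ _ _) κ
  have hcr : (∀ x μ (κ : Fin (q + 2) → Fin (n + 2)),
      alt (fun κ => pderiv (κ (Fin.last (q + 1)))
        (fun y => superposition m f y μ (Fin.init κ)) x) κ = 0) ↔
      ∀ᵐ k ∂m, ∀ μ (κ : Fin (q + 2) → Fin (n + 2)),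
        alt (fun κ => (low k (κ (Fin.last (q + 1))) : ℂ) * f k μ (Fin.init κ)) κ = 0 := by
    simp only [MeasureTheory.ae_all_iff, hd]
    rw [forall_comm]
    refine forall_congr' fun μ => ?_
    rw [forall_comm]
    exact forall_congr' fun κ => forall_alt_eq_zero_iff (fun κ => hci _ _ _) κ
  have hccl : (∀ x (μ : Fin p → Fin (n + 2)) ν,
      ∑ α, ∑ β, (eta n α β : ℂ) * pderiv α (fun y => superposition m f y (Fin.cons β μ) ν) x = 0) ↔
      ∀ᵐ k ∂m, ∀ (μ : Fin p → Fin (n + 2)) ν, ∑ β, (k β : ℂ) * f k (Fin.cons β μ) ν = 0 := by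
    simp only [MeasureTheory.ae_all_iff, hd]
    rw [forall_comm]
    refine forall_congr' fun μ => ?_
    rw [forall_comm]
    exact forall_congr' fun ν => forall_trace_eq_zero_iff fun α β => hci _ _ _
  have hccr : (∀ x μ (ν : Fin q → Fin (n + 2)),
      ∑ α, ∑ β, (eta n α β : ℂ) * pderiv α (fun y => superposition m f y μ (Fin.cons β ν)) x = 0) ↔
      ∀ᵐ k ∂m, ∀ μ (ν : Fin q → Fin (n + 2)), ∑ β, (k β : ℂ) * f k μ (Fin.cons β ν) = 0 := by
    simp only [MeasureTheory.ae_all_iff, hd]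
    rw [forall_comm]
    refine forall_congr' fun μ => ?_
    rw [forall_comm]
    exact forall_congr' fun ν => forall_trace_eq_zero_iff fun α β => hci _ _ _
  constructor
  · rintro ⟨-, h1, h2, h3, h4, h5⟩
    filter_upwards [hyoung.1 h1, hcl.1 h2, hcr.1 h3, hccl.1 h4, hccr.1 h5] with k k1 k2 k3 k4 k5
    exact ⟨k1, k2, k3, k4, k5⟩
  · intro h
    exact ⟨fun α β => contDiff_integral_phase (hf α β), hyoung.2 (h.mono fun k hk => hk.young),
      hcl.2 (h.mono fun k hk => hk.closed_left), hcr.2 (h.mono fun k hk => hk.closed_right),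
      hccl.2 (h.mono fun k hk => hk.coclosed_left), hccr.2 (h.mono fun k hk => hk.coclosed_right)⟩

/-- A plane wave is a superposition for the Dirac measure at `k`, for which almost everywhere means
at `k`. -/
theorem planeWave_mem_harmonicMultiforms_iff {n p q : ℕ} {k : Spacetime n}
    {T : BiTensor (Fin (n + 2)) (p + 1) (q + 1)} :
    planeWave k T ∈ harmonicMultiforms n p q ↔ IsAmplitude k T := by
  have h := superposition_mem_iff (MeasureTheory.Measure.dirac k) (fun _ => T) fun α β =>
    MeasureTheory.integrable_dirac enorm_lt_top
  have hs : superposition (MeasureTheory.Measure.dirac k) (fun _ => T) = planeWave k T := by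
    funext x α β
    exact MeasureTheory.integral_dirac _ _
  rw [hs] at h
  rw [h, MeasureTheory.ae_dirac_eq, Filter.eventually_pure]

theorem planeWave_mem_iff {n p q : ℕ} {k : Spacetime n}
    {T : BiTensor (Fin (n + 2)) (p + 1) (q + 1)} :
    planeWave k T ∈ momentumSolutions n p q k ↔ IsAmplitude k T := by
  rw [← planeWave_mem_harmonicMultiforms_iff]
  refine ⟨fun h => h.1, fun h => ⟨h, fun a x => ?_⟩⟩
  rw [planeWave, phase_add, mul_comm, mul_smul]
  rfl

theorem eq_planeWave_of_mem {n p q : ℕ} {k : Spacetime n} {K : TensorField n (p + 1) (q + 1)}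
    (hK : K ∈ momentumSolutions n p q k) : K = planeWave k (K 0) := by
  funext x
  have := hK.2 x 0
  rwa [zero_add] at this

theorem mem_momentumSolutions_iff {n p q : ℕ} {k : Spacetime n}
    {K : TensorField n (p + 1) (q + 1)} :
    K ∈ momentumSolutions n p q k ↔ K = planeWave k (K 0) ∧ IsAmplitude k (K 0) := by
  refine ⟨fun h => ⟨eq_planeWave_of_mem h, ?_⟩, fun h => ?_⟩
  · rw [← planeWave_mem_iff, ← eq_planeWave_of_mem h]
    exact h
  · rw [h.1]
    exact planeWave_mem_iff.2 h.2

/-! ### The wave equation -/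

/-- Swapping slot `i` with the first one extends conditions stated for the first slot, such as
coclosedness, to every slot. -/
theorem IsAlt.update_eq {ι : Type} {a : ℕ} {f : (Fin (a + 1) → ι) → ℂ} (hf : IsAlt f)
    (μ : Fin (a + 1) → ι) (i : Fin (a + 1)) (y : ι) :
    f (update μ i y) =
      ((Perm.sign (Equiv.swap 0 i) : ℤ) : ℂ) * f (Fin.cons y (Fin.tail (μ ∘ Equiv.swap 0 i))) := by
  rw [← hf]
  congr 1
  funext j
  by_cases hj : j = i
  · subst hj
    simp
  · rw [update_of_ne hj, comp_apply]
    have h0 : Equiv.swap 0 i j ≠ 0 := fun h => hj (by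
      rw [swap_apply_eq_iff] at h
      simpa using h)
    obtain ⟨l, hl⟩ := Fin.exists_succ_eq.2 h0
    rw [← hl, Fin.cons_succ, Fin.tail, hl, comp_apply, swap_apply_self]

theorem contDiff_pderiv {n : ℕ} {f : Spacetime n → ℂ} (hf : ContDiff ℝ 2 f) (μ : Fin (n + 2)) :
    ContDiff ℝ 1 (pderiv μ f) :=
  (hf.fderiv_right (m := 1) (by norm_num)).clm_apply contDiff_const

theorem pderiv_comm {n : ℕ} {f : Spacetime n → ℂ} (hf : ContDiff ℝ 2 f) (μ ν : Fin (n + 2))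
    (x : Spacetime n) : pderiv μ (pderiv ν f) x = pderiv ν (pderiv μ f) x := by
  have hd : Differentiable ℝ (fderiv ℝ f) :=
    (hf.fderiv_right (m := 1) (by norm_num)).differentiable (by norm_num)
  have h : ∀ μ ν, pderiv μ (pderiv ν f) x =
      fderiv ℝ (fderiv ℝ f) x (Pi.single μ 1) (Pi.single ν 1) := fun μ ν => by
    change fderiv ℝ (fun y => fderiv ℝ f y (Pi.single ν 1)) x (Pi.single μ 1) = _
    rw [fderiv_clm_apply (hd x) (differentiableAt_const _)]
    simp
  rw [h, h]
  exact (hf.contDiffAt.isSymmSndFDerivAt (by simp)).eq _ _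

theorem pderiv_finset_sum {n : ℕ} {J : Type} (s : Finset J) {f : J → Spacetime n → ℂ}
    (hf : ∀ j, ContDiff ℝ 1 (f j)) (μ : Fin (n + 2)) (x : Spacetime n) :
    pderiv μ (fun y => ∑ j ∈ s, f j y) x = ∑ j ∈ s, pderiv μ (f j) x := by
  simp only [pderiv]
  rw [fderiv_fun_sum fun j _ => (hf j).differentiable (by norm_num) x]
  simp

theorem pderiv_const_mul {n : ℕ} {f : Spacetime n → ℂ} (hf : ContDiff ℝ 1 f) (c : ℂ)
    (μ : Fin (n + 2)) (x : Spacetime n) : pderiv μ (fun y => c * f y) x = c * pderiv μ f x := by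
  simp [pderiv, fderiv_const_mul ((hf.differentiable (by norm_num)) x)]

/-- Only the first column is needed: closedness moves the derivative onto the original indices, and
after commuting derivatives a divergence in slot `i` remains, which vanishes. -/
theorem box_eq_zero {n p q : ℕ} {K : TensorField n (p + 1) (q + 1)}
    (hK : K ∈ harmonicMultiforms n p q) (α : Fin (p + 1) → Fin (n + 2))
    (β : Fin (q + 1) → Fin (n + 2)) (x : Spacetime n) : box (fun y => K y α β) x = 0 := by
  obtain ⟨hK₀, hK₁, hK₂, -, hK₄, -⟩ := hK
  have halt : ∀ x β, IsAlt fun μ => K x μ β := fun x β =>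
    (mem_youngTraceless_iff.1 (hK₁ x)).1.left β
  have hclosed : ∀ x y, pderiv y (fun z => K z α β) x =
      ∑ i, pderiv (α i) (fun z => K z (update α i y) β) x := by
    intro x y
    refine (alt_cons_eq_zero_iff (F := fun μ y => pderiv y (fun z => K z μ β) x)
      fun y σ μ => ?_).1 (fun κ => hK₂ x κ β) α y
    have : (fun z => K z (μ ∘ σ) β) = fun z => ((Perm.sign σ : ℤ) : ℂ) * K z μ β :=
      funext fun z => halt z β σ μ
    simp only [this]
    exact pderiv_mul y (hK₀ μ β) _ x
  have hcoclosed : ∀ x i, ∑ μ, ∑ ν, (eta n μ ν : ℂ) *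
      pderiv μ (fun z => K z (update α i ν) β) x = 0 := by
    intro x i
    have h : ∀ ν, (fun z => K z (update α i ν) β) = fun z =>
        ((Perm.sign (swap 0 i) : ℤ) : ℂ) * K z (Fin.cons ν (Fin.tail (α ∘ swap 0 i))) β :=
      fun ν => funext fun z => (halt z β).update_eq α i ν
    simp only [h, pderiv_mul _ (hK₀ _ _), mul_left_comm _ ((Perm.sign (swap 0 i) : ℤ) : ℂ),
      ← Finset.mul_sum, hK₄, mul_zero]
  have hd := fun i ν μ => contDiff_pderiv (hK₀ (update α i ν) β) μ
  have h1 : ∀ μ ν, pderiv μ (pderiv ν fun y => K y α β) x =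
      ∑ i, pderiv (α i) (pderiv μ fun y => K y (update α i ν) β) x := by
    intro μ ν
    rw [show pderiv ν (fun y => K y α β) =
      fun x => ∑ i, pderiv (α i) (fun z => K z (update α i ν) β) x from
      funext fun x => hclosed x ν, pderiv_finset_sum _ fun i => hd i ν (α i)]
    exact Finset.sum_congr rfl fun i _ => pderiv_comm (hK₀ _ β) _ _ x
  have h2 : ∀ i, ∑ μ, ∑ ν, (eta n μ ν : ℂ) *
      pderiv (α i) (pderiv μ fun y => K y (update α i ν) β) x = 0 := by
    intro i
    have h3 : pderiv (α i) (fun x => ∑ μ, ∑ ν, (eta n μ ν : ℂ) *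
        pderiv μ (fun z => K z (update α i ν) β) x) x = 0 := by
      simp only [hcoclosed]
      exact pderiv_zero _ _
    rw [pderiv_finset_sum _ fun μ => ContDiff.sum fun ν _ => contDiff_const.mul (hd i ν μ)] at h3
    rw [← h3]
    refine Finset.sum_congr rfl fun μ _ => ?_
    rw [pderiv_finset_sum _ fun ν => contDiff_const.mul (hd i ν μ)]
    exact Finset.sum_congr rfl fun ν _ => (pderiv_const_mul (hd i ν μ) _ _ _).symm
  simp only [box, h1, Finset.mul_sum]
  rw [← Finset.sum_eq_zero fun i (_ : i ∈ Finset.univ) => h2 i,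
    Finset.sum_comm (s := Finset.univ (α := Fin (p + 1)))]
  exact Finset.sum_congr rfl fun μ _ => Finset.sum_comm

/-! ### Amplitudes -/

section

variable {n p q : ℕ} {k : Spacetime n} {T : BiTensor (Fin (n + 2)) (p + 1) (q + 1)}

theorem IsAmplitude.isYoung (hT : IsAmplitude k T) : IsYoung T :=
  (mem_youngTraceless_iff.1 hT.young).1

theorem closed_left_iff (hT : ∀ ν, IsAlt fun μ => T μ ν) :
    (∀ (κ : Fin (p + 2) → Fin (n + 2)) ν,
      alt (fun κ => (low k (κ 0) : ℂ) * T (Fin.tail κ) ν) κ = 0) ↔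
    ∀ μ ν y, (low k y : ℂ) * T μ ν = ∑ i, (low k (μ i) : ℂ) * T (update μ i y) ν := by
  rw [forall_comm, forall_comm (α := Fin (p + 1) → Fin (n + 2))]
  refine forall_congr' fun ν => alt_cons_eq_zero_iff (F := fun μ y => (low k y : ℂ) * T μ ν)
    fun y σ μ => ?_
  simp only [hT ν σ μ, mul_left_comm]

theorem closed_right_iff (hT : ∀ μ, IsAlt fun ν => T μ ν) :
    (∀ μ (κ : Fin (q + 2) → Fin (n + 2)),
      alt (fun κ => (low k (κ (Fin.last (q + 1))) : ℂ) * T μ (Fin.init κ)) κ = 0) ↔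
    ∀ μ ν y, (low k y : ℂ) * T μ ν = ∑ j, (low k (ν j) : ℂ) * T μ (update ν j y) := by
  refine forall_congr' fun μ => alt_snoc_eq_zero_iff (F := fun ν y => (low k y : ℂ) * T μ ν)
    fun y σ ν => ?_
  simp only [hT μ σ ν, mul_left_comm]

theorem coclosed_left_iff (hT : ∀ ν, IsAlt fun μ => T μ ν) :
    (∀ (μ : Fin p → Fin (n + 2)) ν, ∑ β, (k β : ℂ) * T (Fin.cons β μ) ν = 0) ↔
    ∀ μ ν i, ∑ β, (k β : ℂ) * T (update μ i β) ν = 0 := by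
  refine ⟨fun h μ ν i => ?_, fun h μ ν => ?_⟩
  · have h1 : ∀ y, T (update μ i y) ν = _ := (hT ν).update_eq μ i
    simp only [h1, mul_left_comm _ ((Perm.sign (swap 0 i) : ℤ) : ℂ), ← Finset.mul_sum, h, mul_zero]
  · simpa using h (Fin.cons 0 μ) ν 0

theorem coclosed_right_iff (hT : ∀ μ, IsAlt fun ν => T μ ν) :
    (∀ μ (ν : Fin q → Fin (n + 2)), ∑ β, (k β : ℂ) * T μ (Fin.cons β ν) = 0) ↔
    ∀ μ ν j, ∑ β, (k β : ℂ) * T μ (update ν j β) = 0 := by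
  refine ⟨fun h μ ν i => ?_, fun h μ ν => ?_⟩
  · have h1 : ∀ y, T μ (update ν i y) = _ := (hT μ).update_eq ν i
    simp only [h1, mul_left_comm _ ((Perm.sign (swap 0 i) : ℤ) : ℂ), ← Finset.mul_sum, h, mul_zero]
  · simpa using h μ (Fin.cons 0 ν) 0

theorem isAmplitude_iff : IsAmplitude k T ↔ T ∈ youngTraceless (eta n) (p + 1) (q + 1) ∧
    (∀ μ ν y, (low k y : ℂ) * T μ ν = ∑ i, (low k (μ i) : ℂ) * T (update μ i y) ν) ∧
    (∀ μ ν y, (low k y : ℂ) * T μ ν = ∑ j, (low k (ν j) : ℂ) * T μ (update ν j y)) ∧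
    (∀ μ ν i, ∑ β, (k β : ℂ) * T (update μ i β) ν = 0) ∧
    ∀ μ ν j, ∑ β, (k β : ℂ) * T μ (update ν j β) = 0 := by
  constructor
  · intro h
    have hY := h.isYoung
    exact ⟨h.young, (closed_left_iff hY.left).1 h.closed_left,
      (closed_right_iff hY.right).1 h.closed_right, (coclosed_left_iff hY.left).1 h.coclosed_left,
      (coclosed_right_iff hY.right).1 h.coclosed_right⟩
  · rintro ⟨h1, h2, h3, h4, h5⟩
    have hY := (mem_youngTraceless_iff.1 h1).1
    exact ⟨h1, (closed_left_iff hY.left).2 h2, (closed_right_iff hY.right).2 h3,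
      (coclosed_left_iff hY.left).2 h4, (coclosed_right_iff hY.right).2 h5⟩

/-- The momentum-space form of `box_eq_zero`: contracting the closedness relation with `k` leaves
`k·k` on the left, and on the right only coclosedness contractions. -/
theorem IsAmplitude.eq_zero (hT : IsAmplitude k T) (hk : mdot k k ≠ 0) : T = 0 := by
  obtain ⟨-, h2, -, h4, -⟩ := isAmplitude_iff.1 hT
  funext μ ν
  have h : (mdot k k : ℂ) * T μ ν = 0 := by
    rw [← sum_low_mul, Complex.ofReal_sum, Finset.sum_mul]
    calc ∑ y, ((low k y * k y : ℝ) : ℂ) * T μ ν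
        = ∑ y, ∑ i, (low k (μ i) : ℂ) * ((k y : ℂ) * T (update μ i y) ν) := by
          refine Finset.sum_congr rfl fun y _ => ?_
          push_cast
          rw [mul_right_comm, h2 μ ν y, Finset.sum_mul]
          exact Finset.sum_congr rfl fun i _ => by ring
      _ = 0 := by
          rw [Finset.sum_comm]
          simp only [← Finset.mul_sum, h4, mul_zero, Finset.sum_const_zero]
  exact (mul_eq_zero.1 h).resolve_left (Complex.ofReal_ne_zero.2 hk)

theorem momentumSolutions_eq_bot (hk : mdot k k ≠ 0) : momentumSolutions n p q k = ⊥ := by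
  refine (Submodule.eq_bot_iff _).2 fun K hK => ?_
  obtain ⟨h1, h2⟩ := mem_momentumSolutions_iff.1 hK
  rw [h1, h2.eq_zero hk]
  funext x
  exact smul_zero _

end

/-! ### Covariance of the amplitudes -/

/-- The conditions on the amplitude of a harmonic plane wave in an arbitrary basis, for the
inverse metric `g` and the momentum with covariant components `κ` and contravariant
components `v`. -/
structure IsMode {ι : Type} [Fintype ι] {a b : ℕ} (g : Matrix ι ι ℝ) (κ v : ι → ℝ)
    (T : BiTensor ι a b) : Prop where
  young : T ∈ youngTraceless g a b
  closed_left : ∀ μ ν y, (κ y : ℂ) * T μ ν = ∑ i, (κ (μ i) : ℂ) * T (update μ i y) ν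
  closed_right : ∀ μ ν y, (κ y : ℂ) * T μ ν = ∑ j, (κ (ν j) : ℂ) * T μ (update ν j y)
  coclosed_left : ∀ μ ν i, ∑ β, (v β : ℂ) * T (update μ i β) ν = 0
  coclosed_right : ∀ μ ν j, ∑ β, (v β : ℂ) * T μ (update ν j β) = 0

theorem isAmplitude_iff_isMode {n p q : ℕ} {k : Spacetime n}
    {T : BiTensor (Fin (n + 2)) (p + 1) (q + 1)} :
    IsAmplitude k T ↔ IsMode (eta n) (low k) k T := by
  rw [isAmplitude_iff]
  exact ⟨fun ⟨h1, h2, h3, h4, h5⟩ => ⟨h1, h2, h3, h4, h5⟩,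
    fun ⟨h1, h2, h3, h4, h5⟩ => ⟨h1, h2, h3, h4, h5⟩⟩

section

variable {ι : Type} [Fintype ι] {a b : ℕ}

theorem mev_closed {J A : Type} [Fintype J] [DecidableEq J] [Fintype A] {S : (J → ι) → ℂ}
    {κ : ι → ℂ} (s : A → J)
    (h : ∀ γ y, κ y * S γ = ∑ i, κ (γ (s i)) * S (update γ (s i) y)) (w : J → ι → ℂ)
    (x : ι → ℂ) :
    (∑ c, κ c * x c) * mev S w = ∑ i, (∑ c, κ c * w (s i) c) * mev S (update w (s i) x) := by
  -- The covector `κ` is adjoined as an additional slot. Closedness becomes an exchange relation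
  -- between it and the slots `s i`, which extends to vectors by permuting slots.
  let S' : (J ⊕ Unit → ι) → ℂ := fun γ => S (γ ∘ Sum.inl) * κ ((γ ∘ Sum.inr) ())
  have hS' : ∀ (w : J → ι → ℂ) (x : Unit → ι → ℂ),
      mev S' (Sum.elim w x) = (∑ c, κ c * x () c) * mev S w := by
    intro w x
    rw [mev_mul S fun γ => κ (γ ()), Sum.elim_comp_inl, Sum.elim_comp_inr, mul_comm]
    congr 1
    rw [mev_apply]
    refine Fintype.sum_equiv (Equiv.funUnique Unit ι) _ _ fun γ => ?_
    simp [Equiv.funUnique]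
  have h1 : S' = fun γ => ∑ i, S' (γ ∘ Equiv.swap (Sum.inl (s i)) (Sum.inr ())) := by
    funext γ
    rw [← Sum.elim_comp_inl_inr γ]
    simp only [elim_comp_swap]
    simp only [S', Sum.elim_comp_inl, Sum.elim_comp_inr, update_self]
    rw [mul_comm, h]
    exact Finset.sum_congr rfl fun i _ => mul_comm _ _
  have h2 := congrArg (fun S => mev S (Sum.elim w fun _ => x)) h1
  simp only [mev_sum, mev_comp_perm, elim_comp_swap, hS', update_self] at h2
  exact h2

theorem joint_update_left {ι : Type} {a b : ℕ} (T : BiTensor ι a b)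
    (γ : Fin a ⊕ Fin b → ι) (i : Fin a) (y : ι) :
    joint T (update γ (Sum.inl i) y) = T (update (γ ∘ Sum.inl) i y) (γ ∘ Sum.inr) := by
  rw [joint, update_comp_eq_of_injective γ Sum.inl_injective, update_comp_eq_of_forall_ne]
  simp

theorem joint_update_right {ι : Type} {a b : ℕ} (T : BiTensor ι a b)
    (γ : Fin a ⊕ Fin b → ι) (j : Fin b) (y : ι) :
    joint T (update γ (Sum.inr j) y) = T (γ ∘ Sum.inl) (update (γ ∘ Sum.inr) j y) := by
  rw [joint, update_comp_eq_of_injective γ Sum.inr_injective, update_comp_eq_of_forall_ne]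
  simp

theorem ev_closed_left {T : BiTensor ι a b} {κ : ι → ℂ}
    (h : ∀ μ ν y, κ y * T μ ν = ∑ i, κ (μ i) * T (update μ i y) ν)
    (u : Fin a → ι → ℂ) (v : Fin b → ι → ℂ) (x : ι → ℂ) :
    (∑ c, κ c * x c) * ev T u v = ∑ i, (∑ c, κ c * u i c) * ev T (update u i x) v := by
  have := mev_closed (S := joint T) (κ := κ) (A := Fin a) Sum.inl (fun γ y => by
    simp only [joint_update_left]
    exact h _ _ y) (Sum.elim u v) x
  simpa only [ev, Sum.update_elim_inl, Sum.elim_inl] using this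

theorem ev_closed_right {T : BiTensor ι a b} {κ : ι → ℂ}
    (h : ∀ μ ν y, κ y * T μ ν = ∑ j, κ (ν j) * T μ (update ν j y))
    (u : Fin a → ι → ℂ) (v : Fin b → ι → ℂ) (x : ι → ℂ) :
    (∑ c, κ c * x c) * ev T u v = ∑ j, (∑ c, κ c * v j c) * ev T u (update v j x) := by
  have := mev_closed (S := joint T) (κ := κ) (A := Fin b) Sum.inr (fun γ y => by
    simp only [joint_update_right]
    exact h _ _ y) (Sum.elim u v) x
  simpa only [ev, Sum.update_elim_inr, Sum.elim_inr] using this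

theorem mev_eq_zero_of_slot {J : Type} [Fintype J] [DecidableEq J] {S : (J → ι) → ℂ}
    {v : ι → ℂ} {s : J} (h : ∀ γ, ∑ c, v c * S (update γ s c) = 0) (w : J → ι → ℂ) :
    mev S (update w s v) = 0 := by
  classical
  have key := eq_zero_of_basis (N := fun w => mev S (update w s v)) ?_ ?_ w
  · exact key
  · intro w r hw
    by_cases hr : r = s
    · subst hr
      rcases isEmpty_or_nonempty ι with hι | hι
      · rw [mev_update_eq_sum]
        simp
      · simpa using hw (Classical.arbitrary ι)
    · conv_lhs => rw [← update_eq_self r w]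
      rw [update_comm hr, mev_update_eq_sum]
      refine Finset.sum_eq_zero fun c _ => ?_
      have := hw c
      simp only [update_comm hr] at this
      rw [this, mul_zero]
  · intro γ
    rw [mev_update_eq_sum, ← h γ]
    refine Finset.sum_congr rfl fun c _ => ?_
    rw [← mev_single S (update γ s c)]
    congr 2
    funext r
    by_cases hr : r = s
    · subst hr
      simp
    · simp [hr]

theorem ev_coclosed_left {T : BiTensor ι a b} {v : ι → ℂ} {i : Fin a}
    (h : ∀ μ ν, ∑ β, v β * T (update μ i β) ν = 0) (u : Fin a → ι → ℂ) (w : Fin b → ι → ℂ) :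
    ev T (update u i v) w = 0 := by
  rw [ev, ← Sum.update_elim_inl]
  refine mev_eq_zero_of_slot (fun γ => ?_) _
  simp only [joint_update_left]
  exact h _ _

theorem ev_coclosed_right {T : BiTensor ι a b} {v : ι → ℂ} {j : Fin b}
    (h : ∀ μ ν, ∑ β, v β * T μ (update ν j β) = 0) (u : Fin a → ι → ℂ) (w : Fin b → ι → ℂ) :
    ev T u (update w j v) = 0 := by
  rw [ev, ← Sum.update_elim_inr]
  refine mev_eq_zero_of_slot (fun γ => ?_) _
  simp only [joint_update_right]
  exact h _ _

end

theorem ofReal_update_columns {ι : Type} {m : ℕ} (M : Matrix ι ι ℝ) (μ : Fin m → ι) (i : Fin m)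
    (y : ι) : (fun l c => (M c (update μ i y l) : ℂ)) =
      update (fun l c => (M c (μ l) : ℂ)) i fun c => (M c y : ℂ) := by
  funext l
  by_cases h : l = i
  · subst h; simp
  · simp [h]

/-- Momentum, metric and tensor are transformed together, so one statement gives both invariance
under the stabilizer and the passage to and from a light-cone frame. -/
theorem IsMode.pull {ι : Type} [Fintype ι] [DecidableEq ι] {a b : ℕ} {g g' M : Matrix ι ι ℝ}
    {κ κ' v v' : ι → ℝ} {T : BiTensor ι a b} (hT : IsMode g κ v T) (hM : M * g' * Mᵀ = g)
    (hκ : ∀ c, κ' c = ∑ α, κ α * M α c) (hv : M *ᵥ v' = v) :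
    IsMode g' κ' v' (LightCone.pull M T) := by
  have hκ' : ∀ c, (κ' c : ℂ) = ∑ α, (κ α : ℂ) * (M α c : ℂ) := fun c => by
    rw [hκ]
    push_cast
    rfl
  have hv' : (fun α => (v α : ℂ)) = ∑ c, (v' c : ℂ) • fun α => (M α c : ℂ) := by
    funext α
    rw [← hv, Finset.sum_apply]
    simp only [Matrix.mulVec, dotProduct, Complex.ofReal_sum, Complex.ofReal_mul, Pi.smul_apply,
      smul_eq_mul, mul_comm]
  refine ⟨pull_mem_youngTraceless hM hT.young, fun μ ν y => ?_, fun μ ν y => ?_,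
    fun μ ν i => ?_, fun μ ν j => ?_⟩
  · simp only [pull_apply, ofReal_update_columns, hκ']
    exact ev_closed_left hT.closed_left _ _ _
  · simp only [pull_apply, ofReal_update_columns, hκ']
    exact ev_closed_right hT.closed_right _ _ _
  · simp only [pull_apply, ofReal_update_columns]
    have h := ev_coclosed_left (i := i) (fun μ ν => hT.coclosed_left μ ν i)
      (fun l c => (M c (μ l) : ℂ)) (fun l c => (M c (ν l) : ℂ))
    rw [hv'] at h
    simp only [ev, ← Sum.update_elim_inl, MultilinearMap.map_update_sum,
      MultilinearMap.map_update_smul, smul_eq_mul] at h ⊢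
    exact h
  · simp only [pull_apply, ofReal_update_columns]
    have h := ev_coclosed_right (j := j) (fun μ ν => hT.coclosed_right μ ν j)
      (fun l c => (M c (μ l) : ℂ)) (fun l c => (M c (ν l) : ℂ))
    rw [hv'] at h
    simp only [ev, ← Sum.update_elim_inr, MultilinearMap.map_update_sum,
      MultilinearMap.map_update_smul, smul_eq_mul] at h ⊢
    exact h

/-! ### The action of the stabilizer -/

section

variable {n : ℕ}

theorem eta_mul_eta (n : ℕ) : eta n * eta n = 1 := by
  rw [eta, Matrix.diagonal_mul_diagonal, ← Matrix.diagonal_one]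
  congr 1
  funext μ
  split_ifs <;> simp

theorem mdot_eq_transpose {m l : Type} [Fintype m] [Fintype l]
    (A : Matrix (Fin (n + 2)) m ℝ) (B : Matrix (Fin (n + 2)) l ℝ) (i : m) (j : l) :
    mdot (fun α => A α i) (fun α => B α j) = (Aᵀ * eta n * B) i j := by
  rw [Matrix.mul_assoc, Matrix.mul_apply]
  simp only [mdot, dotProduct, Matrix.mulVec, Matrix.mul_apply, Matrix.transpose_apply]

theorem lorentz_transpose {Λ : Matrix (Fin (n + 2)) (Fin (n + 2)) ℝ}
    (h : ∀ x y, mdot (Λ *ᵥ x) (Λ *ᵥ y) = mdot x y) : Λᵀ * eta n * Λ = eta n := by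
  ext α β
  have h1 := h (Pi.single α 1) (Pi.single β 1)
  rw [Matrix.mulVec_single_one, Matrix.mulVec_single_one] at h1
  rw [← mdot_eq_transpose]
  change mdot (fun γ => Λ γ α) (fun γ => Λ γ β) = _ at h1
  rw [h1, mdot]
  simp

/-- The left inverse `η Λᵀ η` of `Λ` is also a right inverse. This is the form in which the inverse
metric is preserved. -/
theorem mul_eta_mul_transpose {Λ : Matrix (Fin (n + 2)) (Fin (n + 2)) ℝ}
    (h : Λᵀ * eta n * Λ = eta n) : Λ * eta n * Λᵀ = eta n := by
  have h1 : (eta n * Λᵀ * eta n) * Λ = 1 := by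
    rw [Matrix.mul_assoc, Matrix.mul_assoc, ← Matrix.mul_assoc Λᵀ, h, eta_mul_eta]
  have h2 := mul_eq_one_comm.1 h1
  calc Λ * eta n * Λᵀ = Λ * (eta n * Λᵀ * eta n) * eta n := by
        simp only [Matrix.mul_assoc, eta_mul_eta, Matrix.mul_one]
    _ = eta n := by rw [h2, Matrix.one_mul]

theorem lorentzMatrix_mdot (g : lorentzGroup n) (x y : Spacetime n) :
    mdot (lorentzMatrix n g *ᵥ x) (lorentzMatrix n g *ᵥ y) = mdot x y := g.2 x y

theorem lorentzMatrix_inv_mulVec (g : lorentzGroup n) (x : Spacetime n) :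
    lorentzMatrix n g *ᵥ (lorentzMatrix n g⁻¹ *ᵥ x) = x := by
  rw [Matrix.mulVec_mulVec, ← map_mul, mul_inv_cancel, map_one, Matrix.one_mulVec]

theorem mdot_lorentz_inv {k : Spacetime n} (g : stabilizer k) (x : Spacetime n) :
    mdot k (lorentzMatrix n (g.1)⁻¹ *ᵥ x) = mdot k x := by
  rw [← lorentzMatrix_mdot g.1, lorentzMatrix_inv_mulVec]
  congr 1
  exact g.2

theorem IsAmplitude.pull_stabilizer {p q : ℕ} {k : Spacetime n}
    {T : BiTensor (Fin (n + 2)) (p + 1) (q + 1)} (hT : IsAmplitude k T) (g : stabilizer k) :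
    IsAmplitude k (pull (lorentzMatrix n (g.1)⁻¹) T) := by
  rw [isAmplitude_iff_isMode] at *
  refine hT.pull (mul_eta_mul_transpose (lorentz_transpose (lorentzMatrix_mdot _))) (fun c => ?_)
    (g⁻¹).2
  rw [sum_low_mul k fun α => lorentzMatrix n (g.1)⁻¹ α c, low, ← mdot_lorentz_inv g,
    Matrix.mulVec_single_one]
  rfl

theorem fieldRep_planeWave {a b : ℕ} {k : Spacetime n} (T : BiTensor (Fin (n + 2)) a b)
    (g : stabilizer k) : fieldRep n a b g.1 (planeWave k T) =
      planeWave k (pull (lorentzMatrix n (g.1)⁻¹) T) := by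
  funext x
  change pull (lorentzMatrix n (g.1)⁻¹) (phase k (lorentzMatrix n (g.1)⁻¹ *ᵥ x) • T) = _
  rw [map_smul, phase, mdot_lorentz_inv]
  rfl

/-- The representation of the stabilizer of `k` on the harmonic multiforms of momentum `k`. -/
def modeRep (n p q : ℕ) (k : Spacetime n) :
    Subrepresentation ((fieldRep n (p + 1) (q + 1)).comp (stabilizer k).subtype) where
  toSubmodule := momentumSolutions n p q k
  apply_mem_toSubmodule g K hK := by
    obtain ⟨h1, h2⟩ := mem_momentumSolutions_iff.1 hK
    change fieldRep n (p + 1) (q + 1) g.1 K ∈ _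
    rw [h1, fieldRep_planeWave]
    exact planeWave_mem_iff.2 (h2.pull_stabilizer g)

theorem modeRep_apply_zero {p q : ℕ} {k : Spacetime n} (g : stabilizer k)
    (K : (modeRep n p q k).toSubmodule) :
    ((modeRep n p q k).toRepresentation g K).1 0 = pull (lorentzMatrix n (g.1)⁻¹) (K.1 0) := by
  change pull (lorentzMatrix n (g.1)⁻¹) (K.1 (lorentzMatrix n (g.1)⁻¹ *ᵥ 0)) = _
  rw [Matrix.mulVec_zero]

end

/-! ### Modes in light-cone components -/

/-- The inverse metric in a light-cone frame, with index `0` for `+` and index `1` for `-`. -/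
def lcMetric (n : ℕ) : Matrix (Fin (n + 2)) (Fin (n + 2)) ℝ :=
  Matrix.of fun a b => if a = 0 then (if b = 1 then -1 else 0)
    else if a = 1 then (if b = 0 then -1 else 0) else if a = b then 1 else 0

/-- The transverse indices of a light-cone frame. -/
def tr {n : ℕ} (i : Fin n) : Fin (n + 2) := i.succ.succ

theorem tr_ne_zero {n : ℕ} (i : Fin n) : tr i ≠ 0 := Fin.succ_ne_zero _

theorem tr_ne_one {n : ℕ} (i : Fin n) : tr i ≠ 1 := fun h =>
  Fin.succ_ne_zero i (Fin.succ_injective _ (h.trans Fin.succ_zero_eq_one.symm))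

theorem tr_injective {n : ℕ} : Injective (tr (n := n)) :=
  (Fin.succ_injective _).comp (Fin.succ_injective _)

theorem exists_tr_eq {n : ℕ} {a : Fin (n + 2)} (h0 : a ≠ 0) (h1 : a ≠ 1) : ∃ i, tr i = a := by
  obtain ⟨b, rfl⟩ := Fin.exists_succ_eq.2 h0
  obtain ⟨i, rfl⟩ := Fin.exists_succ_eq.2 (show b ≠ 0 from fun h => h1 (by simp [h]))
  exact ⟨i, rfl⟩

theorem sum_lc {n : ℕ} {A : Type} [AddCommMonoid A] (f : Fin (n + 2) → A) :
    ∑ a, f a = f 0 + (f 1 + ∑ i, f (tr i)) := by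
  rw [Fin.sum_univ_succ, Fin.sum_univ_succ]
  rfl

theorem sum_lcMetric {n : ℕ} (f : Fin (n + 2) → Fin (n + 2) → ℂ) :
    ∑ a, ∑ b, (lcMetric n a b : ℂ) * f a b = -f 0 1 - f 1 0 + ∑ i, f (tr i) (tr i) := by
  have h : ∀ a b, (lcMetric n a b : ℂ) * f a b = if a = 0 then (if b = 1 then -f 0 1 else 0)
    else if a = 1 then (if b = 0 then -f 1 0 else 0) else if a = b then f a a else 0 := by
    intro a b
    simp only [lcMetric, Matrix.of_apply]
    split_ifs <;> simp_all
  simp only [h]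
  rw [sum_lc]
  simp [tr_ne_zero, tr_ne_one, sub_eq_add_neg, add_assoc]

/-- A permutation of the embedded slots extends by the identity to all slots with the same sign. -/
theorem IsAlt.comp_embedding {ι : Type} {m m' : ℕ} {f : (Fin m' → ι) → ℂ} (hf : IsAlt f)
    (e : Fin m ↪ Fin m') (F : (Fin m → ι) → Fin m' → ι) (hF : ∀ μ i, F μ (e i) = μ i)
    (hF' : ∀ μ μ' j, j ∉ Set.range e → F μ j = F μ' j) : IsAlt fun μ => f (F μ) := by
  intro σ μ
  have h : F (μ ∘ σ) = F μ ∘ Equiv.Perm.viaFintypeEmbedding σ e := by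
    funext j
    by_cases hj : j ∈ Set.range e
    · obtain ⟨i, rfl⟩ := hj
      rw [hF, comp_apply, comp_apply, Equiv.Perm.viaFintypeEmbedding_apply_image, hF]
    · rw [comp_apply, Equiv.Perm.viaFintypeEmbedding_apply_notMem_range _ _ hj, hF' _ μ j hj]
  change f (F (μ ∘ σ)) = _
  rw [h, hf, Equiv.Perm.viaFintypeEmbedding_sign]

theorem IsAlt.cons {ι : Type} {m : ℕ} {f : (Fin (m + 1) → ι) → ℂ} (hf : IsAlt f) (y : ι) :
    IsAlt fun μ => f (Fin.cons y μ) :=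
  hf.comp_embedding (Fin.succEmb m) (fun μ => Fin.cons y μ) (fun μ i => by simp) fun μ μ' j hj => by
    have : j = 0 := by
      by_contra h
      exact hj (Fin.exists_succ_eq.2 h)
    subst this
    simp

theorem IsAlt.snoc {ι : Type} {m : ℕ} {f : (Fin (m + 1) → ι) → ℂ} (hf : IsAlt f) (y : ι) :
    IsAlt fun μ => f (Fin.snoc (α := fun _ => ι) μ y) :=
  hf.comp_embedding Fin.castSuccEmb (fun μ => Fin.snoc (α := fun _ => ι) μ y) (fun μ i => by simp)
    fun μ μ' j hj => by
      have : j = Fin.last m := by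
        by_contra h
        exact hj (Fin.exists_castSucc_eq.2 h)
      subst this
      simp

theorem cons_comp_finRotate {ι : Type} {m : ℕ} (y : ι) (μ : Fin m → ι) :
    (Fin.cons y μ : Fin (m + 1) → ι) ∘ finRotate (m + 1) = Fin.snoc (α := fun _ => ι) μ y := by
  funext j
  refine Fin.lastCases ?_ (fun i => ?_) j
  · rw [comp_apply, finRotate_last]
    simp
  · rw [comp_apply, finRotate_apply, Fin.coeSucc_eq_succ]
    simp

theorem isAlt_comp {ι ι' : Type} {m : ℕ} {f : (Fin m → ι) → ℂ} (hf : IsAlt f) (e : ι' → ι) :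
    IsAlt fun μ => f (e ∘ μ) := fun σ μ => hf σ (e ∘ μ)

/-- The transverse components `T_{- i₁…i_p | j₁…j_q -}`. -/
def transverse {n p q : ℕ} (T : BiTensor (Fin (n + 2)) (p + 1) (q + 1)) : BiTensor (Fin n) p q :=
  fun i j => T (Fin.cons 1 (tr ∘ i)) (Fin.snoc (α := fun _ => Fin (n + 2)) (tr ∘ j) 1)

section

variable {n p q : ℕ} {s c : ℝ} {T : BiTensor (Fin (n + 2)) (p + 1) (q + 1)}

/-- The contravariant momentum points along `+` only, so coclosedness singles out one component. -/
theorem IsMode.left_eq_zero_of_plus {a b : ℕ} {T : BiTensor (Fin (n + 2)) a b}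
    (hT : IsMode (lcMetric n) (Pi.single 1 s) (Pi.single 0 c) T)
    (hc : c ≠ 0) {μ : Fin a → Fin (n + 2)} {i : Fin a} (hi : μ i = 0)
    (ν : Fin b → Fin (n + 2)) : T μ ν = 0 := by
  have h := hT.coclosed_left μ ν i
  rw [Finset.sum_eq_single 0 (fun β _ hβ => by simp [hβ]) (by simp), Pi.single_eq_same, ← hi,
    update_eq_self] at h
  exact (mul_eq_zero.1 h).resolve_left (Complex.ofReal_ne_zero.2 hc)

theorem IsMode.right_eq_zero_of_plus {a b : ℕ} {T : BiTensor (Fin (n + 2)) a b}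
    (hT : IsMode (lcMetric n) (Pi.single 1 s) (Pi.single 0 c) T)
    (hc : c ≠ 0) (μ : Fin a → Fin (n + 2)) {ν : Fin b → Fin (n + 2)} {j : Fin b} (hj : ν j = 0) :
    T μ ν = 0 := by
  have h := hT.coclosed_right μ ν j
  rw [Finset.sum_eq_single 0 (fun β _ hβ => by simp [hβ]) (by simp), Pi.single_eq_same, ← hj,
    update_eq_self] at h
  exact (mul_eq_zero.1 h).resolve_left (Complex.ofReal_ne_zero.2 hc)

/-- Closedness with new index `-` expresses `s T μ ν` through the `κ (μ i)`, which are all zero if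
no `μ i` is `-`. -/
theorem IsMode.left_eq_zero_of_not_minus {a b : ℕ} {T : BiTensor (Fin (n + 2)) a b}
    (hT : IsMode (lcMetric n) (Pi.single 1 s) (Pi.single 0 c) T)
    (hs : s ≠ 0) {μ : Fin a → Fin (n + 2)} (hμ : ∀ i, μ i ≠ 1)
    (ν : Fin b → Fin (n + 2)) : T μ ν = 0 := by
  have h := hT.closed_left μ ν 1
  rw [Finset.sum_eq_zero fun i _ => by rw [Pi.single_eq_of_ne (hμ i)]; simp,
    Pi.single_eq_same] at h
  exact (mul_eq_zero.1 h).resolve_left (Complex.ofReal_ne_zero.2 hs)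

theorem IsMode.right_eq_zero_of_not_minus {a b : ℕ} {T : BiTensor (Fin (n + 2)) a b}
    (hT : IsMode (lcMetric n) (Pi.single 1 s) (Pi.single 0 c) T)
    (hs : s ≠ 0) (μ : Fin a → Fin (n + 2)) {ν : Fin b → Fin (n + 2)} (hν : ∀ j, ν j ≠ 1) :
    T μ ν = 0 := by
  have h := hT.closed_right μ ν 1
  rw [Finset.sum_eq_zero fun i _ => by rw [Pi.single_eq_of_ne (hν i)]; simp,
    Pi.single_eq_same] at h
  exact (mul_eq_zero.1 h).resolve_left (Complex.ofReal_ne_zero.2 hs)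

/-- In the exchange relation, moving the `-` out of the first column leaves none there, so that term
drops out. In the trace the two mixed terms of the light-cone metric contain a `+` and vanish,
leaving the Euclidean trace. -/
theorem IsMode.transverse_mem
    (hT : IsMode (lcMetric n) (Pi.single 1 s) (Pi.single 0 c) T) (hs : s ≠ 0) (hc : c ≠ 0) :
    transverse T ∈ youngTraceless (1 : Matrix (Fin n) (Fin n) ℝ) p q := by
  obtain ⟨hY, ht⟩ := mem_youngTraceless_iff.1 hT.young
  have hcomp : ∀ {m : ℕ} (i : Fin m → Fin n) l y, tr ∘ update i l y = update (tr ∘ i) l (tr y) :=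
    fun i l y => comp_update tr i l y
  refine mem_youngTraceless_iff.2 ⟨⟨fun j => ?_, fun i => ?_, fun i j t => ?_⟩, fun i j l t => ?_⟩
  · exact isAlt_comp ((hY.left _).cons 1) tr
  · exact isAlt_comp ((hY.right _).snoc 1) tr
  · have h := hY.exch (Fin.cons 1 (tr ∘ i)) (Fin.snoc (α := fun _ => Fin (n + 2)) (tr ∘ j) 1)
      t.castSucc
    rw [Fin.sum_univ_succ, hT.left_eq_zero_of_not_minus hs
      (μ := update (Fin.cons 1 (tr ∘ i)) 0 _), zero_add] at h
    · rw [transverse, h]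
      refine Finset.sum_congr rfl fun l _ => ?_
      rw [transverse, hcomp, hcomp, Fin.cons_update, Fin.snoc_update]
      simp
    · intro l
      refine Fin.cases ?_ (fun l => ?_) l
      · simpa using tr_ne_one (j t)
      · simpa using tr_ne_one (i l)
  · have h := ht (Fin.cons 1 (tr ∘ i)) (Fin.snoc (α := fun _ => Fin (n + 2)) (tr ∘ j) 1)
      l.succ t.castSucc
    rw [sum_lcMetric fun a b => T (update (Fin.cons 1 (tr ∘ i)) l.succ a)
      (update (Fin.snoc (α := fun _ => Fin (n + 2)) (tr ∘ j) 1) t.castSucc b),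
      hT.left_eq_zero_of_plus hc (i := l.succ) (by simp),
      hT.right_eq_zero_of_plus hc _ (j := t.castSucc) (by simp), neg_zero, sub_zero, zero_add] at h
    rw [← h]
    refine Finset.sum_congr rfl fun α _ => ?_
    rw [Finset.sum_eq_single α]
    · simp only [Matrix.one_apply_eq, Complex.ofReal_one, one_mul, transverse, hcomp,
        Fin.cons_update, Fin.snoc_update]
    · intro β _ hβ
      simp [Matrix.one_apply_ne hβ.symm]
    · simp

theorem IsMode.eq_zero_of_cons_cons
    (hT : IsMode (lcMetric n) (Pi.single 1 s) (Pi.single 0 c) T) (hs : s ≠ 0)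
    (h : ∀ μ ν, T (Fin.cons 1 μ) (Fin.cons 1 ν) = 0) : T = 0 := by
  obtain ⟨hY, -⟩ := mem_youngTraceless_iff.1 hT.young
  funext μ ν
  by_cases hμ : ∀ i, μ i ≠ 1
  · exact hT.left_eq_zero_of_not_minus hs hμ ν
  by_cases hν : ∀ i, ν i ≠ 1
  · exact hT.right_eq_zero_of_not_minus hs μ hν
  push Not at hμ hν
  obtain ⟨i, hi⟩ := hμ
  obtain ⟨j, hj⟩ := hν
  have h1 := (hY.left ν).update_eq μ i 1
  have h2 := fun μ => (hY.right μ).update_eq ν j 1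
  rw [← hi, update_eq_self] at h1
  rw [← hj, update_eq_self] at h2
  rw [h1, h2, hi, hj, h, mul_zero, mul_zero]
  rfl

/-- Antisymmetry brings one `-` to the front of each column. The other indices cannot be `+`, nor a
second `-`, so they are transverse. -/
theorem IsMode.eq_zero_of_transverse_eq_zero
    (hT : IsMode (lcMetric n) (Pi.single 1 s) (Pi.single 0 c) T) (hs : s ≠ 0) (hc : c ≠ 0)
    (h : transverse T = 0) : T = 0 := by
  obtain ⟨hY, -⟩ := mem_youngTraceless_iff.1 hT.young
  refine hT.eq_zero_of_cons_cons hs fun μ ν => ?_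
  by_cases hμ0 : ∃ i, μ i = 0
  · obtain ⟨i, hi⟩ := hμ0
    exact hT.left_eq_zero_of_plus hc (i := i.succ) (by simpa using hi) _
  by_cases hν0 : ∃ i, ν i = 0
  · obtain ⟨i, hi⟩ := hν0
    exact hT.right_eq_zero_of_plus hc _ (j := i.succ) (by simpa using hi)
  by_cases hμ1 : ∃ i, μ i = 1
  · obtain ⟨i, hi⟩ := hμ1
    exact (hY.left _).eq_zero_of_not_injective fun hinj => Fin.succ_ne_zero i (hinj (by simp [hi]))
  by_cases hν1 : ∃ i, ν i = 1
  · obtain ⟨i, hi⟩ := hν1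
    exact (hY.right _).eq_zero_of_not_injective fun hinj => Fin.succ_ne_zero i (hinj (by simp [hi]))
  push Not at hμ0 hν0 hμ1 hν1
  choose i hi using fun l => exists_tr_eq (hμ0 l) (hμ1 l)
  choose j hj using fun l => exists_tr_eq (hν0 l) (hν1 l)
  have h1 := congrFun (congrFun h i) j
  rw [transverse, show tr ∘ i = μ from funext hi, show tr ∘ j = ν from funext hj,
    ← cons_comp_finRotate] at h1
  rwa [← (hY.right (Fin.cons 1 μ)).perm_eq_zero_iff (finRotate (q + 1))]

/-- The entries of `N` that lead to or from the `+` direction never meet a nonzero component of `T`,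
so only the transverse block acts. -/
theorem IsMode.transverse_pull {N : Matrix (Fin (n + 2)) (Fin (n + 2)) ℝ}
    (hT : IsMode (lcMetric n) (Pi.single 1 s) (Pi.single 0 c) T) (hs : s ≠ 0) (hc : c ≠ 0)
    (h1 : N 1 1 = 1) (h2 : ∀ i, N 1 (tr i) = 0) :
    transverse (LightCone.pull N T) = LightCone.pull (N.submatrix tr tr) (transverse T) := by
  obtain ⟨hY, -⟩ := mem_youngTraceless_iff.1 hT.young
  funext i j
  change ∑ α, ∑ β, _ = ∑ i', ∑ j', _
  symm
  -- A summand survives only if its sole `-` sits in the first slot: by `h2` a transverse slot never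
  -- produces one, and `T` needs at least one.
  have hleft : ∀ (α : Fin (p + 1) → Fin (n + 2)),
      α ∉ Set.range (fun i' : Fin p → Fin n => (Fin.cons 1 (tr ∘ i') : Fin (p + 1) → Fin (n + 2))) →
      (∏ l, N (α l) ((Fin.cons 1 (tr ∘ i) : Fin (p + 1) → Fin (n + 2)) l)) = 0 ∨
      ∀ β, T α β = 0 := by
    intro α hα
    by_contra hcon
    push Not at hcon
    obtain ⟨hprod, β, hβ⟩ := hcon
    have hne : ∀ l : Fin p, α l.succ ≠ 1 := fun l hl =>
      hprod (Finset.prod_eq_zero (Finset.mem_univ l.succ) (by simp [hl, h2]))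
    have h0 : α 0 = 1 := by
      by_contra h0
      refine hβ (hT.left_eq_zero_of_not_minus hs (fun l => ?_) β)
      exact Fin.cases h0 hne l
    have hz : ∀ l, α l ≠ 0 := fun l hl => hβ (hT.left_eq_zero_of_plus hc hl β)
    choose i' hi' using fun l => exists_tr_eq (hz (Fin.succ l)) (hne l)
    refine hα ⟨i', ?_⟩
    funext l
    refine Fin.cases ?_ (fun l => ?_) l
    · simp [h0]
    · simp [hi']
  have hright : ∀ (β : Fin (q + 1) → Fin (n + 2)),
      β ∉ Set.range (fun j' : Fin q → Fin n => Fin.snoc (α := fun _ => Fin (n + 2)) (tr ∘ j') 1) →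
      (∏ l, N (β l) (Fin.snoc (α := fun _ => Fin (n + 2)) (tr ∘ j) 1 l)) = 0 ∨
      ∀ α, T α β = 0 := by
    intro β hβ
    by_contra hcon
    push Not at hcon
    obtain ⟨hprod, α, hα⟩ := hcon
    have hne : ∀ l : Fin q, β l.castSucc ≠ 1 := fun l hl =>
      hprod (Finset.prod_eq_zero (Finset.mem_univ l.castSucc) (by simp [hl, h2]))
    have h0 : β (Fin.last q) = 1 := by
      by_contra h0
      refine hα (hT.right_eq_zero_of_not_minus hs α (fun l => ?_))
      exact Fin.lastCases h0 hne l
    have hz : ∀ l, β l ≠ 0 := fun l hl => hα (hT.right_eq_zero_of_plus hc α hl)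
    choose i' hi' using fun l => exists_tr_eq (hz (Fin.castSucc l)) (hne l)
    refine hβ ⟨i', ?_⟩
    funext l
    refine Fin.lastCases ?_ (fun l => ?_) l
    · simp [h0]
    · simp [hi']
  have hinjl : Injective fun i' : Fin p → Fin n =>
      (Fin.cons 1 (tr ∘ i') : Fin (p + 1) → Fin (n + 2)) := fun x y hxy =>
    tr_injective.comp_left (Fin.cons_injective2.right 1 hxy)
  have hinjr : Injective fun j' : Fin q → Fin n =>
      Fin.snoc (α := fun _ => Fin (n + 2)) (tr ∘ j') 1 := fun x y hxy =>
    tr_injective.comp_left (Fin.snoc_injective2.left 1 hxy)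
  refine Fintype.sum_of_injective _ hinjl _ _ (fun α hα => ?_) fun i' => ?_
  · refine Finset.sum_eq_zero fun β _ => ?_
    rcases hleft α hα with h | h
    · rw [h]
      simp
    · rw [h, mul_zero]
  · refine Fintype.sum_of_injective _ hinjr _ _ (fun β hβ => ?_) fun j' => ?_
    · rcases hright β hβ with h | h
      · rw [h]
        simp
      · rw [h, mul_zero]
    · rw [Fin.prod_univ_succ, Fin.prod_univ_castSucc]
      simp [h1, transverse]

/-- Closedness holds because `κ` is a multiple of a factor in each column, so that its wedge with
the column vanishes; coclosedness holds because `v` annihilates every factor. -/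
theorem isMode_detTensor {ι : Type} [Fintype ι] {a b : ℕ} {g : Matrix ι ι ℝ} {u : Fin a → ι → ℂ}
    {w : Fin b → ι → ℂ} {κ v : ι → ℝ} (huw : ∀ r, ∃ s, w r = u s)
    (hg : ∀ r s, ∑ α, ∑ β, (g α β : ℂ) * (u r α * w s β) = 0)
    (hu : ∃ r t, ∀ y, (κ y : ℂ) = t * u r y) (hw : ∃ r t, ∀ y, (κ y : ℂ) = t * w r y)
    (hv : ∀ r, ∑ y, (v y : ℂ) * u r y = 0) : IsMode g κ v (detTensor u w) := by
  have key : ∀ {m : ℕ} {u : Fin m → ι → ℂ}, (∃ r t, ∀ y, (κ y : ℂ) = t * u r y) → ∀ μ y,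
      (κ y : ℂ) * colDet u μ = ∑ i, (κ (μ i) : ℂ) * colDet u (update μ i y) := by
    rintro m u ⟨r, t, h⟩ μ y
    simp only [h]
    rw [mul_right_comm, mul_assoc t, ← sum_colDet_update_mul, Finset.mul_sum]
    exact Finset.sum_congr rfl fun i _ => by ring
  have key' : ∀ {m : ℕ} {u : Fin m → ι → ℂ}, (∀ r, ∑ y, (v y : ℂ) * u r y = 0) → ∀ μ i,
      ∑ y, (v y : ℂ) * colDet u (update μ i y) = 0 := by
    intro m u h μ i
    obtain ⟨d, hd⟩ := exists_colDet_update_eq u μ i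
    simp only [hd, Finset.mul_sum]
    rw [Finset.sum_comm]
    refine Finset.sum_eq_zero fun r _ => ?_
    simp only [mul_left_comm _ (d r), ← Finset.mul_sum, h, mul_zero]
  have hvw : ∀ r, ∑ y, (v y : ℂ) * w r y = 0 := fun r => by
    obtain ⟨s, hs⟩ := huw r
    rw [hs]
    exact hv s
  refine ⟨detTensor_mem huw hg, fun μ ν y => ?_, fun μ ν y => ?_, fun μ ν i => ?_, fun μ ν j => ?_⟩
  · simp only [detTensor]
    rw [← mul_assoc, key hu, Finset.sum_mul]
    simp only [mul_assoc]
  · simp only [detTensor]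
    rw [mul_left_comm, key hw, Finset.mul_sum]
    simp only [mul_left_comm]
  · simp only [detTensor, ← mul_assoc, ← Finset.sum_mul, key' hv, zero_mul]
  · simp only [detTensor, mul_left_comm _ (colDet u μ), ← Finset.mul_sum, key' hvw, mul_zero]

/-- There are nonzero modes. -/
theorem exists_isMode_ne_zero (hqp : q ≤ p) (hn : p + q ≤ n) (s c : ℝ) :
    ∃ T : BiTensor (Fin (n + 2)) (p + 1) (q + 1),
      IsMode (lcMetric n) (Pi.single 1 s) (Pi.single 0 c) T ∧ T ≠ 0 := by
  obtain ⟨r, rfl⟩ := Nat.exists_eq_add_of_le hqp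
  obtain ⟨a, b, f, h₀⟩ := exists_indices hn
  obtain ⟨u, z, μ, ν, huz, hdot, hμ, hν⟩ := exists_null_vectors h₀
  let lift : (Fin n → ℂ) → Fin (n + 2) → ℂ := fun x => Fin.cons 0 (Fin.cons 0 x)
  have hl0 : ∀ x, lift x 0 = 0 := fun x => rfl
  have hl1 : ∀ x, lift x 1 = 0 := fun x => rfl
  have hlt : ∀ x i, lift x (tr i) = x i := fun x i => rfl
  let e : Fin (n + 2) → ℂ := Pi.single 1 1
  have het : ∀ i, e (tr i) = 0 := fun i => Pi.single_eq_of_ne (tr_ne_one i) _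
  -- Each column of the transverse null tensor is wedged with the covector `e` along the momentum.
  -- It is null and orthogonal to the transverse factors, so tracelessness is kept.
  let ext : ∀ {m : ℕ}, (Fin m → Fin n → ℂ) → Fin (m + 1) → Fin (n + 2) → ℂ := fun x =>
    Fin.cons e fun j => lift (x j)
  have hext0 : ∀ {m : ℕ} (x : Fin m → Fin n → ℂ) r, ext x r 0 = 0 := fun x r =>
    Fin.cases (by simp [ext, e]) (fun r => by simp [ext, hl0]) r
  have hdet : ∀ {m : ℕ} {x : Fin m → Fin n → ℂ} {μ : Fin m → Fin n},
      (∀ s t, x s (μ t) = if s = t then 1 else 0) →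
      colDet (ext x) (Fin.cons 1 (tr ∘ μ)) = 1 := by
    intro m x μ h
    refine colDet_eq_one fun s t => ?_
    refine Fin.cases ?_ (fun s => ?_) s <;> refine Fin.cases ?_ (fun t => ?_) t
    · simp [ext, e]
    · simp [ext, het, (Fin.succ_ne_zero _).symm]
    · simp [ext, hl1]
    · simp [ext, hlt, h]
  refine ⟨detTensor (ext u) (ext z), isMode_detTensor (fun j => ?_) (fun j l => ?_)
    ⟨0, s, fun y => ?_⟩ ⟨0, s, fun y => ?_⟩ (fun j => ?_), fun h => ?_⟩
  · refine Fin.cases ⟨0, rfl⟩ (fun j => ?_) j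
    obtain ⟨t, ht⟩ := huz j
    exact ⟨t.succ, by simp [ext, ht]⟩
  · rw [sum_lcMetric fun a b => ext u j a * ext z l b]
    simp only [hext0, zero_mul, mul_zero, neg_zero, sub_zero, zero_add]
    refine Fin.cases ?_ (fun j => ?_) j
    · simp [ext, het]
    · refine Fin.cases ?_ (fun l => ?_) l
      · simp [ext, het]
      · simpa [ext, hlt, dotProduct] using hdot j l
  · by_cases hy : y = 1
    · subst hy
      simp [ext, e]
    · simp [ext, e, hy]
  · by_cases hy : y = 1
    · subst hy
      simp [ext, e]
    · simp [ext, e, hy]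
  · rw [Finset.sum_eq_single 0]
    · rw [hext0, mul_zero]
    · intro y _ hy
      simp [hy]
    · simp
  · have h1 : detTensor (ext u) (ext z) (Fin.cons 1 (tr ∘ μ)) (Fin.cons 1 (tr ∘ ν)) = 1 := by
      rw [detTensor, hdet hμ, hdet hν, mul_one]
    rw [h] at h1
    simp at h1

end

/-! ### Light-cone frames -/

namespace Frame

variable {n : ℕ} (E : Frame n)

/-- The vectors of a frame in the order `e₊, e₋, e₁, …, e_{D-2}`. -/
def vec : Fin (n + 2) → Spacetime n := Fin.cons E.plus (Fin.cons E.minus E.trans)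

theorem vec_zero : E.vec 0 = E.plus := rfl

theorem vec_one : E.vec 1 = E.minus := rfl

theorem vec_tr (i : Fin n) : E.vec (tr i) = E.trans i := rfl

/-- The matrix whose columns are the vectors of the frame. -/
def matrix : Matrix (Fin (n + 2)) (Fin (n + 2)) ℝ := Matrix.of fun α a => E.vec a α

theorem mdot_vec (a b : Fin (n + 2)) : mdot (E.vec a) (E.vec b) = lcMetric n a b := by
  by_cases ha0 : a = 0
  · subst ha0
    by_cases hb0 : b = 0
    · subst hb0
      simp [lcMetric, vec_zero, E.plus_plus]
    by_cases hb1 : b = 1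
    · subst hb1
      simp [lcMetric, vec_zero, vec_one, E.plus_minus]
    obtain ⟨j, rfl⟩ := exists_tr_eq hb0 hb1
    simp [lcMetric, vec_zero, vec_tr, E.plus_trans, tr_ne_one]
  by_cases ha1 : a = 1
  · subst ha1
    by_cases hb0 : b = 0
    · subst hb0
      simp [lcMetric, vec_zero, vec_one, mdot_comm E.minus, E.plus_minus]
    by_cases hb1 : b = 1
    · subst hb1
      simp [lcMetric, vec_one, E.minus_minus]
    obtain ⟨j, rfl⟩ := exists_tr_eq hb0 hb1
    simp [lcMetric, vec_one, vec_tr, E.minus_trans, tr_ne_zero]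
  obtain ⟨i, rfl⟩ := exists_tr_eq ha0 ha1
  by_cases hb0 : b = 0
  · subst hb0
    simp [lcMetric, vec_zero, vec_tr, mdot_comm _ E.plus, E.plus_trans, tr_ne_one, tr_ne_zero]
  by_cases hb1 : b = 1
  · subst hb1
    simp [lcMetric, vec_one, vec_tr, mdot_comm _ E.minus, E.minus_trans, tr_ne_one, tr_ne_zero]
  obtain ⟨j, rfl⟩ := exists_tr_eq hb0 hb1
  simp [lcMetric, vec_tr, E.trans_trans, tr_ne_one, tr_ne_zero, tr_injective.eq_iff]

theorem lcMetric_mul_self : lcMetric n * lcMetric n = 1 := by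
  ext a b
  rw [Matrix.mul_apply, sum_lc]
  simp only [lcMetric, Matrix.of_apply, tr_ne_zero, tr_ne_one, if_false, Matrix.one_apply]
  by_cases ha0 : a = 0
  · subst ha0
    by_cases hb0 : b = 0
    · subst hb0
      simp
    · simp [hb0, Ne.symm hb0]
  by_cases ha1 : a = 1
  · subst ha1
    by_cases hb1 : b = 1
    · subst hb1
      simp
    · simp [hb1, Ne.symm hb1]
  obtain ⟨i, rfl⟩ := exists_tr_eq ha0 ha1
  rw [Finset.sum_eq_single i (fun x _ hx => by simp [tr_injective.eq_iff, hx.symm]) (by simp)]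
  simp [tr_ne_zero, tr_ne_one]

theorem transpose_mul_mul : E.matrixᵀ * eta n * E.matrix = lcMetric n := by
  ext a b
  rw [← mdot_eq_transpose]
  exact E.mdot_vec a b

/-- The inverse of the matrix of the frame. -/
def coframe : Matrix (Fin (n + 2)) (Fin (n + 2)) ℝ := lcMetric n * E.matrixᵀ * eta n

theorem coframe_mul : E.coframe * E.matrix = 1 := by
  rw [coframe, Matrix.mul_assoc, Matrix.mul_assoc, ← Matrix.mul_assoc _ (eta n),
    transpose_mul_mul, lcMetric_mul_self]

theorem mul_coframe : E.matrix * E.coframe = 1 := mul_eq_one_comm.1 E.coframe_mul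

theorem mul_lcMetric_mul : E.matrix * lcMetric n * E.matrixᵀ = eta n := by
  calc E.matrix * lcMetric n * E.matrixᵀ = E.matrix * E.coframe * eta n := by
        simp only [coframe, Matrix.mul_assoc, eta_mul_eta, Matrix.mul_one]
    _ = eta n := by rw [mul_coframe, Matrix.one_mul]

theorem coframe_mul_eta_mul : E.coframe * eta n * E.coframeᵀ = lcMetric n := by
  rw [← E.mul_lcMetric_mul]
  calc E.coframe * (E.matrix * lcMetric n * E.matrixᵀ) * E.coframeᵀ
      = (E.coframe * E.matrix) * lcMetric n * (E.coframe * E.matrix)ᵀ := by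
        simp only [Matrix.transpose_mul, Matrix.mul_assoc]
    _ = lcMetric n := by rw [coframe_mul]; simp

theorem coframe_mul_apply (Λ : Matrix (Fin (n + 2)) (Fin (n + 2)) ℝ) (a b : Fin (n + 2)) :
    (E.coframe * Λ * E.matrix) a b = ∑ d, lcMetric n a d * mdot (E.vec d) (Λ *ᵥ E.vec b) := by
  have h : E.coframe * Λ * E.matrix = lcMetric n * (E.matrixᵀ * eta n * (Λ * E.matrix)) := by
    simp only [coframe, Matrix.mul_assoc]
  rw [h, Matrix.mul_apply]
  refine Finset.sum_congr rfl fun d _ => ?_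
  rw [← mdot_eq_transpose]
  rfl

theorem sum_lcMetric_tr (i : Fin n) (f : Fin (n + 2) → ℝ) :
    ∑ d, lcMetric n (tr i) d * f d = f (tr i) := by
  rw [sum_lc]
  simp [lcMetric, tr_ne_zero, tr_ne_one, tr_injective.eq_iff]

theorem sum_lcMetric_one (f : Fin (n + 2) → ℝ) : ∑ d, lcMetric n 1 d * f d = -f 0 := by
  rw [sum_lc]
  simp [lcMetric, tr_ne_zero]

variable {E} {k : Spacetime n}

theorem Adapted.ne_zero (hE : E.Adapted k) (hk : k ≠ 0) : mdot k E.minus ≠ 0 := by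
  obtain ⟨c, rfl⟩ := hE
  rw [smul_mdot, E.plus_minus]
  intro h
  exact hk (by rw [show c = 0 by linarith, zero_smul])

theorem Adapted.smul_plus (hE : E.Adapted k) : k = (-mdot k E.minus) • E.plus := by
  obtain ⟨c, rfl⟩ := hE
  rw [smul_mdot, E.plus_minus]
  simp

theorem Adapted.matrix_mulVec (hE : E.Adapted k) :
    E.matrix *ᵥ Pi.single 0 (-mdot k E.minus) = k := by
  conv_rhs => rw [hE.smul_plus]
  rw [Matrix.mulVec_single]
  funext α
  simp [matrix, vec_zero, mul_comm]

theorem Adapted.mdot_vec (hE : E.Adapted k) (a : Fin (n + 2)) :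
    mdot k (E.vec a) = (Pi.single 1 (mdot k E.minus) : Fin (n + 2) → ℝ) a := by
  by_cases ha1 : a = 1
  · subst ha1
    simp [vec_one]
  rw [Pi.single_eq_of_ne ha1]
  obtain ⟨c, rfl⟩ := hE
  rw [smul_mdot]
  by_cases ha0 : a = 0
  · subst ha0
    rw [vec_zero, E.plus_plus, mul_zero]
  obtain ⟨i, rfl⟩ := exists_tr_eq ha0 ha1
  rw [vec_tr, E.plus_trans, mul_zero]

theorem Adapted.isMode_pull (hE : E.Adapted k) {p q : ℕ}
    {T : BiTensor (Fin (n + 2)) (p + 1) (q + 1)} (hT : IsAmplitude k T) :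
    IsMode (lcMetric n) (Pi.single 1 (mdot k E.minus)) (Pi.single 0 (-mdot k E.minus))
      (pull E.matrix T) := by
  refine (isAmplitude_iff_isMode.1 hT).pull E.mul_lcMetric_mul (fun a => ?_) hE.matrix_mulVec
  rw [← hE.mdot_vec, sum_low_mul k fun α => E.matrix α a]
  rfl

theorem Adapted.isAmplitude_pull (hE : E.Adapted k) {p q : ℕ}
    {T : BiTensor (Fin (n + 2)) (p + 1) (q + 1)}
    (hT : IsMode (lcMetric n) (Pi.single 1 (mdot k E.minus)) (Pi.single 0 (-mdot k E.minus)) T) :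
    IsAmplitude k (pull E.coframe T) := by
  rw [isAmplitude_iff_isMode]
  refine hT.pull E.coframe_mul_eta_mul (fun c => ?_) ?_
  · calc low k c = ∑ β, low k β * (E.matrix * E.coframe) β c := by
          rw [mul_coframe]
          simp [Matrix.one_apply]
      _ = ∑ a, (∑ β, low k β * E.matrix β a) * E.coframe a c := by
          simp only [Matrix.mul_apply, Finset.mul_sum, Finset.sum_mul, ← mul_assoc]
          exact Finset.sum_comm
      _ = _ := by
          refine Finset.sum_congr rfl fun a _ => ?_
          rw [← hE.mdot_vec, sum_low_mul k fun α => E.matrix α a]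
          rfl
  · conv_lhs => rw [← hE.matrix_mulVec]
    rw [Matrix.mulVec_mulVec, coframe_mul, Matrix.one_mulVec]

theorem components_eq {p q : ℕ} (T : BiTensor (Fin (n + 2)) (p + 1) (q + 1)) :
    E.components k T = (((p + 1) * (q + 1) / mdot k E.minus ^ 2 : ℝ) : ℂ) •
      transverse (pull E.matrix T) := by
  funext i j
  have h1 : (Fin.cons E.minus fun s => E.trans (i s) : Fin (p + 1) → Spacetime n) =
      fun l α => E.matrix α ((Fin.cons 1 (tr ∘ i) : Fin (p + 1) → Fin (n + 2)) l) := by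
    funext l
    refine Fin.cases ?_ (fun l => ?_) l <;> rfl
  have h2 : (Fin.snoc (α := fun _ => Spacetime n) (fun s => E.trans (j s)) E.minus) =
      fun l α => E.matrix α (Fin.snoc (α := fun _ => Fin (n + 2)) (tr ∘ j) 1 l) := by
    funext l
    refine Fin.lastCases ?_ (fun l => ?_) l
    · simp only [Fin.snoc_last]
      rfl
    · simp only [Fin.snoc_castSucc]
      rfl
  rw [components, h1, h2]
  rfl

end Frame

/-! ### The stabilizer in a light-cone frame -/

namespace Frame

variable {n : ℕ} {E : Frame n} {k : Spacetime n}

theorem Adapted.mulVec_plus (hE : E.Adapted k) (hk : k ≠ 0) (g : stabilizer k) :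
    lorentzMatrix n g.1 *ᵥ E.plus = E.plus := by
  obtain ⟨c, rfl⟩ := hE
  have hc : c ≠ 0 := fun h => hk (by rw [h, zero_smul])
  have h : lorentzMatrix n g.1 *ᵥ (c • E.plus) = c • E.plus := g.2
  rw [Matrix.mulVec_smul] at h
  exact smul_right_injective _ hc h

variable (E) in
/-- A Lorentz transformation in the basis given by the frame. -/
def conj (g : lorentzGroup n) : Matrix (Fin (n + 2)) (Fin (n + 2)) ℝ :=
  E.coframe * lorentzMatrix n g * E.matrix

theorem conj_mul (g h : lorentzGroup n) : E.conj (g * h) = E.conj g * E.conj h := by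
  calc E.conj (g * h) = E.coframe * lorentzMatrix n g * (1 * (lorentzMatrix n h * E.matrix)) := by
        rw [conj, map_mul, Matrix.one_mul]
        simp only [Matrix.mul_assoc]
    _ = E.conj g * E.conj h := by
        rw [← E.mul_coframe]
        simp only [conj, Matrix.mul_assoc]

theorem matrix_mul_conj (g : lorentzGroup n) :
    E.matrix * E.conj g = lorentzMatrix n g * E.matrix := by
  rw [conj, Matrix.mul_assoc E.coframe, ← Matrix.mul_assoc E.matrix, mul_coframe, Matrix.one_mul]

theorem conj_tr (g : lorentzGroup n) (i : Fin n) (b : Fin (n + 2)) :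
    E.conj g (tr i) b = mdot (E.trans i) (lorentzMatrix n g *ᵥ E.vec b) := by
  rw [conj, coframe_mul_apply, sum_lcMetric_tr, vec_tr]

theorem conj_one (g : lorentzGroup n) (b : Fin (n + 2)) :
    E.conj g 1 b = -mdot E.plus (lorentzMatrix n g *ᵥ E.vec b) := by
  rw [conj, coframe_mul_apply, sum_lcMetric_one, vec_zero]

theorem Adapted.conj_one_one (hE : E.Adapted k) (hk : k ≠ 0) (g : stabilizer k) :
    E.conj g.1 1 1 = 1 := by
  rw [conj_one, ← hE.mulVec_plus hk g, lorentzMatrix_mdot, vec_one, E.plus_minus, neg_neg]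

theorem Adapted.conj_one_tr (hE : E.Adapted k) (hk : k ≠ 0) (g : stabilizer k) (i : Fin n) :
    E.conj g.1 1 (tr i) = 0 := by
  rw [conj_one, ← hE.mulVec_plus hk g, lorentzMatrix_mdot, vec_tr, E.plus_trans, neg_zero]

theorem Adapted.conj_tr_zero (hE : E.Adapted k) (hk : k ≠ 0) (g : stabilizer k) (i : Fin n) :
    E.conj g.1 (tr i) 0 = 0 := by
  rw [conj_tr, vec_zero, hE.mulVec_plus hk g, mdot_comm, E.plus_trans]

/-- In the product of the two matrices the intermediate index `+` is excluded by the first factor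
and `-` by the second, so the transverse block is multiplicative. -/
theorem Adapted.submatrix_mul (hE : E.Adapted k) (hk : k ≠ 0) (g h : stabilizer k) :
    (E.conj (g * h).1).submatrix tr tr =
      (E.conj g.1).submatrix tr tr * (E.conj h.1).submatrix tr tr := by
  ext i j
  rw [Subgroup.coe_mul, conj_mul, Matrix.submatrix_apply, Matrix.mul_apply, sum_lc,
    hE.conj_tr_zero hk, hE.conj_one_tr hk, zero_mul, mul_zero, zero_add, zero_add]
  rfl

theorem submatrix_one : (E.conj 1).submatrix tr tr = (1 : Matrix (Fin n) (Fin n) ℝ) := by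
  rw [conj, map_one, Matrix.mul_one, coframe_mul, Matrix.submatrix_one _ tr_injective]

theorem submatrix_transpose (g : lorentzGroup n) :
    ((E.conj g).submatrix tr tr)ᵀ = (E.conj g⁻¹).submatrix tr tr := by
  ext i j
  simp only [Matrix.transpose_apply, Matrix.submatrix_apply, conj_tr, vec_tr]
  rw [← lorentzMatrix_mdot g (E.trans i), lorentzMatrix_inv_mulVec, mdot_comm]

/-- The homomorphism from the stabilizer of `k` to `O(D-2)`. -/
def Adapted.toOrthogonal (hE : E.Adapted k) (hk : k ≠ 0) :
    stabilizer k →* Matrix.orthogonalGroup (Fin n) ℝ :=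
  MonoidHom.mk' (fun g => ⟨(E.conj g.1).submatrix tr tr, by
    rw [Matrix.mem_orthogonalGroup_iff, submatrix_transpose]
    change _ * (E.conj (g⁻¹).1).submatrix tr tr = 1
    rw [← hE.submatrix_mul hk, mul_inv_cancel]
    exact submatrix_one⟩) fun g h => Subtype.ext (hE.submatrix_mul hk g h)

theorem Adapted.toOrthogonal_apply (hE : E.Adapted k) (hk : k ≠ 0) (g : stabilizer k)
    (i j : Fin n) : (hE.toOrthogonal hk g).1 i j =
      mdot (E.trans i) (lorentzMatrix n g.1 *ᵥ E.trans j) :=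
  conj_tr g.1 i (tr j)

theorem Adapted.continuous_toOrthogonal (hE : E.Adapted k) (hk : k ≠ 0) :
    Continuous (hE.toOrthogonal hk) := by
  refine Continuous.subtype_mk ?_ _
  have h : Continuous fun g : stabilizer k => lorentzMatrix n g.1 :=
    Units.continuous_val.comp (continuous_subtype_val.comp continuous_subtype_val)
  refine Continuous.matrix_submatrix ?_ _ _
  exact (continuous_const.matrix_mul h).matrix_mul continuous_const

variable (E) in
/-- The matrix of transverse vectors. -/
def transMatrix : Matrix (Fin (n + 2)) (Fin n) ℝ := Matrix.of fun α i => E.trans i α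

variable (E) in
/-- The map that acts as `A` on the transverse space and fixes `e₊` and `e₋`. -/
def rotation (A : Matrix (Fin n) (Fin n) ℝ) : Matrix (Fin (n + 2)) (Fin (n + 2)) ℝ :=
  1 + E.transMatrix * (A - 1) * (E.transMatrixᵀ * eta n)

theorem transMatrix_transpose_mul : E.transMatrixᵀ * eta n * E.transMatrix = 1 := by
  ext i j
  rw [← mdot_eq_transpose, Matrix.one_apply]
  exact E.trans_trans i j

theorem rotation_mul (A B : Matrix (Fin n) (Fin n) ℝ) :
    E.rotation A * E.rotation B = E.rotation (A * B) := by
  have h := E.transMatrix_transpose_mul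
  set X := E.transMatrix
  set Y := E.transMatrixᵀ * eta n
  have h2 : X * (A - 1) * Y * (X * (B - 1) * Y) = X * ((A - 1) * (B - 1)) * Y := by
    calc X * (A - 1) * Y * (X * (B - 1) * Y) = X * (A - 1) * (Y * X) * (B - 1) * Y := by
          simp only [Matrix.mul_assoc]
      _ = X * ((A - 1) * (B - 1)) * Y := by
          rw [h, Matrix.mul_one]
          simp only [Matrix.mul_assoc]
  have h3 : A * B - 1 = (A - 1) + (B - 1) + (A - 1) * (B - 1) := by noncomm_ring
  change (1 + X * (A - 1) * Y) * (1 + X * (B - 1) * Y) = 1 + X * (A * B - 1) * Y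
  rw [h3]
  simp only [Matrix.mul_add, Matrix.add_mul, Matrix.one_mul, Matrix.mul_one, h2]
  abel

theorem rotation_one : E.rotation 1 = 1 := by
  simp [rotation]

theorem eta_transpose : (eta n)ᵀ = eta n := Matrix.diagonal_transpose _

theorem rotation_transpose (A : Matrix (Fin n) (Fin n) ℝ) :
    (E.rotation A)ᵀ * eta n = eta n * E.rotation Aᵀ := by
  simp only [rotation, Matrix.transpose_add, Matrix.transpose_one, Matrix.transpose_mul,
    Matrix.transpose_sub, eta_transpose, Matrix.transpose_transpose, Matrix.add_mul, Matrix.mul_add,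
    Matrix.one_mul, Matrix.mul_one, Matrix.mul_assoc]

theorem mdot_rotation {A : Matrix (Fin n) (Fin n) ℝ} (hA : A ∈ Matrix.orthogonalGroup (Fin n) ℝ)
    (x y : Spacetime n) : mdot (E.rotation A *ᵥ x) (E.rotation A *ᵥ y) = mdot x y := by
  have h : (E.rotation A)ᵀ * (eta n * E.rotation A) = eta n := by
    rw [← Matrix.mul_assoc, rotation_transpose, Matrix.mul_assoc, rotation_mul,
      (Matrix.mem_orthogonalGroup_iff' _ _).1 hA, rotation_one, Matrix.mul_one]
  rw [mdot, mdot, ← Matrix.vecMul_transpose, ← Matrix.dotProduct_mulVec, Matrix.mulVec_mulVec,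
    Matrix.mulVec_mulVec, Matrix.mul_assoc, h]

theorem rotation_mulVec (A : Matrix (Fin n) (Fin n) ℝ) {x : Spacetime n}
    (hx : ∀ i, mdot (E.trans i) x = 0) : E.rotation A *ᵥ x = x := by
  have h : (E.transMatrixᵀ * eta n) *ᵥ x = 0 := by
    rw [← Matrix.mulVec_mulVec]
    funext i
    exact hx i
  rw [rotation, Matrix.add_mulVec, Matrix.one_mulVec, ← Matrix.mulVec_mulVec, h, Matrix.mulVec_zero,
    add_zero]

variable (E) in
/-- `rotation` as a Lorentz transformation. -/
def lorentzRotation (A : Matrix.orthogonalGroup (Fin n) ℝ) : lorentzGroup n :=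
  ⟨⟨E.rotation A.1, E.rotation A.1ᵀ,
    by rw [rotation_mul, (Matrix.mem_orthogonalGroup_iff _ _).1 A.2, rotation_one],
    by rw [rotation_mul, (Matrix.mem_orthogonalGroup_iff' _ _).1 A.2, rotation_one]⟩,
    mdot_rotation A.2⟩

/-- The preimage rotates the transverse space by `A` and fixes both null directions, hence also `k`.
-/
theorem Adapted.exists_toOrthogonal_eq (hE : E.Adapted k) (hk : k ≠ 0)
    (A : Matrix.orthogonalGroup (Fin n) ℝ) :
    ∃ g, hE.toOrthogonal hk g = A ∧ lorentzMatrix n g.1 *ᵥ E.minus = E.minus := by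
  have hplus : E.rotation A.1 *ᵥ k = k := by
    obtain ⟨c, hc⟩ := hE
    refine rotation_mulVec _ fun i => ?_
    rw [hc, mdot_smul, mdot_comm, E.plus_trans, mul_zero]
  refine ⟨⟨E.lorentzRotation A, hplus⟩, ?_, ?_⟩
  · refine Subtype.ext (Matrix.ext fun i j => ?_)
    rw [hE.toOrthogonal_apply hk]
    change mdot (E.trans i) (E.rotation A.1 *ᵥ E.trans j) = A.1 i j
    have h : E.transMatrixᵀ * eta n * (E.rotation A.1 * E.transMatrix) = A.1 := by
      have h1 := E.transMatrix_transpose_mul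
      rw [rotation, Matrix.add_mul, Matrix.one_mul, Matrix.mul_assoc _ _ E.transMatrix, h1,
        Matrix.mul_one, Matrix.mul_add, h1, ← Matrix.mul_assoc, h1, Matrix.one_mul]
      abel
    have h2 := mdot_eq_transpose E.transMatrix (E.rotation A.1 * E.transMatrix) i j
    rw [h] at h2
    exact h2
  · refine rotation_mulVec _ fun i => ?_
    rw [mdot_comm, E.minus_trans]

theorem Adapted.components_pull (hE : E.Adapted k) (hk : k ≠ 0) {p q : ℕ}
    {T : BiTensor (Fin (n + 2)) (p + 1) (q + 1)} (hT : IsAmplitude k T) (g : stabilizer k) :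
    E.components k (pull (lorentzMatrix n (g.1)⁻¹) T) =
      orthogonalRep n p q (hE.toOrthogonal hk g) (E.components k T) := by
  change _ = pull ((hE.toOrthogonal hk g)⁻¹).1 _
  rw [components_eq, components_eq, map_smul, ← pull_mul, ← matrix_mul_conj, pull_mul,
    ← map_inv]
  congr 1
  have hs := hE.ne_zero hk
  exact (hE.isMode_pull hT).transverse_pull hs (neg_ne_zero.2 hs) (hE.conj_one_one hk g⁻¹)
    (hE.conj_one_tr hk g⁻¹)

theorem Adapted.components_mem (hE : E.Adapted k) (hk : k ≠ 0) {p q : ℕ}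
    {T : BiTensor (Fin (n + 2)) (p + 1) (q + 1)} (hT : IsAmplitude k T) :
    E.components k T ∈ youngTraceless (1 : Matrix (Fin n) (Fin n) ℝ) p q := by
  have hs := hE.ne_zero hk
  rw [components_eq]
  exact Submodule.smul_mem _ _ ((hE.isMode_pull hT).transverse_mem hs (neg_ne_zero.2 hs))

theorem Adapted.eq_zero_of_components_eq_zero (hE : E.Adapted k) (hk : k ≠ 0) {p q : ℕ}
    {T : BiTensor (Fin (n + 2)) (p + 1) (q + 1)} (hT : IsAmplitude k T)
    (h : E.components k T = 0) : T = 0 := by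
  have hs := hE.ne_zero hk
  rw [components_eq, smul_eq_zero, or_iff_right] at h
  · have h1 := (hE.isMode_pull hT).eq_zero_of_transverse_eq_zero hs (neg_ne_zero.2 hs) h
    rw [← pull_one T, ← E.mul_coframe, pull_mul, h1, map_zero]
  · refine Complex.ofReal_ne_zero.2 (div_ne_zero ?_ (pow_ne_zero _ hs))
    positivity

theorem Adapted.exists_isAmplitude_ne_zero (hE : E.Adapted k) {p q : ℕ} (hqp : q ≤ p)
    (hn : p + q ≤ n) :
    ∃ T : BiTensor (Fin (n + 2)) (p + 1) (q + 1), IsAmplitude k T ∧ T ≠ 0 := by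
  obtain ⟨T, hT, hne⟩ := exists_isMode_ne_zero (p := p) (q := q) hqp hn (mdot k E.minus)
    (-mdot k E.minus)
  refine ⟨_, hE.isAmplitude_pull hT, fun h => hne ?_⟩
  rw [← pull_one T, ← E.coframe_mul, pull_mul, h, map_zero]

/-- The map `K ↦ φ` from the modes of momentum `k` to the tensors of type `[p,q]`. -/
def Adapted.toYoung (hE : E.Adapted k) (hk : k ≠ 0) (p q : ℕ) :
    (modeRep n p q k).toSubmodule →ₗ[ℂ] (youngRep n p q).toSubmodule where
  toFun K := ⟨E.components k (K.1 0),
    hE.components_mem hk (mem_momentumSolutions_iff.1 K.2).2⟩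
  map_add' K L := by
    refine Subtype.ext ?_
    change E.components k (K.1 0 + L.1 0) = _
    rw [components_eq, map_add]
    change _ = E.components k (K.1 0) + E.components k (L.1 0)
    rw [components_eq, components_eq, ← smul_add]
    rfl
  map_smul' c K := by
    refine Subtype.ext ?_
    change E.components k (c • K.1 0) = c • E.components k (K.1 0)
    rw [components_eq, components_eq, map_smul, smul_comm]
    rfl

theorem Adapted.toYoung_apply (hE : E.Adapted k) (hk : k ≠ 0) {p q : ℕ}
    (K : (modeRep n p q k).toSubmodule) :
    (hE.toYoung hk p q K).1 = E.components k (K.1 0) := rfl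

theorem Adapted.toYoung_intertwines (hE : E.Adapted k) (hk : k ≠ 0) {p q : ℕ} (g : stabilizer k)
    (K : (modeRep n p q k).toSubmodule) :
    hE.toYoung hk p q ((modeRep n p q k).toRepresentation g K) =
      (youngRep n p q).toRepresentation (hE.toOrthogonal hk g) (hE.toYoung hk p q K) := by
  refine Subtype.ext ?_
  rw [toYoung_apply, modeRep_apply_zero]
  exact hE.components_pull hk (mem_momentumSolutions_iff.1 K.2).2 g

theorem Adapted.toYoung_injective (hE : E.Adapted k) (hk : k ≠ 0) (p q : ℕ) :
    Injective (hE.toYoung hk p q) := by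
  rw [← LinearMap.ker_eq_bot, Submodule.eq_bot_iff]
  intro K hK
  obtain ⟨h1, h2⟩ := mem_momentumSolutions_iff.1 K.2
  have h3 := hE.eq_zero_of_components_eq_zero hk h2 (congrArg Subtype.val (LinearMap.mem_ker.1 hK))
  refine Subtype.ext (h1.trans ?_)
  rw [h3]
  funext x
  exact smul_zero _

/-- The range is invariant because every element of `O(D-2)` comes from the stabilizer, and it is
nonzero because a nonzero mode exists; irreducibility of the target does the rest. -/
theorem Adapted.toYoung_surjective (hE : E.Adapted k) (hk : k ≠ 0) {p q : ℕ} (hqp : q ≤ p)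
    (hn : p + q ≤ n) : Surjective (hE.toYoung hk p q) := by
  rw [← LinearMap.range_eq_top]
  refine (eq_bot_or_eq_top_of_isIrreducible (youngRep_isIrreducible hqp hn) _ ?_).resolve_left ?_
  · rintro A _ ⟨K, rfl⟩
    obtain ⟨g, rfl, -⟩ := hE.exists_toOrthogonal_eq hk A
    exact ⟨_, hE.toYoung_intertwines hk g K⟩
  · rw [LinearMap.range_eq_bot]
    intro h
    obtain ⟨T, hT, hne⟩ := hE.exists_isAmplitude_ne_zero hqp hn
    have h1 : (⟨planeWave k T, planeWave_mem_iff.2 hT⟩ : (modeRep n p q k).toSubmodule) = 0 :=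
      hE.toYoung_injective hk p q (by rw [h]; rfl)
    have h2 := congrFun (congrArg Subtype.val h1) 0
    change phase k 0 • T = 0 at h2
    rw [phase_zero, one_smul] at h2
    exact hne h2

/-- The isomorphism of the modes of momentum `k` with the tensors of type `[p,q]`. -/
def Adapted.equivYoung (hE : E.Adapted k) (hk : k ≠ 0) {p q : ℕ} (hqp : q ≤ p) (hn : p + q ≤ n) :
    (modeRep n p q k).toSubmodule ≃ₗ[ℂ] (youngRep n p q).toSubmodule :=
  LinearEquiv.ofBijective (hE.toYoung hk p q)
    ⟨hE.toYoung_injective hk p q, hE.toYoung_surjective hk hqp hn⟩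

end Frame

/-! ### Existence of adapted frames -/

theorem mdot_cons {n : ℕ} (s t : ℝ) (x y : EuclideanSpace ℝ (Fin (n + 1))) :
    mdot (Fin.cons s x : Spacetime n) (Fin.cons t y : Spacetime n) = -(s * t) + inner ℝ x y := by
  rw [mdot_eq_sum, Fin.sum_univ_succ, PiLp.inner_apply]
  simp [Fin.succ_ne_zero, mul_comm]

/-- A nonzero null vector has the form `k₀ (1, u)` with `u` a unit vector. The frame is `e_± = (1,
±u)/√2`, together with the remaining vectors of an orthonormal basis of space that starts with `u`.
-/
theorem exists_adapted {n : ℕ} {k : Spacetime n} (hk : k ≠ 0) (hkk : mdot k k = 0) :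
    ∃ E : Frame n, E.Adapted k := by
  let x : EuclideanSpace ℝ (Fin (n + 1)) := WithLp.toLp 2 (Fin.tail k)
  have hkx : k = (Fin.cons (k 0) x : Spacetime n) := (Fin.cons_self_tail k).symm
  have hxx : inner ℝ x x = k 0 * k 0 := by
    rw [hkx, mdot_cons] at hkk
    linarith
  have hk0 : k 0 ≠ 0 := by
    intro h
    rw [h, mul_zero, inner_self_eq_zero] at hxx
    refine hk ?_
    rw [hkx, hxx, h]
    funext α
    exact Fin.cases rfl (fun _ => rfl) α
  let u : EuclideanSpace ℝ (Fin (n + 1)) := (k 0)⁻¹ • x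
  have huu : inner ℝ u u = (1 : ℝ) := by
    rw [inner_smul_left, inner_smul_right, hxx]
    simp only [conj_trivial]
    field_simp
  obtain ⟨b, hb⟩ := Orthonormal.exists_orthonormalBasis_extension_of_card_eq (𝕜 := ℝ)
    (ι := Fin (n + 1)) (by simp) (v := fun _ => u) (s := {0}) (by
      refine ⟨fun i => ?_, fun i j hij => absurd (Subsingleton.elim i j) hij⟩
      have h1 : ‖u‖ ^ 2 = 1 := by rw [← real_inner_self_eq_norm_sq, huu]
      change ‖u‖ = 1
      exact (pow_eq_one_iff_of_nonneg (norm_nonneg u) two_ne_zero).1 h1)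
  have hb0 : b 0 = u := hb 0 rfl
  have hbi : ∀ i j, inner ℝ (b i) (b j) = if i = j then (1 : ℝ) else 0 :=
    fun i j => b.inner_eq_ite i j
  have hub : ∀ i : Fin n, inner ℝ u (b i.succ) = (0 : ℝ) := fun i => by
    rw [← hb0, hbi, if_neg (Fin.succ_ne_zero i).symm]
  let c : ℝ := (√2)⁻¹
  have hc : c * c = 1 / 2 := by
    rw [← mul_inv, Real.mul_self_sqrt (by norm_num)]
    norm_num
  have hc0 : c ≠ 0 := by
    intro h
    rw [h] at hc
    norm_num at hc
  refine ⟨{ plus := Fin.cons c (c • u : EuclideanSpace ℝ (Fin (n + 1)))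
            minus := Fin.cons c (-(c • u) : EuclideanSpace ℝ (Fin (n + 1)))
            trans := fun i => Fin.cons 0 (b i.succ)
            plus_plus := ?_
            minus_minus := ?_
            plus_minus := ?_
            plus_trans := fun i => ?_
            minus_trans := fun i => ?_
            trans_trans := fun i j => ?_ }, k 0 * c⁻¹, ?_⟩
  · rw [mdot_cons, inner_smul_left, inner_smul_right, huu, conj_trivial]
    ring
  · rw [mdot_cons, inner_neg_neg, inner_smul_left, inner_smul_right, huu, conj_trivial]
    ring
  · rw [mdot_cons, inner_neg_right, inner_smul_left, inner_smul_right, huu, conj_trivial]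
    linarith
  · rw [mdot_cons, inner_smul_left, hub]
    simp
  · rw [mdot_cons, inner_neg_left, inner_smul_left, hub]
    simp
  · rw [mdot_cons, hbi]
    simp
  · funext α
    refine Fin.cases ?_ (fun i => ?_) α
    · simp [hc0]
    · change k i.succ = k 0 * c⁻¹ * (c * ((k 0)⁻¹ * k i.succ))
      field_simp

section
variable {E : Type} [NormedAddCommGroup E] [NormedSpace ℝ E] [FiniteDimensional ℝ E]

/-! ### The Fourier transform of solutions of the wave equation -/

theorem exists_norm_iteratedFDeriv_one_sub_bump_le (χ : ContDiffBump (0 : E)) (i : ℕ) :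
    ∃ C, 0 ≤ C ∧ ∀ x, ‖iteratedFDeriv ℝ i (fun x => (1 : ℂ) - (χ x : ℂ)) x‖ ≤ C := by
  have hs : ContDiff ℝ ∞ fun x => (χ x : ℂ) := Complex.ofRealCLM.contDiff.comp χ.contDiff
  have hc : HasCompactSupport fun x => (χ x : ℂ) :=
    χ.hasCompactSupport.comp_left (g := Complex.ofReal) rfl
  let f : 𝓢(E, ℂ) := hc.toSchwartzMap hs
  refine ⟨1 + SchwartzMap.seminorm ℝ 0 i f, by positivity, fun x => ?_⟩
  have h1 : iteratedFDeriv ℝ i (fun x => (1 : ℂ) - (χ x : ℂ)) x =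
      iteratedFDeriv ℝ i (fun _ : E => (1 : ℂ)) x - iteratedFDeriv ℝ i f x :=
    iteratedFDeriv_sub_apply (contDiff_const.contDiffAt) ((hs.of_le (mod_cast le_top)).contDiffAt)
  rw [h1]
  refine (norm_sub_le _ _).trans (add_le_add ?_ (f.norm_iteratedFDeriv_le_seminorm ℝ i x))
  rcases eq_or_ne i 0 with rfl | hi
  · simp
  · simp [iteratedFDeriv_const_of_ne hi]

/-- Smooth functions with compact support are dense in the Schwartz space. -/
theorem exists_tendsto_hasCompactSupport (g : 𝓢(E, ℂ)) :
    ∃ u : ℕ → 𝓢(E, ℂ), (∀ m, HasCompactSupport (u m)) ∧ (∀ m, tsupport (u m) ⊆ tsupport g) ∧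
      Filter.Tendsto u Filter.atTop (nhds g) := by
  let χ : ContDiffBump (0 : E) := ⟨1, 2, one_pos, one_lt_two⟩
  have hs : ContDiff ℝ ∞ fun x => (χ x : ℂ) := Complex.ofRealCLM.contDiff.comp χ.contDiff
  let r : ℕ → ℝ := fun m => ((m : ℝ) + 1)⁻¹
  have hr : ∀ m, 0 < r m := fun m => by positivity
  have hr1 : ∀ m, r m ≤ 1 := fun m => inv_le_one_of_one_le₀ (by simp)
  have hd : ∀ m, ContDiff ℝ ∞ fun x => (χ (r m • x) : ℂ) * g x := fun m =>
    (hs.comp (contDiff_const_smul (r m))).mul (g.smooth ⊤)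
  have hcs : ∀ m, HasCompactSupport fun x => (χ (r m • x) : ℂ) * g x := fun m => by
    have h := (χ.hasCompactSupport.comp_left (g := Complex.ofReal) rfl).comp_homeomorph
      (Homeomorph.smulOfNeZero (r m) (hr m).ne')
    exact h.mul_right
  refine ⟨fun m => (hcs m).toSchwartzMap (hd m), hcs, fun m => tsupport_mul_subset_right, ?_⟩
  rw [(schwartz_withSeminorms ℝ E ℂ).tendsto_nhds]
  rintro ⟨k, n⟩ ε hε
  choose C hC0 hC using exists_norm_iteratedFDeriv_one_sub_bump_le χ
  let M := ∑ i ∈ Finset.range (n + 1),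
    (n.choose i : ℝ) * C i * SchwartzMap.seminorm ℝ (k + 1) (n - i) g
  have hM0 : 0 ≤ M := Finset.sum_nonneg fun i _ => by have := hC0 i; positivity
  have key : ∀ m, SchwartzMap.seminorm ℝ k n ((hcs m).toSchwartzMap (hd m) - g) ≤ r m * M := by
    intro m
    refine SchwartzMap.seminorm_le_bound ℝ k n _ (mul_nonneg (hr m).le hM0) fun x => ?_
    have hneg : iteratedFDeriv ℝ n ((hcs m).toSchwartzMap (hd m) - g) x =
        -iteratedFDeriv ℝ n (fun x => ((1 : ℂ) - (χ (r m • x) : ℂ)) * g x) x := by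
      rw [← iteratedFDeriv_neg_apply]
      congr 1
      funext y
      change (χ (r m • y) : ℂ) * g y - g y = -((1 - (χ (r m • y) : ℂ)) * g y)
      ring
    rw [hneg, norm_neg]
    rcases lt_or_ge ‖x‖ ((r m)⁻¹) with hx | hx
    -- Here the cutoff is identically `1` near `x`, so the error vanishes together with its
    -- derivatives.
    · have h0 : (fun x => ((1 : ℂ) - (χ (r m • x) : ℂ)) * g x) =ᶠ[nhds x] fun _ => 0 := by
        filter_upwards [continuous_norm.continuousAt.eventually_lt continuousAt_const hx]
          with y hy
        have : χ (r m • y) = 1 := χ.one_of_mem_closedBall (by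
          rw [mem_closedBall_zero_iff, norm_smul, Real.norm_of_nonneg (hr m).le]
          change _ ≤ (1 : ℝ)
          have := mul_le_mul_of_nonneg_left hy.le (hr m).le
          rwa [mul_inv_cancel₀ (hr m).ne'] at this)
        rw [this]; simp
      rw [(Filter.EventuallyEq.iteratedFDeriv ℝ h0 n).eq_of_nhds]
      have : iteratedFDeriv ℝ n (fun _ : E => (0 : ℂ)) x = 0 := by simp
      rw [this]
      have := (hr m).le
      simp only [norm_zero, mul_zero]; positivity
    · have hw : ContDiff ℝ ∞ fun x => (1 : ℂ) - (χ x : ℂ) := contDiff_const.sub hs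
      have hle := norm_iteratedFDeriv_mul_le (hw.comp (contDiff_const_smul (r m))) (g.smooth ⊤) x
        (n := n) (mod_cast le_top)
      -- In the outer region one extra power of `‖x‖` buys the factor `r m`, which tends to zero.
      have hx1 : 1 ≤ r m * ‖x‖ := by
        rwa [inv_le_iff_one_le_mul₀' (hr m)] at hx
      have hdi : ∀ i,
          ‖iteratedFDeriv ℝ i ((fun x => (1 : ℂ) - (χ x : ℂ)) ∘ (r m • ·)) x‖ ≤ C i := by
        intro i
        have := congrFun
          (iteratedFDeriv_comp_const_smul (r m) (i := i) (hw.of_le (mod_cast le_top))) x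
        refine (congrArg norm this).le.trans ?_
        rw [norm_smul]
        refine (mul_le_of_le_one_left (norm_nonneg _) ?_).trans (hC i _)
        rw [norm_pow, Real.norm_of_nonneg (hr m).le]
        exact pow_le_one₀ (hr m).le (hr1 m)
      calc _ ≤ ‖x‖ ^ k * ∑ i ∈ Finset.range (n + 1), (n.choose i : ℝ) *
            ‖iteratedFDeriv ℝ i ((fun x => (1 : ℂ) - (χ x : ℂ)) ∘ (r m • ·)) x‖ *
            ‖iteratedFDeriv ℝ (n - i) g x‖ := mul_le_mul_of_nonneg_left hle (by positivity)
        _ ≤ (r m * ‖x‖) * (‖x‖ ^ k * ∑ i ∈ Finset.range (n + 1), (n.choose i : ℝ) * C i *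
            ‖iteratedFDeriv ℝ (n - i) g x‖) := by
          refine le_trans ?_ (le_mul_of_one_le_left ?_ hx1)
          · gcongr with i hi
            exact hdi i
          · exact mul_nonneg (by positivity)
              (Finset.sum_nonneg fun i _ => by have := hC0 i; positivity)
        _ ≤ r m * M := by
          rw [mul_assoc, ← mul_assoc ‖x‖, ← pow_succ', Finset.mul_sum]
          refine mul_le_mul_of_nonneg_left (Finset.sum_le_sum fun i _ => ?_) (hr m).le
          rw [mul_left_comm]
          exact mul_le_mul_of_nonneg_left (g.le_seminorm ℝ (k + 1) (n - i) x)
            (mul_nonneg (by positivity) (hC0 i))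
  have hlim : Filter.Tendsto (fun m => r m * M) Filter.atTop (nhds 0) := by
    simpa [r] using (tendsto_one_div_add_atTop_nhds_zero_nat (𝕜 := ℝ)).mul_const M
  filter_upwards [hlim.eventually (gt_mem_nhds hε)] with m hm
  exact (key m).trans_lt hm

end

/-! ### Tempered integrals and the wave operator -/

/-- The Fourier transform with respect to the Minkowski product, as an operator on the Schwartz
space. -/
theorem exists_fourierPhaseCLM (n : ℕ) : ∃ Φ : 𝓢(Spacetime n, ℂ) →L[ℂ] 𝓢(Spacetime n, ℂ),
    ∀ g x, Φ g x = ∫ k, phase k x * g k := by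
  -- The scaling converts the Euclidean kernel `e^{-2πi⟨v,x⟩}` into the Minkowski phase; the time
  -- coordinate has the opposite sign.
  let c : Fin (n + 2) → ℝˣ := fun μ => if μ = 0 then
    Units.mk0 (2 * Real.pi)⁻¹ (by positivity) else -Units.mk0 (2 * Real.pi)⁻¹ (by positivity)
  let D : Spacetime n ≃L[ℝ] Spacetime n :=
    ContinuousLinearEquiv.piCongrRight fun μ => ContinuousLinearEquiv.unitsEquivAut ℝ (c μ)
  let e : EuclideanSpace ℝ (Fin (n + 2)) ≃L[ℝ] Spacetime n := EuclideanSpace.equiv _ ℝ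
  refine ⟨SchwartzMap.compCLMOfContinuousLinearEquiv ℂ (D.trans e.symm) ∘L
    FourierTransform.fourierCLM ℂ 𝓢(EuclideanSpace ℝ (Fin (n + 2)), ℂ) ∘L
    SchwartzMap.compCLMOfContinuousLinearEquiv ℂ e, fun g x => ?_⟩
  have h := (PiLp.volume_preserving_ofLp (Fin (n + 2))).integral_comp
    (MeasurableEquiv.toLp 2 (Fin (n + 2) → ℝ)).symm.measurableEmbedding fun k => phase k x * g k
  rw [← h]
  simp only [ContinuousLinearMap.comp_apply, SchwartzMap.compCLMOfContinuousLinearEquiv_apply,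
    comp_apply, FourierTransform.fourierCLM_apply, SchwartzMap.fourier_coe, Real.fourier_eq]
  refine MeasureTheory.integral_congr_ae (Filter.Eventually.of_forall fun v => ?_)
  have hv : inner ℝ v ((D.trans e.symm) x) = phaseL n (e v) x := by
    change _ = -(2 * Real.pi)⁻¹ * mdot _ _
    rw [mdot_comm, ← sum_low_mul, PiLp.inner_apply, Finset.mul_sum]
    refine Finset.sum_congr rfl fun μ _ => ?_
    change x μ * (c μ : ℝ) * v μ = _ * (_ * v μ)
    rw [low_eq]
    by_cases hμ : μ = 0 <;> simp [c, hμ] <;> ring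
  simp only [hv, Circle.smul_def, fourierChar_phaseL]
  rfl

/-- A polynomially bounded function is a tempered distribution. -/
theorem exists_integralCLM {n : ℕ} {F : Spacetime n → ℂ} (hF : Continuous F)
    {C : ℝ} {N : ℕ} (hC : ∀ x, ‖F x‖ ≤ C * (1 + ‖x‖) ^ N) :
    ∃ T : 𝓢(Spacetime n, ℂ) →L[ℂ] ℂ, ∀ u, T u = ∫ x, F x * u x := by
  -- One more than the dimension `n + 2`, so that `(1 + ‖x‖)^(-d)` is integrable.
  let d := n + 3
  have hd : MeasureTheory.Integrable fun x : Spacetime n => (1 + ‖x‖) ^ (-(d : ℝ)) :=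
    integrable_one_add_norm (by simp [d]; norm_num)
  have hC0 : 0 ≤ C := by simpa using (norm_nonneg _).trans (hC 0)
  let S : 𝓢(Spacetime n, ℂ) → ℝ := fun u => 2 ^ (N + d) *
    (Finset.Iic (N + d, 0)).sup (schwartzSeminormFamily ℂ (Spacetime n) ℂ) u
  have hb : ∀ (u : 𝓢(Spacetime n, ℂ)) x, ‖F x * u x‖ ≤ C * S u * (1 + ‖x‖) ^ (-(d : ℝ)) := by
    intro u x
    have h := SchwartzMap.one_add_le_sup_seminorm_apply (𝕜 := ℂ) (m := (N + d, 0)) le_rfl le_rfl u x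
    rw [norm_iteratedFDeriv_zero] at h
    have hp : 0 < 1 + ‖x‖ := by positivity
    rw [Real.rpow_neg hp.le, Real.rpow_natCast, ← div_eq_mul_inv,
      le_div_iff₀ (by positivity), norm_mul]
    calc _ ≤ C * (1 + ‖x‖) ^ N * ‖u x‖ * (1 + ‖x‖) ^ d := by gcongr; exact hC x
      _ = C * ((1 + ‖x‖) ^ (N + d) * ‖u x‖) := by ring
      _ ≤ C * S u := mul_le_mul_of_nonneg_left h hC0
  have hi : ∀ u : 𝓢(Spacetime n, ℂ), MeasureTheory.Integrable fun x => F x * u x := fun u =>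
    (hd.const_mul _).mono' (hF.mul u.continuous).aestronglyMeasurable
      (Filter.Eventually.of_forall (hb u))
  let I := ∫ x : Spacetime n, (1 + ‖x‖) ^ (-(d : ℝ))
  have hI : 0 ≤ I := MeasureTheory.integral_nonneg fun x => by positivity
  refine ⟨SchwartzMap.mkCLMtoNormedSpace (fun u => ∫ x, F x * u x) (fun u v => ?_) (fun a u => ?_)
    ⟨Finset.Iic (N + d, 0), C * 2 ^ (N + d) * I, by positivity, fun u => ?_⟩, fun u => rfl⟩
  · simp only [add_apply, mul_add]
    exact MeasureTheory.integral_add (hi u) (hi v)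
  · simp only [smul_apply, smul_eq_mul, mul_left_comm _ a, RingHom.id_apply]
    exact MeasureTheory.integral_const_mul _ _
  · refine (MeasureTheory.norm_integral_le_of_norm_le (hd.const_mul _)
      (Filter.Eventually.of_forall (hb u))).trans (le_of_eq ?_)
    rw [MeasureTheory.integral_const_mul]
    simp only [S, I]
    ring

/-- The wave operator on the Schwartz space. -/
theorem exists_boxCLM (n : ℕ) : ∃ B : 𝓢(Spacetime n, ℂ) →L[ℂ] 𝓢(Spacetime n, ℂ),
    ∀ g x, B g x = box g x := by
  let d : Fin (n + 2) → 𝓢(Spacetime n, ℂ) →L[ℂ] 𝓢(Spacetime n, ℂ) := fun μ =>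
    LineDeriv.lineDerivOpCLM ℂ _ (Pi.single μ (1 : ℝ) : Spacetime n)
  have hd : ∀ μ g, ⇑(d μ g) = pderiv μ g := fun μ g => rfl
  refine ⟨∑ μ, ∑ ν, (eta n μ ν : ℂ) • (d μ ∘L d ν), fun g x => ?_⟩
  simp only [sum_apply, smul_apply,
    ContinuousLinearMap.comp_apply, hd, smul_eq_mul]
  rfl

theorem integral_mul_pderiv {n : ℕ} {f u : Spacetime n → ℂ} (hf : ContDiff ℝ 1 f)
    (hu : ContDiff ℝ 1 u) (hc : HasCompactSupport u) (μ : Fin (n + 2)) :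
    ∫ x, f x * pderiv μ u x = -∫ x, pderiv μ f x * u x := by
  have hcont : ∀ {f : Spacetime n → ℂ}, ContDiff ℝ 1 f → Continuous (pderiv μ f) := fun hf =>
    (hf.continuous_fderiv (by norm_num)).clm_apply continuous_const
  refine integral_mul_fderiv_eq_neg_fderiv_mul_of_integrable ?_ ?_ ?_
    (fun x _ => hf.differentiable (by norm_num) x) (fun x _ => hu.differentiable (by norm_num) x)
  · exact ((hcont hf).mul hu.continuous).integrable_of_hasCompactSupport hc.mul_left
  · exact (hf.continuous.mul (hcont hu)).integrable_of_hasCompactSupport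
      (hc.fderiv_apply ℝ (Pi.single μ 1)).mul_left
  · exact (hf.continuous.mul hu.continuous).integrable_of_hasCompactSupport hc.mul_left

theorem integral_mul_box {n : ℕ} {f u : Spacetime n → ℂ} (hf : ContDiff ℝ 2 f)
    (hu : ContDiff ℝ 2 u) (hc : HasCompactSupport u) :
    ∫ x, f x * box u x = ∫ x, box f x * u x := by
  have hcont : ∀ {f : Spacetime n → ℂ} (μ ν), ContDiff ℝ 2 f → Continuous (pderiv μ (pderiv ν f)) :=
    fun μ ν hf =>
      ((contDiff_pderiv hf ν).continuous_fderiv (by norm_num)).clm_apply continuous_const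
  have hcp : ∀ μ, HasCompactSupport (pderiv μ u) := fun μ => hc.fderiv_apply ℝ (Pi.single μ 1)
  have h : ∀ μ ν, ∫ x, f x * pderiv μ (pderiv ν u) x = ∫ x, pderiv μ (pderiv ν f) x * u x := by
    intro μ ν
    rw [integral_mul_pderiv (hf.of_le (by norm_num)) (contDiff_pderiv hu ν) (hcp ν),
      integral_mul_pderiv (contDiff_pderiv hf μ) (hu.of_le (by norm_num)) hc, neg_neg]
    simp only [pderiv_comm hf μ ν]
  simp only [box, Finset.mul_sum, Finset.sum_mul, mul_left_comm (f _), mul_assoc]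
  have hi1 : ∀ μ ν, MeasureTheory.Integrable fun x =>
      (eta n μ ν : ℂ) * (f x * pderiv μ (pderiv ν u) x) := fun μ ν =>
    ((hf.continuous.mul (hcont μ ν hu)).integrable_of_hasCompactSupport
      ((hcp ν).fderiv_apply ℝ (Pi.single μ 1)).mul_left).const_mul _
  have hi2 : ∀ μ ν, MeasureTheory.Integrable fun x =>
      (eta n μ ν : ℂ) * (pderiv μ (pderiv ν f) x * u x) := fun μ ν =>
    (((hcont μ ν hf).mul hu.continuous).integrable_of_hasCompactSupport hc.mul_left).const_mul _
  rw [MeasureTheory.integral_finsetSum _ fun μ _ =>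
      MeasureTheory.integrable_finsetSum _ fun ν _ => hi1 μ ν,
    MeasureTheory.integral_finsetSum _ fun μ _ =>
      MeasureTheory.integrable_finsetSum _ fun ν _ => hi2 μ ν]
  refine Finset.sum_congr rfl fun μ _ => ?_
  rw [MeasureTheory.integral_finsetSum _ fun ν _ => hi1 μ ν,
    MeasureTheory.integral_finsetSum _ fun ν _ => hi2 μ ν]
  refine Finset.sum_congr rfl fun ν _ => ?_
  rw [MeasureTheory.integral_const_mul, MeasureTheory.integral_const_mul, h]

theorem box_integral_phase {n : ℕ} {c : Spacetime n → ℂ} (hc : Continuous c)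
    (hs : HasCompactSupport c) (x : Spacetime n) :
    box (fun x => ∫ k, phase k x * c k) x = -∫ k, phase k x * ((mdot k k : ℂ) * c k) := by
  have hlow : ∀ μ, Continuous fun k : Spacetime n => (low k μ : ℂ) := fun μ => by
    simp only [low_eq]
    fun_prop
  have hci : ∀ {w : Spacetime n → ℂ}, Continuous w →
      MeasureTheory.Integrable fun k => w k * c k := fun hw =>
    (hw.mul hc).integrable_of_hasCompactSupport hs.mul_left
  have h2 : ∀ μ ν, pderiv μ (pderiv ν fun x => ∫ k, phase k x * c k) x =
      ∫ k, phase k x * (-((low k μ : ℂ) * (low k ν : ℂ)) * c k) := fun μ ν => by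
    have h1 : (pderiv ν fun x => ∫ k, phase k x * c k) =
        fun x => ∫ k, phase k x * (Complex.I * ((low k ν : ℂ) * c k)) :=
      funext fun y => pderiv_integral_phase (hci (by fun_prop)) ν y
    rw [h1, pderiv_integral_phase]
    · refine MeasureTheory.integral_congr_ae (Filter.Eventually.of_forall fun k => ?_)
      linear_combination (phase k x * (low k μ : ℂ) * (low k ν : ℂ) * c k) * Complex.I_sq
    · have := hlow ν
      simpa only [mul_assoc] using hci (w := fun k => ((1 + ‖k‖ ^ 2 : ℝ) : ℂ) *
        (Complex.I * (low k ν : ℂ))) (by fun_prop)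
  have hi : ∀ μ ν, MeasureTheory.Integrable fun k =>
      (eta n μ ν : ℂ) * (phase k x * (-((low k μ : ℂ) * (low k ν : ℂ)) * c k)) := fun μ ν => by
    have := hlow μ
    have := hlow ν
    exact (integrable_phase_mul (hci (by fun_prop)) x).const_mul _
  simp only [box, h2, ← MeasureTheory.integral_const_mul]
  simp only [← MeasureTheory.integral_finsetSum _ fun ν _ => hi _ ν]
  rw [← MeasureTheory.integral_finsetSum _ fun μ _ =>
    MeasureTheory.integrable_finsetSum _ fun ν _ => hi μ ν, ← MeasureTheory.integral_neg]
  refine MeasureTheory.integral_congr_ae (Filter.Eventually.of_forall fun k => ?_)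
  have h := sum_eta_low_mul k fun ν => (low k ν : ℂ) * (phase k x * c k)
  simp only [← mul_assoc, ← Finset.sum_mul] at h ⊢
  have hk : ∑ β, (k β : ℂ) * (low k β : ℂ) = (mdot k k : ℂ) := by
    rw [← sum_low_mul]
    push_cast
    exact Finset.sum_congr rfl fun _ _ => mul_comm _ _
  rw [hk] at h
  simp only [mul_neg, neg_mul, Finset.sum_neg_distrib, Finset.sum_mul] at h ⊢
  rw [show phase k x * (mdot k k : ℂ) * c k = (mdot k k : ℂ) * phase k x * c k by ring, ← h]
  refine congrArg Neg.neg (Finset.sum_congr rfl fun μ _ => Finset.sum_congr rfl fun ν _ => ?_)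
  ring

/-- For test functions of compact support this is integration by parts. The polynomial bound makes
the pairing continuous on the Schwartz space, so density extends it. -/
theorem integral_mul_box_eq_zero {n : ℕ} {F : Spacetime n → ℂ} (hF : ContDiff ℝ 2 F)
    {C : ℝ} {N : ℕ} (hC : ∀ x, ‖F x‖ ≤ C * (1 + ‖x‖) ^ N) (hbox : ∀ x, box F x = 0)
    (u : 𝓢(Spacetime n, ℂ)) : ∫ x, F x * box u x = 0 := by
  obtain ⟨T, hT⟩ := exists_integralCLM hF.continuous hC
  obtain ⟨B, hB⟩ := exists_boxCLM n
  obtain ⟨v, hv, -, hlim⟩ := exists_tendsto_hasCompactSupport u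
  have h : ∀ u, T (B u) = ∫ x, F x * box u x := fun u => by simp only [hT, hB]
  have h0 : ∀ m, T (B (v m)) = 0 := fun m => by
    rw [h, integral_mul_box hF ((v m).smooth 2) (hv m)]
    simp [hbox]
  rw [← h]
  refine tendsto_nhds_unique (((T ∘L B).continuous.tendsto u).comp hlim) ?_
  exact tendsto_const_nhds.congr fun m => (h0 m).symm

/-- At a point of the closed support the denominator is nonzero; at any other point the function
vanishes in a neighbourhood. -/
theorem contDiff_mdot_div {n : ℕ} {g : Spacetime n → ℂ} (hd : ContDiff ℝ ∞ g)
    (hg : ∀ k ∈ tsupport g, mdot k k ≠ 0) : ContDiff ℝ ∞ fun k => (mdot k k : ℂ)⁻¹ * g k := by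
  have hm : ContDiff ℝ ∞ fun k : Spacetime n => (mdot k k : ℂ) := by
    simp only [mdot_eq_sum]
    push_cast
    exact ContDiff.sum fun i _ => by
      have hi : ContDiff ℝ ∞ fun k : Spacetime n => (k i : ℂ) :=
        Complex.ofRealCLM.contDiff.comp (contDiff_apply ℝ ℝ i)
      fun_prop
  refine contDiff_iff_contDiffAt.2 fun k => ?_
  by_cases hk : k ∈ tsupport g
  · exact (hm.contDiffAt.inv (Complex.ofReal_ne_zero.2 (hg k hk))).mul hd.contDiffAt
  · refine (contDiffAt_const (c := (0 : ℂ))).congr_of_eventuallyEq ?_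
    filter_upwards [notMem_tsupport_iff_eventuallyEq.1 hk] with y hy
    simp [hy]

/-- The Fourier transform of a polynomially bounded solution of the wave equation is supported on
the light-cone. -/
theorem integral_mul_fourier_eq_zero {n : ℕ} {F : Spacetime n → ℂ} (hF : ContDiff ℝ 2 F)
    {C : ℝ} {N : ℕ} (hC : ∀ x, ‖F x‖ ≤ C * (1 + ‖x‖) ^ N) (hbox : ∀ x, box F x = 0)
    {g : SchwartzMap (Spacetime n) ℂ} (hg : ∀ k ∈ tsupport g, mdot k k ≠ 0) :
    (∫ x, F x * (∫ k, phase k x * g k)) = 0 := by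
  obtain ⟨T, hT⟩ := exists_integralCLM hF.continuous hC
  obtain ⟨Φ, hΦ⟩ := exists_fourierPhaseCLM n
  obtain ⟨v, hv, hvg, hlim⟩ := exists_tendsto_hasCompactSupport g
  have h : ∀ u, T (Φ u) = ∫ x, F x * ∫ k, phase k x * u k := fun u => by simp only [hT, hΦ]
  have h0 : ∀ m, T (Φ (v m)) = 0 := fun m => by
    have hd := contDiff_mdot_div ((v m).smooth ⊤) fun k hk => hg k (hvg m hk)
    have hs : HasCompactSupport fun k => (mdot k k : ℂ)⁻¹ * v m k := (hv m).mul_left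
    -- Division by `k·k` is possible since the support avoids the cone; the transform of `v m` is
    -- then minus the wave operator applied to that of `w`.
    let w : 𝓢(Spacetime n, ℂ) := hs.toSchwartzMap hd
    have hw : ∀ k, (mdot k k : ℂ) * w k = v m k := fun k => by
      by_cases hk : k ∈ tsupport (v m)
      · exact mul_inv_cancel_left₀ (Complex.ofReal_ne_zero.2 (hg k (hvg m hk))) _
      · change _ * (_ * v m k) = _
        simp [image_eq_zero_of_notMem_tsupport hk]
    have hb := integral_mul_box_eq_zero hF hC hbox (Φ w)
    have hΦw : ⇑(Φ w) = fun x => ∫ k, phase k x * w k := funext (hΦ w)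
    simp only [hΦw, box_integral_phase w.continuous hs, hw, mul_neg, MeasureTheory.integral_neg,
      neg_eq_zero] at hb
    rw [h, hb]
  rw [← h]
  refine tendsto_nhds_unique (((T ∘L Φ).continuous.tendsto g).comp hlim) ?_
  exact tendsto_const_nhds.congr fun m => (h0 m).symm

end LightCone

end

/-! ### The main theorem -/

open LightCone in
theorem mainTheorem10 (n p q : ℕ) (hqp : q ≤ p) (hn : p + q ≤ n) :
    -- harmonic multiforms satisfy the wave equation
    (∀ K ∈ harmonicMultiforms n p q, ∀ α β x, box (fun y => K y α β) x = 0) ∧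
    -- the Fourier transform of a tempered harmonic multiform is supported on the light-cone
    (∀ K ∈ harmonicMultiforms n p q,
      (∃ (C : ℝ) (N : ℕ), ∀ x α β, ‖K x α β‖ ≤ C * (1 + ‖x‖) ^ N) →
      ∀ g : SchwartzMap (Spacetime n) ℂ, (∀ k ∈ tsupport g, mdot k k ≠ 0) →
      ∀ α β, (∫ x, K x α β * (∫ k, phase k x * g k)) = 0) ∧
    -- a superposition of plane waves is harmonic iff its modes are
    (∀ (m : MeasureTheory.Measure (Spacetime n))
      (f : Spacetime n → BiTensor (Fin (n + 2)) (p + 1) (q + 1)),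
      (∀ α β, MeasureTheory.Integrable (fun k => ((1 + ‖k‖ ^ 2 : ℝ) : ℂ) * f k α β) m) →
      (superposition m f ∈ harmonicMultiforms n p q ↔
        ∀ᵐ k ∂m, planeWave k (f k) ∈ momentumSolutions n p q k)) ∧
    -- there are no modes off the light-cone
    (∀ k : Spacetime n, mdot k k ≠ 0 → momentumSolutions n p q k = ⊥) ∧
    -- the module `[p,q]` of `O(D-2)` and the modes on the light-cone
    ∃ τ : Subrepresentation (orthogonalRep n p q),
      τ.toSubmodule = youngTraceless (1 : Matrix (Fin n) (Fin n) ℝ) p q ∧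
      τ.toRepresentation.IsIrreducible ∧ IsUnitary τ.toRepresentation ∧
      ∀ k : Spacetime n, k ≠ 0 → mdot k k = 0 →
        ∃ σ : Subrepresentation ((fieldRep n (p + 1) (q + 1)).comp (stabilizer k).subtype),
          σ.toSubmodule = momentumSolutions n p q k ∧
          (∀ K ∈ σ.toSubmodule, K = planeWave k (K 0)) ∧
          σ.toRepresentation.IsIrreducible ∧ IsUnitary σ.toRepresentation ∧
          (∃ E : Frame n, E.Adapted k) ∧
          ∀ E : Frame n, E.Adapted k →
            ∃ r : stabilizer k →* Matrix.orthogonalGroup (Fin n) ℝ,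
              (∀ g i j, (r g).1 i j =
                mdot (E.trans i) (lorentzMatrix n g.1 *ᵥ E.trans j)) ∧
              (∀ A, ∃ g, r g = A ∧ lorentzMatrix n g.1 *ᵥ E.minus = E.minus) ∧
              ∃ L : σ.toSubmodule ≃ₗ[ℂ] τ.toSubmodule,
                (∀ K, (L K).1 = E.components k (K.1 0)) ∧
                (∀ g K, L (σ.toRepresentation g K) = τ.toRepresentation (r g) (L K)) := by
  refine ⟨fun K hK α β x => box_eq_zero hK α β x, fun K hK hb g hg α β => ?_, fun m f hf => ?_,
    fun k hk => momentumSolutions_eq_bot hk, youngRep n p q, rfl, youngRep_isIrreducible hqp hn,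
    youngRep_isUnitary n p q, fun k hk hkk => ?_⟩
  · obtain ⟨C, N, hC⟩ := hb
    exact integral_mul_fourier_eq_zero (hK.1 α β) (fun x => hC x α β) (box_eq_zero hK α β) hg
  · rw [superposition_mem_iff m f hf]
    exact Filter.eventually_congr (Filter.Eventually.of_forall fun k => planeWave_mem_iff.symm)
  -- Irreducibility and unitarity do not refer to a frame, so a single adapted one suffices to
  -- transport them.
  obtain ⟨E₀, hE₀⟩ := exists_adapted hk hkk
  have hr : Function.Surjective (hE₀.toOrthogonal hk) := fun A =>
    (hE₀.exists_toOrthogonal_eq hk A).imp fun _ h => h.1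
  refine ⟨modeRep n p q k, rfl, fun K hK => eq_planeWave_of_mem hK,
    isIrreducible_of_equiv (hE₀.equivYoung hk hqp hn) (hE₀.toOrthogonal hk) hr
      (hE₀.toYoung_intertwines hk) (youngRep_isIrreducible hqp hn),
    isUnitary_of_equiv (hE₀.equivYoung hk hqp hn) (hE₀.toOrthogonal hk)
      (hE₀.continuous_toOrthogonal hk) (hE₀.toYoung_intertwines hk) (youngRep_isUnitary n p q),
    ⟨E₀, hE₀⟩, fun E hE => ⟨hE.toOrthogonal hk, hE.toOrthogonal_apply hk,
      hE.exists_toOrthogonal_eq hk, hE.equivYoung hk hqp hn, hE.toYoung_apply hk,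
      hE.toYoung_intertwines hk⟩⟩
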